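/- A (finite) mixed multigraph is a multigraph in which each edge is either undirected or directed. A walk traverses undirected edges in either direction and directed edges along their direction; $d_G(u,v)$ is the length (number of edges) of a shortest path from $u$ to $v$. The eccentricity of a vertex $u$ is $\max_v \max\{d_G(u,v), d_G(v,u)\}$, and the radius of $G$ is the minimum eccentricity of a vertex. $G$ is strongly connected if every vertex can be reached from every vertex. It is bridgeless if it has no bridge, where a bridge is an undirected edge whose removal disconnects the underlying undirected multigraph. An orientation of $G$ assigns exactly one direction to each undirected edge of $G$. For $r \in \mathbb{N}$ let $f(r)$ be the smallest number such that every strongly connected bridgeless mixed multigraph of radius $r$ can be oriented to a strongly connected digraph of radius at most $f(r)$. Theorem. For every $r \in \mathbb{N}$, $f(r) \le 1.5r^2 + r + 1$; that is, every strongly connected bridgeless mixed multigraph of radius $r$ has a strongly connected orientation of radius at most $1.5r^2 + r + 1$. Moreover, there is a polynomial-time algorithm which, given such a mixed multigraph, finds such an orientation: it runs on a unit-cost random access machine with addition and truncated subtraction, and its number of steps is bounded by a polynomial in the number of vertices plus the number of edges. -/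

import Mathlib

open scoped ENNReal

/-- A mixed multigraph with vertex set `V` and edge set `E` (parallel edges and loops are allowed).
An edge `e` with `directed e = true` is directed from `fst e` to `snd e`; an edge with
`directed e = false` is undirected with endpoints `fst e` and `snd e`, listed in an immaterial
order. -/
structure MixedMultigraph (V : Type*) (E : Type*) where
  fst : E → V
  snd : E → V
  directed : E → Bool

namespace MixedMultigraph

variable {V E : Type*}

/-- The edge `e` may be traversed from `u` to `v`: along its direction if it is directed, both ways
if it is undirected. -/
def Traverses (G : MixedMultigraph V E) (e : E) (u v : V) : Prop :=
  (G.fst e = u ∧ G.snd e = v) ∨ (G.directed e = false ∧ G.fst e = v ∧ G.snd e = u)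

/-- `G.HasWalk k u v`: there is a walk with exactly `k` edges from `u` to `v`. -/
inductive HasWalk (G : MixedMultigraph V E) : ℕ → V → V → Prop
  | nil (u : V) : HasWalk G 0 u u
  | cons {k : ℕ} {u v w : V} (e : E) (h : G.Traverses e u v) (p : HasWalk G k v w) :
      HasWalk G (k + 1) u w

/-- Each vertex can be reached from each vertex. -/
def StronglyConnected (G : MixedMultigraph V E) : Prop :=
  ∀ u v : V, ∃ k : ℕ, G.HasWalk k u v

/-- The distance from `u` to `v`, i.e. the length of a shortest path (equivalently, of a shortest
walk, since a shortest walk is a path); it is `⊤` if there is none. -/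
noncomputable def edist (G : MixedMultigraph V E) (u v : V) : ℕ∞ :=
  ⨅ (k : ℕ) (_ : G.HasWalk k u v), (k : ℕ∞)

noncomputable def outEcc (G : MixedMultigraph V E) (u : V) : ℕ∞ := ⨆ v, G.edist u v

noncomputable def inEcc (G : MixedMultigraph V E) (u : V) : ℕ∞ := ⨆ v, G.edist v u

noncomputable def ecc (G : MixedMultigraph V E) (u : V) : ℕ∞ := max (G.outEcc u) (G.inEcc u)

/-- The minimum eccentricity of a vertex; it is `⊤` if `G` is not strongly connected. -/
noncomputable def radius (G : MixedMultigraph V E) : ℕ∞ := ⨅ u, G.ecc u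

/-- The underlying undirected multigraph. -/
def underlying (G : MixedMultigraph V E) : MixedMultigraph V E where
  fst := G.fst
  snd := G.snd
  directed := fun _ => false

/-- The graph `G - e`. -/
def deleteEdge (G : MixedMultigraph V E) (e : E) : MixedMultigraph V {e' : E // e' ≠ e} where
  fst := fun e' => G.fst e'
  snd := fun e' => G.snd e'
  directed := fun e' => G.directed e'

/-- A bridge is an undirected edge whose removal disconnects the graph, i.e. leaves a graph whose
underlying undirected multigraph is disconnected. -/
def IsBridge (G : MixedMultigraph V E) (e : E) : Prop :=
  G.directed e = false ∧ ¬ (G.deleteEdge e).underlying.StronglyConnected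

def Bridgeless (G : MixedMultigraph V E) : Prop := ∀ e : E, ¬ G.IsBridge e

/-- The orientation of `G` given by `σ`: directed edges keep their direction, an undirected edge
`e` is directed from `fst e` to `snd e` if `σ e = false`, and from `snd e` to `fst e` if
`σ e = true`. Every orientation of `G` is of this form. -/
def orient (G : MixedMultigraph V E) (σ : E → Bool) : MixedMultigraph V E where
  fst := fun e => if G.directed e = false ∧ σ e = true then G.snd e else G.fst e
  snd := fun e => if G.directed e = false ∧ σ e = true then G.fst e else G.snd e
  directed := fun _ => true

/-- The smallest `k` such that each strongly connected bridgeless finite mixed multigraph of radius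
`r` can be oriented to a strongly connected digraph of radius at most `k` (`⊤` if there is none). -/
noncomputable def worstOrientedRadius (r : ℕ) : ℕ∞ :=
  sInf {k : ℕ∞ | ∀ (V E : Type) [Finite V] [Finite E] (G : MixedMultigraph V E),
    G.StronglyConnected → G.Bridgeless → G.radius = r →
      ∃ σ : E → Bool, (G.orient σ).StronglyConnected ∧ (G.orient σ).radius ≤ k}

end MixedMultigraph

/-! A random access machine, programmed in a structured language with natural-number variables and
one-dimensional arrays. The only arithmetic operations are addition and truncated subtraction, so in
`t` steps only numbers with `O(t)` more bits than the input numbers and the constants of the program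
arise, and unit-cost polynomial time is polynomial time on a Turing machine. -/

namespace RAM

/-- A memory state: the values of the variables, and the contents of the arrays. -/
structure State where
  var : ℕ → ℕ
  arr : ℕ → ℕ → ℕ

inductive Expr
  | lit (c : ℕ)
  | var (x : ℕ)
  | arr (a : ℕ) (i : Expr)
  | add (e₁ e₂ : Expr)
  | sub (e₁ e₂ : Expr)

namespace Expr

def eval (s : State) : Expr → ℕ
  | lit c => c
  | var x => s.var x
  | arr a i => s.arr a (eval s i)
  | add e₁ e₂ => eval s e₁ + eval s e₂
  | sub e₁ e₂ => eval s e₁ - eval s e₂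

/-- The number of steps taken to evaluate an expression: one for each of its nodes. -/
def cost : Expr → ℕ
  | lit _ => 1
  | var _ => 1
  | arr _ i => cost i + 1
  | add e₁ e₂ => cost e₁ + cost e₂ + 1
  | sub e₁ e₂ => cost e₁ + cost e₂ + 1

end Expr

inductive Program
  | skip
  /-- set variable `x` to `e` -/
  | assign (x : ℕ) (e : Expr)
  /-- set entry `i` of array `a` to `e` -/
  | store (a : ℕ) (i e : Expr)
  | seq (p q : Program)
  /-- run `p` if `c` is nonzero, and `q` otherwise -/
  | cond (c : Expr) (p q : Program)
  /-- run `p` as long as `c` is nonzero -/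
  | loop (c : Expr) (p : Program)

/-- `Exec p s s' t`: started in state `s`, the program `p` halts in state `s'` after `t` steps. -/
inductive Exec : Program → State → State → ℕ → Prop
  | skip (s : State) : Exec .skip s s 1
  | assign (x : ℕ) (e : Expr) (s : State) :
      Exec (.assign x e) s
        ⟨Function.update s.var x (e.eval s), s.arr⟩ (e.cost + 1)
  | store (a : ℕ) (i e : Expr) (s : State) :
      Exec (.store a i e) s
        ⟨s.var, Function.update s.arr a (Function.update (s.arr a) (i.eval s) (e.eval s))⟩
        (i.cost + e.cost + 1)
  | seq {p q : Program} {s s' s'' : State} {t t' : ℕ} (h : Exec p s s' t) (h' : Exec q s' s'' t') :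
      Exec (.seq p q) s s'' (t + t')
  | condTrue {c : Expr} {p q : Program} {s s' : State} {t : ℕ} (hc : c.eval s ≠ 0)
      (h : Exec p s s' t) : Exec (.cond c p q) s s' (c.cost + 1 + t)
  | condFalse {c : Expr} {p q : Program} {s s' : State} {t : ℕ} (hc : c.eval s = 0)
      (h : Exec q s s' t) : Exec (.cond c p q) s s' (c.cost + 1 + t)
  | loopDone {c : Expr} {p : Program} {s : State} (hc : c.eval s = 0) :
      Exec (.loop c p) s s (c.cost + 1)
  | loopStep {c : Expr} {p : Program} {s s' s'' : State} {t t' : ℕ} (hc : c.eval s ≠ 0)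
      (h : Exec p s s' t) (h' : Exec (.loop c p) s' s'' t') :
      Exec (.loop c p) s s'' (c.cost + 1 + t + t')

/-- The initial state for the input `G`: the numbers `n` of vertices and `m` of edges are in
variables `0` and `1`; entry `e < m` of the arrays `0`, `1`, `2` holds the first endpoint of edge
`e`, its second endpoint, and the bit telling whether it is directed; all else is zero. -/
def input {n m : ℕ} (G : MixedMultigraph (Fin n) (Fin m)) : State where
  var := fun x => if x = 0 then n else if x = 1 then m else 0
  arr := fun a i =>
    if h : i < m then
      if a = 0 then (G.fst ⟨i, h⟩ : ℕ)
      else if a = 1 then (G.snd ⟨i, h⟩ : ℕ)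
      else if a = 2 then (G.directed ⟨i, h⟩).toNat
      else 0
    else 0

/-- The output in state `s`: edge `e` is to be reversed iff entry `e` of array `3` is nonzero. -/
def output (m : ℕ) (s : State) : Fin m → Bool := fun e => decide (s.arr 3 e ≠ 0)

end RAM

namespace ArcSystem

variable {V α : Type*}

/-- The vertices that can be reached from `A` by at most `k` arcs of `W`, where the arc `a` leads
from `t a` to `h a`. -/
def reach (t h : α → V) (W : Set α) (A : Set V) : ℕ → Set V
  | 0 => A
  | k + 1 => reach t h W A k ∪ {x | ∃ a ∈ W, t a ∈ reach t h W A k ∧ h a = x}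

variable {t h : α → V} {W W' : Set α} {A A' : Set V} {k l : ℕ} {x y : V}

theorem reach_zero : reach t h W A 0 = A := rfl

theorem mem_reach_succ :
    x ∈ reach t h W A (k + 1) ↔ x ∈ reach t h W A k ∨ ∃ a ∈ W, t a ∈ reach t h W A k ∧ h a = x :=
  Iff.rfl

theorem reach_step {a : α} (ha : a ∈ W) (hk : t a ∈ reach t h W A k) :
    h a ∈ reach t h W A (k + 1) := Or.inr ⟨a, ha, hk, rfl⟩

theorem reach_mono_right (hkl : k ≤ l) : reach t h W A k ⊆ reach t h W A l := by
  induction hkl with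
  | refl => exact subset_rfl
  | step _ ih => exact ih.trans fun x hx => Or.inl hx

theorem reach_mono (hW : W ⊆ W') (hA : A ⊆ A') : reach t h W A k ⊆ reach t h W' A' k := by
  induction k with
  | zero => exact hA
  | succ k ih =>
    rintro x (hx | ⟨a, ha, hta, rfl⟩)
    · exact Or.inl (ih hx)
    · exact Or.inr ⟨a, hW ha, ih hta, rfl⟩

theorem subset_reach : A ⊆ reach t h W A k := reach_mono_right (k := 0) (Nat.zero_le k)

theorem reach_reach : reach t h W (reach t h W A k) l = reach t h W A (k + l) := by
  induction l with
  | zero => rfl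
  | succ l ih => ext x; rw [mem_reach_succ, ih, ← add_assoc, mem_reach_succ]

theorem reach_le_of_subset (hA : A ⊆ reach t h W A' k) :
    reach t h W A l ⊆ reach t h W A' (k + l) := by
  rw [← reach_reach]; exact reach_mono subset_rfl hA

theorem reach_trans (hx : x ∈ reach t h W A k) (hy : y ∈ reach t h W {x} l) :
    y ∈ reach t h W A (k + l) :=
  reach_le_of_subset (Set.singleton_subset_iff.2 hx) hy

theorem reach_symm_aux : ∀ {k : ℕ} {x y : V}, y ∈ reach t h W {x} k → x ∈ reach h t W {y} k
  | 0, x, y, hy => by rw [reach_zero] at *; exact (Set.mem_singleton_iff.1 hy).symm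
  | k + 1, x, y, hy => by
    rcases hy with hy | ⟨a, ha, hta, rfl⟩
    · exact Or.inl (reach_symm_aux hy)
    · have h1 : t a ∈ reach h t W {h a} 1 := reach_step ha (Set.mem_singleton _)
      have := reach_trans h1 (reach_symm_aux hta)
      rwa [add_comm] at this

theorem reach_symm : y ∈ reach t h W {x} k ↔ x ∈ reach h t W {y} k :=
  ⟨reach_symm_aux, reach_symm_aux⟩

/-- Paths may be followed backwards from an endpoint that lies in the base set. -/
theorem mem_reach_of_reach (hy : y ∈ reach t h W {x} k) (hA : y ∈ reach h t W A l) :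
    x ∈ reach h t W A (l + k) := reach_trans hA (reach_symm.1 hy)

theorem reach_subset {S : Set V} (hA : A ⊆ S) (hW : ∀ a ∈ W, t a ∈ S → h a ∈ S) :
    reach t h W A k ⊆ S := by
  induction k with
  | zero => exact hA
  | succ k ih =>
    rintro x (hx | ⟨a, ha, hta, rfl⟩)
    · exact ih hx
    · exact hW a ha (ih hta)

/-- Deleting an arc out of `A` and its reverse only affects the vertices near the head. -/
theorem reach_diff_pair {G : Set α} {a b : α} (hta : h b ∈ A) (hx : x ∈ reach t h G A k) :
    x ∈ reach t h (G \ {a, b}) A k ∨ ∃ i, i + 1 = k ∧ x ∈ reach t h (G \ {a, b}) {h a} i := by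
  induction k generalizing x with
  | zero => exact Or.inl hx
  | succ k ih =>
    rcases hx with hx | ⟨c, hc, htc, rfl⟩
    · rcases ih hx with h1 | ⟨i, hi, h1⟩
      · exact Or.inl (Or.inl h1)
      · exact Or.inr ⟨k, rfl, reach_mono_right (by omega) h1⟩
    · by_cases hca : c = a
      · exact Or.inr ⟨k, rfl, subset_reach (by simp [hca])⟩
      by_cases hcb : c = b
      · exact Or.inl (subset_reach (by rwa [hcb]))
      have hc' : c ∈ G \ {a, b} := ⟨hc, by simp [hca, hcb]⟩
      rcases ih htc with h1 | ⟨i, hi, h1⟩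
      · exact Or.inl (reach_step hc' h1)
      · exact Or.inr ⟨k, rfl, hi ▸ reach_step hc' h1⟩

/-- A path into `A` splits into a path outside `A` and an arc into `A`. -/
theorem exists_last_arc (hx : x ∈ reach h t W A k) (hxA : x ∉ A) :
    ∃ f ∈ W, h f ∈ A ∧ t f ∉ A ∧ ∃ i, i + 1 = k ∧
      x ∈ reach h t {b ∈ W | t b ∉ A ∧ h b ∉ A} {t f} i := by
  induction k generalizing x with
  | zero => exact absurd hx hxA
  | succ k ih =>
    have key : x ∈ reach h t W A k → ∃ f ∈ W, h f ∈ A ∧ t f ∉ A ∧ ∃ i, i + 1 = k + 1 ∧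
      x ∈ reach h t {b ∈ W | t b ∉ A ∧ h b ∉ A} {t f} i := by
      intro hx
      obtain ⟨f, hf, h1, h2, i, hi, h3⟩ := ih hx hxA
      exact ⟨f, hf, h1, h2, k, rfl, reach_mono_right (by omega) h3⟩
    rcases hx with hx | ⟨a, ha, hha, rfl⟩
    · exact key hx
    · by_cases hA : h a ∈ A
      · exact ⟨a, ha, hA, hxA, k, rfl, subset_reach rfl⟩
      · obtain ⟨f, hf, h1, h2, i, hi, h3⟩ := ih hha hA
        refine ⟨f, hf, h1, h2, k, rfl, ?_⟩
        rw [← hi]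
        exact reach_step (t := h) (h := t) (a := a) ⟨ha, hxA, hA⟩ h3

section Level

variable (t h) (G : Set α) (rev : α → α) (A : Set V)

/-- The arcs that lead out of `A` along an undirected edge. -/
def undirOut : Set α := {a | a ∈ G ∧ rev a ∈ G ∧ t a ∈ A ∧ h a ∉ A}

/-- The arcs that remain when the undirected edges between `A` and its complement are oriented out
of `A` if they belong to `O`, and into `A` otherwise. -/
def cut (O : Set α) : Set α := {b | b ∈ G ∧ rev b ∉ O ∧ (b ∈ undirOut t h G rev A → b ∈ O)}

def entering (W : Set α) : Set V := {x | ∃ b ∈ W, t b ∉ A ∧ h b ∈ A ∧ t b = x}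

def leaving (W : Set α) : Set V := {x | ∃ b ∈ W, t b ∈ A ∧ h b ∉ A ∧ h b = x}

/-- The arcs that go up a level of the breadth-first search from `A`. -/
def ascending (N : ℕ) (W : Set α) (A : Set V) : Set α :=
  {b | b ∈ W ∧ ∃ k ≤ N, t b ∈ reach t h W A k ∧ h b ∉ reach t h W A k}

/-- `A` and the vertices on shortest paths from `A` to `Z`. -/
def span (N : ℕ) (W : Set α) (A Z : Set V) : Set V :=
  A ∪ reach h t (ascending t h N W A) Z N

def spanArcs (N : ℕ) (W : Set α) (A Z : Set V) : Set α :=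
  {b | b ∈ ascending t h N W A ∧ h b ∈ span t h N W A Z}

/-- The undirected edges that can be oriented out of `A` at a moderate cost. -/
def returning (L : ℕ) : Set α :=
  {a | a ∈ undirOut t h G rev A ∧ h a ∈ reach h t (G \ {a, rev a}) A L}

def Reentrant (L : ℕ) (O : Set α) : Prop :=
  entering t h A (cut t h G rev A O) ⊆ reach t h (cut t h G rev A O) A L

end Level

section Span

variable {N L : ℕ} {Z : Set V}

theorem ascending_level {b : α} (hb : b ∈ ascending t h N W A) {i : ℕ}
    (hi : h b ∈ reach t h W A i) : ∃ k < i, t b ∈ reach t h W A k := by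
  obtain ⟨_, k, -, h1, h2⟩ := hb
  refine ⟨k, ?_, h1⟩
  by_contra hk
  exact h2 (reach_mono_right (by omega) hi)

theorem span_level (hZ : Z ⊆ reach t h W A L) {j : ℕ}
    (hx : x ∈ reach h t (ascending t h N W A) Z j) :
    ∃ i ≤ L, x ∈ reach t h W A i ∧ x ∈ reach h t (ascending t h N W A) Z (L - i) := by
  induction j generalizing x with
  | zero => exact ⟨L, le_rfl, hZ hx, subset_reach hx⟩
  | succ j ih =>
    rcases hx with hx | ⟨b, hb, hhb, rfl⟩
    · exact ih hx
    · obtain ⟨i, hi, h1, h2⟩ := ih hhb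
      obtain ⟨k, hk, h3⟩ := ascending_level hb h1
      refine ⟨k, by omega, h3, reach_mono_right ?_ (reach_step (t := h) (h := t) hb h2)⟩
      omega

theorem tail_mem_span (hZ : Z ⊆ reach t h W A L) (hLN : L ≤ N) {b : α}
    (hb : b ∈ spanArcs t h N W A Z) : t b ∈ span t h N W A Z := by
  obtain ⟨hb, hA | hN⟩ := hb
  · obtain ⟨k, hk, -⟩ := ascending_level hb (i := 0) hA
    omega
  · have := reach_step (t := h) (h := t) hb hN
    obtain ⟨i, hi, -, h2⟩ := span_level hZ this
    exact Or.inr (reach_mono_right (by omega) h2)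

theorem span_reach (hZ : Z ⊆ reach t h W A L) (hLN : L ≤ N) {i : ℕ} (hiN : i ≤ N)
    (hx : x ∈ span t h N W A Z) (hi : x ∈ reach t h W A i) :
    x ∈ reach t h (spanArcs t h N W A Z) A i := by
  induction i generalizing x with
  | zero => exact hi
  | succ i ih =>
    by_cases hxi : x ∈ reach t h W A i
    · exact Or.inl (ih (by omega) hx hxi)
    · rcases hi with hi | ⟨b, hb, htb, rfl⟩
      · exact absurd hi hxi
      · have hb' : b ∈ spanArcs t h N W A Z := ⟨⟨hb, i, by omega, htb, hxi⟩, hx⟩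
        exact reach_step hb' (ih (by omega) (tail_mem_span hZ hLN hb') htb)

theorem span_coreach {j : ℕ} (hj : j ≤ N)
    (hx : x ∈ reach h t (ascending t h N W A) Z j) :
    x ∈ reach h t (spanArcs t h N W A Z) Z j := by
  induction j generalizing x with
  | zero => exact hx
  | succ j ih =>
    rcases hx with hx | ⟨b, hb, hhb, rfl⟩
    · exact Or.inl (ih (by omega) hx)
    · exact reach_step (t := h) (h := t)
        (⟨hb, Or.inr (reach_mono_right (by omega) hhb)⟩ : b ∈ spanArcs t h N W A Z)
        (ih (by omega) hhb)

theorem exists_level_of_mem_span (hZ : Z ⊆ reach t h W A L) (hLN : L ≤ N)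
    (hx : x ∈ span t h N W A Z) (hxA : x ∉ A) :
    ∃ i, 1 ≤ i ∧ i ≤ L ∧ x ∈ reach t h (spanArcs t h N W A Z) A i ∧
      x ∈ reach h t (spanArcs t h N W A Z) Z (L - i) := by
  have hx' := hx.resolve_left hxA
  obtain ⟨i, hi, h1, h2⟩ := span_level hZ hx'
  refine ⟨i, ?_, hi, span_reach hZ hLN (by omega) hx h1, span_coreach (by omega) h2⟩
  rcases Nat.eq_zero_or_pos i with rfl | h0
  · exact absurd h1 hxA
  · exact h0

theorem mem_span_of_mem (hx : x ∈ Z) : x ∈ span t h N W A Z := Or.inr (subset_reach hx)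

theorem not_mem_of_ascending {b : α} (hb : b ∈ ascending t h N W A) : h b ∉ A := fun hA => by
  obtain ⟨k, hk, -⟩ := ascending_level hb (i := 0) hA
  omega

theorem ascending_antisymm {b c : α} (hb : b ∈ ascending t h N W A)
    (hc : c ∈ ascending t h N W A) (h1 : t c = h b) (h2 : h c = t b) : False := by
  obtain ⟨_, k, -, hb1, hb2⟩ := hb
  obtain ⟨_, l, -, hc1, hc2⟩ := hc
  rw [h1] at hc1; rw [h2] at hc2
  rcases le_total k l with hkl | hkl
  · exact hc2 (reach_mono_right hkl hb1)
  · exact hb2 (reach_mono_right hkl hc1)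

end Span

end ArcSystem

namespace ArcSystem

variable {V α : Type*}

/-- The arcs `G` of a bridgeless mixed graph: an edge is undirected if both of its arcs `a` and
`rev a` belong to `G`. The ambient arcs are `E`, and the vertices are `S`. -/
structure Bridgefree (t h : α → V) (rev : α → α) (E G : Set α) (S : Set V) : Prop where
  subset : G ⊆ E
  tail_mem : ∀ a ∈ E, t a ∈ S
  rev_mem : ∀ a ∈ E, rev a ∈ E
  rev_rev : ∀ a ∈ E, rev (rev a) = a
  tail_rev : ∀ a ∈ E, t (rev a) = h a
  crossing : ∀ a ∈ G, rev a ∈ G → ∀ B : Set V, t a ∈ B → h a ∉ B →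
    ∃ b ∈ G, b ≠ a ∧ b ≠ rev a ∧ ((t b ∈ B ∧ h b ∉ B) ∨ (t b ∉ B ∧ h b ∈ B))

variable {t h : α → V} {rev : α → α} {E G O O' : Set α} {S A : Set V} {r N : ℕ}

namespace Bridgefree

theorem head_rev (hG : Bridgefree t h rev E G S) {a : α} (ha : a ∈ E) : h (rev a) = t a := by
  rw [← hG.tail_rev _ (hG.rev_mem a ha), hG.rev_rev a ha]

theorem head_mem (hG : Bridgefree t h rev E G S) {a : α} (ha : a ∈ E) : h a ∈ S :=
  hG.tail_rev a ha ▸ hG.tail_mem _ (hG.rev_mem a ha)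

theorem symm (hG : Bridgefree t h rev E G S) : Bridgefree h t rev E G S where
  subset := hG.subset
  tail_mem := fun _ ha => hG.head_mem ha
  rev_mem := hG.rev_mem
  rev_rev := hG.rev_rev
  tail_rev := fun _ ha => hG.head_rev ha
  crossing := fun a ha hra B h1 h2 => by
    obtain ⟨b, hb, h3, h4, h5⟩ := hG.crossing a ha hra Bᶜ h2 (by simpa using h1)
    refine ⟨b, hb, h3, h4, ?_⟩
    simp only [Set.mem_compl_iff, not_not] at h5
    tauto

/-- Each undirected edge that leaves `A` lies on a short cycle of the graph in which `A` is
contracted. -/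
theorem short_cycle (hG : Bridgefree t h rev E G S)
    (hout : S ⊆ reach t h G A r) (hin : S ⊆ reach h t G A r)
    {a : α} (ha : a ∈ G) (hra : rev a ∈ G) (hta : t a ∈ A) (hr : 1 ≤ r) :
    h a ∈ reach h t (G \ {a, rev a}) A (2 * r) ∨ h a ∈ reach t h (G \ {a, rev a}) A (2 * r) := by
  have haE := hG.subset ha
  set G' := G \ {a, rev a} with hG'
  have hP : ∀ x ∈ S, x ∉ reach t h G' A r → x ∈ reach t h G' {h a} (r - 1) := by
    intro x hx hxP
    rcases reach_diff_pair (a := a) (b := rev a) (by rwa [hG.head_rev haE]) (hout hx) with h1 | ⟨i, hi, h1⟩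
    · exact absurd h1 hxP
    · exact reach_mono_right (by omega) h1
  have hQ : ∀ x ∈ S, x ∉ reach h t G' A r → x ∈ reach h t G' {h a} (r - 1) := by
    intro x hx hxP
    rcases reach_diff_pair (t := h) (h := t) (a := rev a) (b := a) hta (hin hx) with h1 | ⟨i, hi, h1⟩
    · rw [Set.pair_comm] at h1; exact absurd h1 hxP
    · rw [Set.pair_comm, hG.tail_rev a haE] at h1
      exact reach_mono_right (by omega) h1
  by_cases h1 : ∃ x ∈ S, x ∈ reach h t G' A r ∧ x ∉ reach t h G' A r
  · obtain ⟨x, hx, hxQ, hxP⟩ := h1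
    exact Or.inl (reach_mono_right (by omega) (mem_reach_of_reach (hP x hx hxP) hxQ))
  by_cases h2 : ∃ x ∈ S, x ∈ reach t h G' A r ∧ x ∉ reach h t G' A r
  · obtain ⟨x, hx, hxP, hxQ⟩ := h2
    exact Or.inr (reach_mono_right (by omega)
      (mem_reach_of_reach (t := h) (h := t) (hQ x hx hxQ) hxP))
  push Not at h1 h2
  by_cases hw : h a ∈ reach t h G' A r
  · exact Or.inr (reach_mono_right (by omega) hw)
  obtain ⟨b, hb, hba, hbr, hcr⟩ := hG.crossing a ha hra _ (subset_reach hta) hw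
  have hb' : b ∈ G' := ⟨hb, by simp [hba, hbr]⟩
  have htS := hG.tail_mem b (hG.subset hb)
  have hhS := hG.head_mem (hG.subset hb)
  rcases hcr with ⟨h3, h4⟩ | ⟨h3, h4⟩
  · have h5 := hQ _ hhS fun h5 => h4 (h1 _ hhS h5)
    exact Or.inr (reach_mono_right (by omega)
      (mem_reach_of_reach (t := h) (h := t) h5 (reach_step hb' h3)))
  · have h5 := hP _ htS h3
    have h6 : t b ∈ reach h t G' A (r + 1) := reach_step (t := h) (h := t) hb' (h2 _ hhS h4)
    exact Or.inl (reach_mono_right (by omega) (mem_reach_of_reach h5 h6))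

end Bridgefree

theorem mem_cut_of_inner (hG : Bridgefree t h rev E G S)
    (hO : O ⊆ undirOut t h G rev A) {b : α} (hb : b ∈ G) (h1 : t b ∉ A) (h2 : h b ∉ A) :
    b ∈ cut t h G rev A O :=
  ⟨hb, fun hr => h2 (hG.tail_rev b (hG.subset hb) ▸ (hO hr).2.2.1), fun hu => absurd hu.2.2.1 h1⟩

theorem reach_subset_reach {W W' : Set α} (hW : ∀ b ∈ W, h b ∉ A → b ∈ W') {k : ℕ} :
    reach t h W A k ⊆ reach t h W' A k := by
  induction k with
  | zero => exact subset_rfl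
  | succ k ih =>
    rintro x (hx | ⟨b, hb, htb, rfl⟩)
    · exact Or.inl (ih hx)
    · by_cases hA : h b ∈ A
      · exact subset_reach hA
      · exact reach_step (hW b hb hA) (ih htb)

theorem mem_cut_mono (hG : Bridgefree t h rev E G S) (hO : O' ⊆ undirOut t h G rev A)
    (hOO : O ⊆ O') {b : α} (hb : b ∈ cut t h G rev A O) (hbA : h b ∉ A) :
    b ∈ cut t h G rev A O' := by
  refine ⟨hb.1, fun hr => hbA ?_, fun hu => hOO (hb.2.2 hu)⟩
  rw [← hG.tail_rev b (hG.subset hb.1)]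
  exact (hO hr).2.2.1

theorem Reentrant.mono (hG : Bridgefree t h rev E G S) (hO : O' ⊆ undirOut t h G rev A)
    (hOO : O ⊆ O') {L : ℕ} (hr : Reentrant t h G rev A L O) : Reentrant t h G rev A L O' := by
  rintro x ⟨b, hb, h1, h2, rfl⟩
  refine reach_subset_reach (fun c hc hcA => mem_cut_mono hG hO hOO hc hcA)
    (hr ⟨b, ?_, h1, h2, rfl⟩)
  exact ⟨hb.1, fun hr => hb.2.1 (hOO hr), fun hu => absurd hu.2.2.1 h1⟩

theorem returning_subset {L : ℕ} : returning t h G rev A L ⊆ undirOut t h G rev A := fun _ h => h.1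

theorem Bridgefree.rev_eq_iff (hG : Bridgefree t h rev E G S) {b f : α} (hb : b ∈ E) (hf : f ∈ E) :
    b = rev f ↔ f = rev b :=
  ⟨fun e => by rw [e, hG.rev_rev f hf], fun e => by rw [e, hG.rev_rev b hb]⟩

/-- Going out along the edges that can be oriented out of `A` and back along the others works. -/
theorem reentrant_returning (hG : Bridgefree t h rev E G S)
    (hout : S ⊆ reach t h G A r) (hin : S ⊆ reach h t G A r) (hr : 1 ≤ r) :
    Reentrant t h G rev A (2 * r) (returning t h G rev A (2 * r)) := by
  rintro x ⟨b, hb, h1, h2, rfl⟩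
  have hbE := hG.subset hb.1
  have hO := returning_subset (t := t) (h := h) (G := G) (rev := rev) (A := A) (L := 2 * r)
  obtain ⟨f, hf, hfb, hfA, hfn, i, hi, hp⟩ : ∃ f ∈ G, f ≠ rev b ∧ t f ∈ A ∧ h f ∉ A ∧ ∃ i,
      i + 1 ≤ 2 * r ∧ t b ∈ reach t h {c | c ∈ G ∧ h c ∉ A ∧ t c ∉ A} {h f} i := by
    by_cases hrev : rev b ∈ G
    · have hu : rev b ∈ undirOut t h G rev A :=
        ⟨hrev, by rw [hG.rev_rev b hbE]; exact hb.1, by rwa [hG.tail_rev b hbE],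
          by rwa [hG.head_rev hbE]⟩
      have hn : rev b ∉ returning t h G rev A (2 * r) := hb.2.1
      rcases hG.short_cycle hout hin hrev (by rw [hG.rev_rev b hbE]; exact hb.1)
        (by rwa [hG.tail_rev b hbE]) hr with h3 | h3
      · exact absurd ⟨hu, h3⟩ hn
      · rw [hG.head_rev hbE] at h3
        obtain ⟨f, hf, hfA, hfn, i, hi, hp⟩ := exists_last_arc (t := h) (h := t) h3 h1
        exact ⟨f, hf.1, fun e => hf.2 (by simp [e]), hfA, hfn, i, hi.le,
          reach_mono (fun c hc => And.intro hc.1.1 hc.2) subset_rfl hp⟩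
    · obtain ⟨f, hf, hfA, hfn, i, hi, hp⟩ :=
        exists_last_arc (t := h) (h := t) (hout (hG.tail_mem b hbE)) h1
      exact ⟨f, hf, fun e => hrev (e ▸ hf), hfA, hfn, i, by omega, hp⟩
  have hfE := hG.subset hf
  by_cases hfc : f ∈ cut t h G rev A (returning t h G rev A (2 * r))
  · have h3 := reach_step (h := h) hfc (subset_reach (k := 0) hfA)
    refine reach_mono_right (by omega) (reach_trans h3 (reach_mono ?_ subset_rfl hp))
    exact fun c hc => mem_cut_of_inner hG hO hc.1 hc.2.2 hc.2.1
  · exfalso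
    apply hfc
    refine ⟨hf, fun hr => hfn (hG.tail_rev f hfE ▸ hr.1.2.2.1), fun hu => ⟨hu, ?_⟩⟩
    have hbf : b ∈ G \ {f, rev f} := by
      refine ⟨hb.1, ?_⟩
      rintro (e | e)
      · exact h1 (e ▸ hfA)
      · exact hfb ((hG.rev_eq_iff hbE hfE).1 e)
    have h3 : t b ∈ reach h t (G \ {f, rev f}) A 1 :=
      reach_step (t := h) (h := t) hbf (subset_reach h2)
    refine reach_mono_right (by omega) (mem_reach_of_reach (reach_mono ?_ subset_rfl hp) h3)
    rintro c ⟨hc, h4, h5⟩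
    refine ⟨hc, ?_⟩
    rintro (rfl | e)
    · exact h5 hfA
    · exact h4 (by rw [e, hG.head_rev hfE]; exact hfA)

/-- If `O` is minimal, then the edges oriented out of `A` lead back to the cycles through `A`. -/
theorem leaving_subset (hG : Bridgefree t h rev E G S) (hin : S ⊆ reach h t G A r) (hr : 1 ≤ r)
    (hN : 2 * r ≤ N) (hO : O ⊆ returning t h G rev A (2 * r))
    (hre : Reentrant t h G rev A (2 * r) O)
    (hmin : ∀ a ∈ O, ¬ Reentrant t h G rev A (2 * r) (O \ {a})) :
    leaving t h A (cut t h G rev A O) ⊆ reach h t (cut t h G rev A O)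
      (span t h N (cut t h G rev A O) A (entering t h A (cut t h G rev A O))) (2 * r - 1) := by
  rintro z ⟨b, hb, h1, h2, rfl⟩
  have hbE := hG.subset hb.1
  have hOU : O ⊆ undirOut t h G rev A := hO.trans returning_subset
  set W := cut t h G rev A O with hW
  set K := span t h N W A (entering t h A W) with hK
  obtain ⟨f, hf, hfb, hfA, hfn, i, hi, hp⟩ : ∃ f ∈ G, f ≠ rev b ∧ h f ∈ A ∧ t f ∉ A ∧ ∃ i,
      i + 1 ≤ 2 * r ∧ h b ∈ reach h t {c | c ∈ G ∧ t c ∉ A ∧ h c ∉ A} {t f} i := by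
    by_cases hrev : rev b ∈ G
    · obtain ⟨f, hf, hfA, hfn, i, hi, hp⟩ := exists_last_arc (hO (hb.2.2 ⟨hb.1, hrev, h1, h2⟩)).2 h2
      exact ⟨f, hf.1, fun e => hf.2 (by simp [e]), hfA, hfn, i, hi.le,
          reach_mono (fun c hc => And.intro hc.1.1 hc.2) subset_rfl hp⟩
    · obtain ⟨f, hf, hfA, hfn, i, hi, hp⟩ := exists_last_arc (hin (hG.head_mem hbE)) h2
      exact ⟨f, hf, fun e => hrev (e ▸ hf), hfA, hfn, i, by omega, hp⟩
  have hfE := hG.subset hf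
  have hinner : ∀ O' ⊆ O, {c | c ∈ G ∧ t c ∉ A ∧ h c ∉ A} ⊆ cut t h G rev A O' :=
    fun O' hO' c hc => mem_cut_of_inner hG (hO'.trans hOU) hc.1 hc.2.1 hc.2.2
  suffices hfK : t f ∈ K from
    reach_mono_right (by omega) (reach_mono (hinner O subset_rfl) (Set.singleton_subset_iff.2 hfK) hp)
  by_contra hfK
  have hfO : rev f ∈ O := by
    by_contra hfO
    exact hfK (mem_span_of_mem ⟨f, ⟨hf, hfO, fun hu => absurd hu.2.2.1 hfn⟩, hfn, hfA, rfl⟩)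
  apply hmin _ hfO
  rintro y ⟨c, hc, h3, h4, rfl⟩
  have hcE := hG.subset hc.1
  by_cases hcf : rev c = rev f
  · have hcf' : c = f := by rw [← hG.rev_rev c hcE, hcf, hG.rev_rev f hfE]
    have hb' : b ∈ cut t h G rev A (O \ {rev f}) := by
      refine ⟨hb.1, fun hr => hb.2.1 hr.1, fun hu => ⟨hb.2.2 hu, ?_⟩⟩
      exact fun e => hfb ((hG.rev_eq_iff hbE hfE).1 e)
    have h5 := reach_step (h := h) hb' (subset_reach (k := 0) h1)
    rw [hcf']
    refine reach_mono_right (by omega) (reach_trans h5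
      (reach_symm.2 (reach_mono (hinner _ Set.sdiff_subset) subset_rfl hp)))
  · have hcT : t c ∈ entering t h A W :=
      ⟨c, ⟨hc.1, fun hr => hc.2.1 ⟨hr, hcf⟩, fun hu => absurd hu.2.2.1 h3⟩, h3, h4, rfl⟩
    have h5 := span_reach hre hN hN (mem_span_of_mem hcT) (hre hcT)
    refine reach_subset_reach (fun d hd hdA => ?_) h5
    refine ⟨hd.1.1.1, fun hr => hd.1.1.2.1 hr.1, fun hu => ⟨hd.1.1.2.2 hu, ?_⟩⟩
    rintro rfl
    exact hfK (hG.head_rev hfE ▸ hd.2)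

section Commit

variable (t h) (N : ℕ) (A K : Set V) (W : Set α)

/-- The cycles through `A` that serve the edges into `A`. -/
def core : Set V := span t h N W A (entering t h A W)

/-- The core together with the paths to it that serve the edges out of `A`. -/
def absorb : Set V := span h t N W (core t h N A W) (leaving t h A W)

def committed : Set α :=
  {b | b ∈ W ∧ ((t b ∈ A ∧ h b ∉ A) ∨ (t b ∉ A ∧ h b ∈ A))} ∪
    (spanArcs t h N W A (entering t h A W) ∪
      spanArcs h t N W (core t h N A W) (leaving t h A W))

end Commit

theorem subset_core {W : Set α} : A ⊆ core t h N A W := fun _ hx => Or.inl hx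

theorem core_subset_absorb {W : Set α} : core t h N A W ⊆ absorb t h N A W := fun _ hx => Or.inl hx

/-- One round of the construction: `absorb` is a set of vertices around `A`, and `committed` orients
the edges that it uses. -/
structure Round (t h : α → V) (rev : α → α) (G : Set α) (S A A' : Set V) (C : Set α) (r : ℕ) :
    Prop where
  subset : A ⊆ A'
  subset_vertices : A' ⊆ S
  arcs : C ⊆ G
  not_rev : ∀ c ∈ C, rev c ∉ C
  fresh : ∀ c ∈ C, ¬ (t c ∈ A ∧ h c ∈ A)
  out : ∀ x ∈ A', x ∈ reach t h {c | c ∈ C ∧ t c ∈ A' ∧ h c ∈ A'} A (2 * r)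
  into : ∀ x ∈ A', x ∈ reach h t {c | c ∈ C ∧ t c ∈ A' ∧ h c ∈ A'} A (4 * r - 1)
  near : S ⊆ reach t h G A' (r - 1)
  near' : S ⊆ reach h t G A' (r - 1)

theorem round_of_minimal (hG : Bridgefree t h rev E G S) (hA : A ⊆ S)
    (hout : S ⊆ reach t h G A r) (hin : S ⊆ reach h t G A r) (hr : 1 ≤ r)
    (hN : 2 * r ≤ N) (hO : O ⊆ returning t h G rev A (2 * r))
    (hre : Reentrant t h G rev A (2 * r) O)
    (hmin : ∀ a ∈ O, ¬ Reentrant t h G rev A (2 * r) (O \ {a})) :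
    Round t h rev G S A (absorb t h N A (cut t h G rev A O))
      (committed t h N A (cut t h G rev A O)) r := by
  have hOU : O ⊆ undirOut t h G rev A := hO.trans returning_subset
  have hle := leaving_subset hG hin hr hN hO hre hmin
  have hWG : cut t h G rev A O ⊆ G := fun b hb => hb.1
  have hcross : ∀ b ∈ cut t h G rev A O, rev b ∈ cut t h G rev A O →
      (t b ∈ A ∧ h b ∉ A) ∨ (t b ∉ A ∧ h b ∈ A) → False := by
    intro b hb hrb hc
    have hbE := hG.subset hb.1
    rcases hc with ⟨h1, h2⟩ | ⟨h1, h2⟩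
    · have := hb.2.2 ⟨hb.1, hrb.1, h1, h2⟩
      exact hrb.2.1 (by rwa [hG.rev_rev b hbE])
    · refine hb.2.1 (hrb.2.2 ⟨hrb.1, ?_, ?_, ?_⟩)
      · rw [hG.rev_rev b hbE]; exact hb.1
      · rwa [hG.tail_rev b hbE]
      · rwa [hG.head_rev hbE]
  set W := cut t h G rev A O with hW
  change _ ⊆ reach h t W (core t h N A W) (2 * r - 1) at hle
  have hN' : 2 * r - 1 ≤ N := by omega
  have hcommW : committed t h N A W ⊆ W := by
    rintro b (hb | hb | hb)
    exacts [hb.1, hb.1.1, hb.1.1]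
  have hent : entering t h A W ⊆ core t h N A W := fun x hx => mem_span_of_mem hx
  have hlea : leaving t h A W ⊆ absorb t h N A W := fun x hx => mem_span_of_mem hx
  have hAabs : A ⊆ absorb t h N A W := subset_core.trans core_subset_absorb
  set C := {c | c ∈ committed t h N A W ∧ t c ∈ absorb t h N A W ∧ h c ∈ absorb t h N A W} with hC
  have hC1 : spanArcs t h N W A (entering t h A W) ⊆ C := fun b hb =>
    ⟨Or.inr (Or.inl hb), core_subset_absorb (tail_mem_span hre hN hb), core_subset_absorb hb.2⟩
  have hC2 : spanArcs h t N W (core t h N A W) (leaving t h A W) ⊆ C := fun b hb =>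
    ⟨Or.inr (Or.inr hb), hb.2, tail_mem_span hle hN' hb⟩
  have hin1 : entering t h A W ⊆ reach h t C A 1 := by
    rintro x ⟨b, hb, h1, h2, rfl⟩
    exact reach_step (t := h) (h := t) (a := b) ⟨Or.inl ⟨hb, Or.inr ⟨h1, h2⟩⟩,
      core_subset_absorb (hent ⟨b, hb, h1, h2, rfl⟩), hAabs h2⟩ h2
  have hout1 : leaving t h A W ⊆ reach t h C A 1 := by
    rintro x ⟨b, hb, h1, h2, rfl⟩
    exact reach_step (a := b) ⟨Or.inl ⟨hb, Or.inl ⟨h1, h2⟩⟩, hAabs h1,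
      hlea ⟨b, hb, h1, h2, rfl⟩⟩ h1
  have hcore : ∀ x ∈ core t h N A W, x ∈ reach t h C A (2 * r) ∧ x ∈ reach h t C A (2 * r) := by
    intro x hx
    by_cases hxA : x ∈ A
    · exact ⟨subset_reach hxA, subset_reach hxA⟩
    obtain ⟨i, h1, h2, h3, h4⟩ := exists_level_of_mem_span hre hN hx hxA
    refine ⟨reach_mono_right h2 (reach_mono hC1 subset_rfl h3), reach_mono_right ?_
      (reach_le_of_subset hin1 (reach_mono hC1 subset_rfl h4))⟩
    omega
  have habs : ∀ x ∈ absorb t h N A W,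
      x ∈ reach t h C A (2 * r) ∧ x ∈ reach h t C A (4 * r - 1) := by
    intro x hx
    by_cases hxK : x ∈ core t h N A W
    · exact ⟨(hcore x hxK).1, reach_mono_right (by omega) (hcore x hxK).2⟩
    obtain ⟨i, h1, h2, h3, h4⟩ := exists_level_of_mem_span hle hN' hx hxK
    refine ⟨reach_mono_right ?_ (reach_le_of_subset hout1 (reach_mono hC2 subset_rfl h4)),
      reach_mono_right ?_ (reach_le_of_subset (fun y hy => (hcore y hy).2)
        (reach_mono hC2 subset_rfl h3))⟩ <;> omega
  have hstep : ∀ b ∈ G, (t b ∈ A → h b ∈ absorb t h N A W) ∧ (h b ∈ A → t b ∈ absorb t h N A W) := by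
    intro b hb
    have hbE := hG.subset hb
    refine ⟨fun h1 => ?_, fun h1 => ?_⟩
    · by_cases h2 : h b ∈ A
      · exact hAabs h2
      by_cases hbW : b ∈ W
      · exact hlea ⟨b, hbW, h1, h2, rfl⟩
      · have hrO : rev b ∉ O := fun hr => h2 (hG.tail_rev b hbE ▸ (hOU hr).2.2.1)
        have hu : b ∈ undirOut t h G rev A ∧ b ∉ O := by
          by_contra hn
          exact hbW ⟨hb, hrO, fun hu => by_contra fun hb => hn ⟨hu, hb⟩⟩
        refine core_subset_absorb (hent ⟨rev b, ⟨hu.1.2.1, ?_, fun hu' => ?_⟩, ?_, ?_, ?_⟩)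
        · rw [hG.rev_rev b hbE]; exact hu.2
        · exact absurd (hG.tail_rev b hbE ▸ hu'.2.2.1) h2
        · rwa [hG.tail_rev b hbE]
        · rwa [hG.head_rev hbE]
        · exact hG.tail_rev b hbE
    · by_cases h2 : t b ∈ A
      · exact hAabs h2
      by_cases hbW : b ∈ W
      · exact core_subset_absorb (hent ⟨b, hbW, h2, h1, rfl⟩)
      · have hrO : rev b ∈ O := by
          by_contra hrO
          exact hbW ⟨hb, hrO, fun hu => absurd hu.2.2.1 h2⟩
        refine hlea ⟨rev b, ⟨(hOU hrO).1, ?_, fun _ => hrO⟩, ?_, ?_, ?_⟩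
        · rw [hG.rev_rev b hbE]; exact fun hb => h2 (hOU hb).2.2.1
        · rwa [hG.tail_rev b hbE]
        · rwa [hG.head_rev hbE]
        · exact hG.head_rev hbE
  have habsS : absorb t h N A W ⊆ S := by
    intro x hx
    refine reach_subset hA (fun c hc _ => ?_) (habs x hx).1
    exact hG.head_mem (hG.subset (hcommW hc.1).1)
  refine ⟨hAabs, habsS, hcommW.trans hWG, ?_, ?_, fun x hx => (habs x hx).1,
    fun x hx => (habs x hx).2, ?_, ?_⟩
  · intro c hc hrc
    have hcE := hG.subset (hWG (hcommW hc))
    have hcW := hcommW hc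
    have hrW := hcommW hrc
    have ht := hG.tail_rev c hcE
    have hh := hG.head_rev hcE
    rcases hc with hc | hc | hc
    · exact hcross c hcW hrW hc.2
    · rcases hrc with hr | hr | hr
      · refine hcross c hcW hrW ?_
        have := hr.2
        rw [ht, hh] at this; tauto
      · exact ascending_antisymm hc.1 hr.1 ht hh
      · exact not_mem_of_ascending (t := h) (h := t) hr.1 (ht ▸ hc.2)
    · rcases hrc with hr | hr | hr
      · refine hcross c hcW hrW ?_
        have := hr.2
        rw [ht, hh] at this; tauto
      · exact not_mem_of_ascending (t := h) (h := t) hc.1 (hh ▸ hr.2)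
      · exact ascending_antisymm (t := h) (h := t) hc.1 hr.1 hh ht
  · rintro c (hc | hc | hc) ⟨h1, h2⟩
    · have := hc.2; tauto
    · exact not_mem_of_ascending hc.1 h2
    · exact not_mem_of_ascending (t := h) (h := t) hc.1 (subset_core h1)
  · obtain ⟨k, rfl⟩ : ∃ k, r = 1 + k := ⟨r - 1, by omega⟩
    rw [← reach_reach] at hout
    refine hout.trans (reach_mono_right (by omega) |>.trans' (reach_mono subset_rfl ?_))
    rintro x (hx | ⟨a, ha, hta, rfl⟩)
    exacts [hAabs hx, (hstep a ha).1 hta]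
  · obtain ⟨k, rfl⟩ : ∃ k, r = 1 + k := ⟨r - 1, by omega⟩
    rw [← reach_reach] at hin
    refine hin.trans (reach_mono_right (by omega) |>.trans' (reach_mono subset_rfl ?_))
    rintro x (hx | ⟨a, ha, hta, rfl⟩)
    exacts [hAabs hx, (hstep a ha).2 hta]

end ArcSystem

namespace RAM

namespace State

def setVar (s : State) (x v : ℕ) : State := ⟨Function.update s.var x v, s.arr⟩

def setArr (s : State) (a i v : ℕ) : State :=
  ⟨s.var, Function.update s.arr a (Function.update (s.arr a) i v)⟩

@[simp] theorem setVar_arr (s : State) (x v : ℕ) : (s.setVar x v).arr = s.arr := rfl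

@[simp] theorem setArr_var (s : State) (a i v : ℕ) : (s.setArr a i v).var = s.var := rfl

@[simp] theorem setVar_var_self (s : State) (x v : ℕ) : (s.setVar x v).var x = v := by
  simp [setVar]

theorem setVar_var_ne (s : State) {x y : ℕ} (v : ℕ) (hy : y ≠ x) :
    (s.setVar x v).var y = s.var y := by simp [setVar, hy]

theorem setArr_arr_ne (s : State) {a b : ℕ} (i v : ℕ) (hb : b ≠ a) :
    (s.setArr a i v).arr b = s.arr b := by simp [setArr, hb]

theorem setArr_arr_self (s : State) (a i v : ℕ) :
    (s.setArr a i v).arr a = Function.update (s.arr a) i v := by simp [setArr]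

end State

namespace Expr

def readVars : Expr → List ℕ
  | lit _ => []
  | var x => [x]
  | arr _ i => readVars i
  | add e f => readVars e ++ readVars f
  | sub e f => readVars e ++ readVars f

def readArrs : Expr → List ℕ
  | lit _ => []
  | var _ => []
  | arr a i => a :: readArrs i
  | add e f => readArrs e ++ readArrs f
  | sub e f => readArrs e ++ readArrs f

theorem eval_congr {s s' : State} : ∀ {e : Expr}, (∀ x ∈ e.readVars, s.var x = s'.var x) →
    (∀ a ∈ e.readArrs, s.arr a = s'.arr a) → e.eval s = e.eval s'
  | lit _, _, _ => rfl
  | var x, h, _ => h x (by simp [readVars])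
  | arr a i, h, h' => by
    simp only [eval]
    rw [eval_congr (e := i) h fun b hb => h' b (by simp [readArrs, hb]), h' a (by simp [readArrs])]
  | add e f, h, h' => by
    simp only [readVars, readArrs, List.mem_append] at h h'
    simp only [eval]
    rw [eval_congr (e := e) (fun x hx => h x (Or.inl hx)) fun x hx => h' x (Or.inl hx),
      eval_congr (e := f) (fun x hx => h x (Or.inr hx)) fun x hx => h' x (Or.inr hx)]
  | sub e f, h, h' => by
    simp only [readVars, readArrs, List.mem_append] at h h'
    simp only [eval]
    rw [eval_congr (e := e) (fun x hx => h x (Or.inl hx)) fun x hx => h' x (Or.inl hx),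
      eval_congr (e := f) (fun x hx => h x (Or.inr hx)) fun x hx => h' x (Or.inr hx)]

def neg (e : Expr) : Expr := sub (lit 1) e

def lt (e f : Expr) : Expr := sub f e

def le (e f : Expr) : Expr := neg (sub e f)

def conj (e f : Expr) : Expr := sub (lit 1) (add (neg e) (neg f))

def disj (e f : Expr) : Expr := add e f

def ne (e f : Expr) : Expr := add (sub e f) (sub f e)

/-- The expression `e` is true in the state `s` if its value is nonzero. -/
def Holds (s : State) (e : Expr) : Prop := e.eval s ≠ 0

variable {s : State} {e f : Expr}

@[simp] theorem holds_neg : (neg e).Holds s ↔ ¬ e.Holds s := by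
  simp only [Holds, neg, eval]; omega

@[simp] theorem holds_lt : (lt e f).Holds s ↔ e.eval s < f.eval s := by
  simp only [Holds, lt, eval]; omega

@[simp] theorem holds_le : (le e f).Holds s ↔ e.eval s ≤ f.eval s := by
  simp only [Holds, le, neg, eval]; omega

@[simp] theorem holds_conj : (conj e f).Holds s ↔ e.Holds s ∧ f.Holds s := by
  simp only [Holds, conj, neg, eval]; omega

@[simp] theorem holds_disj : (disj e f).Holds s ↔ e.Holds s ∨ f.Holds s := by
  simp only [Holds, disj, eval]; omega

@[simp] theorem holds_ne : (ne e f).Holds s ↔ e.eval s ≠ f.eval s := by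
  simp only [Holds, ne, eval]; omega

@[simp] theorem holds_arr {a : ℕ} {i : Expr} : (arr a i).Holds s ↔ s.arr a (i.eval s) ≠ 0 := Iff.rfl

end Expr

/-- The ranges of the loops: the vertices, the arcs, and twice the number of vertices. -/
inductive Bound
  | verts
  | arcs
  | rounds

namespace Bound

def expr : Bound → Expr
  | verts => .var 0
  | arcs => .add (.var 1) (.var 1)
  | rounds => .add (.var 0) (.var 0)

def val (s : State) : Bound → ℕ
  | verts => s.var 0
  | arcs => 2 * s.var 1
  | rounds => 2 * s.var 0

theorem eval_expr (s : State) (b : Bound) : b.expr.eval s = b.val s := by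
  cases b <;> simp only [expr, val, Expr.eval, two_mul]

theorem cost_expr (b : Bound) : b.expr.cost ≤ 3 := by cases b <;> simp [expr, Expr.cost]

theorem val_le (s : State) (b : Bound) : b.val s ≤ 2 * (s.var 0 + s.var 1) := by
  cases b <;> simp only [val] <;> omega

theorem val_congr {s s' : State} (b : Bound) (h0 : s.var 0 = s'.var 0) (h1 : s.var 1 = s'.var 1) :
    b.val s = b.val s' := by cases b <;> simp only [val, h0, h1]

end Bound

/-- Programs in which all loops are counting loops. -/
inductive Cmd
  | skip
  | assign (x : ℕ) (e : Expr)
  | store (a : ℕ) (i e : Expr)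
  | seq (p q : Cmd)
  | cond (c : Expr) (p q : Cmd)
  | count (x : ℕ) (b : Bound) (p : Cmd)

namespace Cmd

def compile : Cmd → Program
  | skip => .skip
  | assign x e => .assign x e
  | store a i e => .store a i e
  | seq p q => .seq p.compile q.compile
  | cond c p q => .cond c p.compile q.compile
  | count x b p => .seq (.assign x (.lit 0))
      (.loop (.sub b.expr (.var x)) (.seq p.compile (.assign x (.add (.var x) (.lit 1)))))

/-- The state after the first `i` rounds of a counting loop whose body acts by `f`. -/
def rounds (f : State → State) (x : ℕ) (s : State) : ℕ → State
  | 0 => s.setVar x 0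
  | i + 1 => (f (rounds f x s i)).setVar x (i + 1)

open Classical in
noncomputable def run : Cmd → State → State
  | skip, s => s
  | assign x e, s => s.setVar x (e.eval s)
  | store a i e, s => s.setArr a (i.eval s) (e.eval s)
  | seq p q, s => q.run (p.run s)
  | cond c p q, s => if c.Holds s then p.run s else q.run s
  | count x b p, s => rounds p.run x s (b.val s)

def writtenVars : Cmd → List ℕ
  | skip => []
  | assign x _ => [x]
  | store _ _ _ => []
  | seq p q => p.writtenVars ++ q.writtenVars
  | cond _ p q => p.writtenVars ++ q.writtenVars
  | count x _ p => x :: p.writtenVars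

def writtenArrs : Cmd → List ℕ
  | skip => []
  | assign _ _ => []
  | store a _ _ => [a]
  | seq p q => p.writtenArrs ++ q.writtenArrs
  | cond _ p q => p.writtenArrs ++ q.writtenArrs
  | count _ _ p => p.writtenArrs

/-- The loop variables and the input sizes are not overwritten. -/
def WellFormed : Cmd → Prop
  | skip => True
  | assign x _ => 2 ≤ x
  | store _ _ _ => True
  | seq p q => p.WellFormed ∧ q.WellFormed
  | cond _ p q => p.WellFormed ∧ q.WellFormed
  | count x _ p => 2 ≤ x ∧ x ∉ p.writtenVars ∧ p.WellFormed

/-- `s'` differs from `s` at most in the listed variables and arrays. -/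
def Agree (vs as : List ℕ) (s s' : State) : Prop :=
  (∀ y, y ∉ vs → s'.var y = s.var y) ∧ ∀ a, a ∉ as → s'.arr a = s.arr a

theorem Agree.trans {vs as vs' as' : List ℕ} {s s' s'' : State} (h : Agree vs as s s')
    (h' : Agree vs' as' s' s'') : Agree (vs ++ vs') (as ++ as') s s'' := by
  refine ⟨fun y hy => ?_, fun a ha => ?_⟩
  · rw [List.mem_append, not_or] at hy; rw [h'.1 y hy.2, h.1 y hy.1]
  · rw [List.mem_append, not_or] at ha; rw [h'.2 a ha.2, h.2 a ha.1]

theorem Agree.mono {vs as vs' as' : List ℕ} {s s' : State} (h : Agree vs as s s')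
    (hv : vs ⊆ vs') (ha : as ⊆ as') : Agree vs' as' s s' :=
  ⟨fun y hy => h.1 y fun h' => hy (hv h'), fun a h' => h.2 a fun h'' => h' (ha h'')⟩

theorem agree_rounds {f : State → State} {vs as : List ℕ} (hf : ∀ s, Agree vs as s (f s)) (x : ℕ)
    (s : State) (i : ℕ) : Agree (x :: vs) as s (rounds f x s i) := by
  induction i with
  | zero =>
    exact ⟨fun y hy => State.setVar_var_ne _ _ (by simp at hy; exact hy.1), fun _ _ => rfl⟩
  | succ i ih =>
    refine ⟨fun y hy => ?_, fun a ha => ?_⟩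
    · have hy' := hy
      rw [List.mem_cons, not_or] at hy'
      rw [rounds, State.setVar_var_ne _ _ hy'.1, (hf _).1 y hy'.2, ih.1 y hy]
    · rw [rounds, State.setVar_arr, (hf _).2 a ha, ih.2 a ha]

theorem agree_run (c : Cmd) : ∀ s, Agree c.writtenVars c.writtenArrs s (c.run s) := by
  induction c with
  | skip => exact fun s => ⟨fun _ _ => rfl, fun _ _ => rfl⟩
  | assign x e =>
    exact fun s => ⟨fun y hy => State.setVar_var_ne _ _ (by simpa [writtenVars] using hy),
      fun _ _ => rfl⟩
  | store a i e =>
    exact fun s => ⟨fun _ _ => rfl,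
      fun b hb => State.setArr_arr_ne _ _ _ (by simpa [writtenArrs] using hb)⟩
  | seq p q hp hq => exact fun s => (hp s).trans (hq _)
  | cond c p q hp hq =>
    intro s
    rw [run]
    split_ifs
    · exact (hp s).mono (by simp [writtenVars]) (by simp [writtenArrs])
    · exact (hq s).mono (by simp [writtenVars]) (by simp [writtenArrs])
  | count x b p hp => exact fun s => agree_rounds hp x s _

theorem run_var {c : Cmd} {y : ℕ} (hy : y ∉ c.writtenVars) (s : State) :
    (c.run s).var y = s.var y := (c.agree_run s).1 y hy

theorem run_arr {c : Cmd} {a : ℕ} (ha : a ∉ c.writtenArrs) (s : State) :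
    (c.run s).arr a = s.arr a := (c.agree_run s).2 a ha

theorem WellFormed.not_mem {c : Cmd} (hc : c.WellFormed) {y : ℕ} (hy : y < 2) :
    y ∉ c.writtenVars := by
  induction c with
  | skip => simp [writtenVars]
  | assign x e => simp only [WellFormed] at hc; simp only [writtenVars, List.mem_singleton]; omega
  | store a i e => simp [writtenVars]
  | seq p q hp hq => simp only [writtenVars, List.mem_append]; exact fun h => h.elim (hp hc.1) (hq hc.2)
  | cond c p q hp hq =>
    simp only [writtenVars, List.mem_append]; exact fun h => h.elim (hp hc.1) (hq hc.2)
  | count x b p hp =>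
    obtain ⟨h1, -, h3⟩ := hc
    simp only [writtenVars, List.mem_cons, not_or]
    exact ⟨by omega, hp h3⟩

/-- A polynomial in the number of vertices plus the number of edges that bounds the running time. -/
noncomputable def timeBound : Cmd → Polynomial ℕ
  | skip => 1
  | assign _ e => .C (e.cost + 1)
  | store _ i e => .C (i.cost + e.cost + 1)
  | seq p q => p.timeBound + q.timeBound
  | cond c p q => .C (c.cost + 1) + p.timeBound + q.timeBound
  | count _ _ p => .C 2 * .X * (p.timeBound + .C 10) + .C 8

theorem exec_compile (c : Cmd) (hc : c.WellFormed) (s : State) :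
    ∃ t ≤ c.timeBound.eval (s.var 0 + s.var 1), Exec c.compile s (c.run s) t := by
  induction c generalizing s with
  | skip => exact ⟨1, by simp [timeBound], .skip s⟩
  | assign x e => exact ⟨_, by simp [timeBound], .assign x e s⟩
  | store a i e => exact ⟨_, by simp [timeBound], .store a i e s⟩
  | seq p q hp hq =>
    obtain ⟨t, ht, h⟩ := hp hc.1 s
    obtain ⟨t', ht', h'⟩ := hq hc.2 (p.run s)
    rw [run_var (hc.1.not_mem (by omega)), run_var (hc.1.not_mem (by omega))] at ht'
    exact ⟨t + t', by simp only [timeBound, Polynomial.eval_add]; omega, .seq h h'⟩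
  | cond c p q hp hq =>
    by_cases hs : c.Holds s
    · obtain ⟨t, ht, h⟩ := hp hc.1 s
      refine ⟨_, ?_, by rw [run, if_pos hs]; exact .condTrue hs h⟩
      simp only [timeBound, Polynomial.eval_add, Polynomial.eval_C]; omega
    · obtain ⟨t, ht, h⟩ := hq hc.2 s
      refine ⟨_, ?_, by rw [run, if_neg hs]; exact .condFalse (not_not.1 hs) h⟩
      simp only [timeBound, Polynomial.eval_add, Polynomial.eval_C]; omega
  | count x b p hp =>
    obtain ⟨hx, hxp, hwf⟩ := hc
    set B := p.timeBound.eval (s.var 0 + s.var 1) with hB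
    have hag := agree_rounds (agree_run p) x s
    have hvar : ∀ i, (rounds p.run x s i).var x = i := by
      rintro (_ | i)
      · exact State.setVar_var_self _ _ _
      · exact State.setVar_var_self _ _ _
    have hlow : ∀ i y, y < 2 → (rounds p.run x s i).var y = s.var y := by
      intro i y hy
      refine (hag i).1 y ?_
      rw [List.mem_cons, not_or]
      exact ⟨by omega, hwf.not_mem hy⟩
    have hcond : ∀ i, (Expr.sub b.expr (.var x)).eval (rounds p.run x s i) = b.val s - i := by
      intro i
      simp only [Expr.eval, Bound.eval_expr, hvar]
      rw [b.val_congr (hlow i 0 (by omega)) (hlow i 1 (by omega))]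
    have hcost : (Expr.sub b.expr (.var x)).cost ≤ 5 := by
      have := b.cost_expr
      simp only [Expr.cost]; omega
    have key : ∀ d i, i + d = b.val s → ∃ t ≤ d * (B + 10) + 6,
        Exec (.loop (.sub b.expr (.var x)) (.seq p.compile (.assign x (.add (.var x) (.lit 1)))))
          (rounds p.run x s i) (rounds p.run x s (b.val s)) t := by
      intro d
      induction d with
      | zero =>
        intro i hi
        rw [add_zero] at hi
        subst hi
        exact ⟨_, by omega, .loopDone (by rw [hcond]; omega)⟩
      | succ d ih =>
        intro i hi
        obtain ⟨t, ht, h⟩ := ih (i + 1) (by omega)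
        obtain ⟨t', ht', h'⟩ := hp hwf (rounds p.run x s i)
        rw [hlow i 0 (by omega), hlow i 1 (by omega)] at ht'
        have h2 : Exec (.assign x (.add (.var x) (.lit 1))) (p.run (rounds p.run x s i))
            (rounds p.run x s (i + 1)) 4 := by
          have := Exec.assign x (.add (.var x) (.lit 1)) (p.run (rounds p.run x s i))
          have he : (Expr.add (.var x) (.lit 1)).eval (p.run (rounds p.run x s i)) = i + 1 := by
            simp only [Expr.eval]
            rw [run_var hxp, hvar]
          rw [he] at this
          exact this
        refine ⟨_, ?_, .loopStep (by rw [hcond]; omega) (.seq h' h2) h⟩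
        rw [add_mul]
        omega
    obtain ⟨t, ht, h⟩ := key (b.val s) 0 (by omega)
    refine ⟨2 + t, ?_, .seq (.assign x (.lit 0) s) h⟩
    have h3 : b.val s * (B + 10) ≤ 2 * (s.var 0 + s.var 1) * (B + 10) :=
      Nat.mul_le_mul_right _ (b.val_le s)
    simp only [timeBound, Polynomial.eval_add, Polynomial.eval_mul, Polynomial.eval_C,
      Polynomial.eval_X]
    rw [← hB]
    omega

theorem count_induction {x : ℕ} {b : Bound} {p : Cmd} {s : State} (P : ℕ → State → Prop)
    (zero : P 0 (s.setVar x 0))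
    (succ : ∀ i σ, i < b.val s → σ.var x = i → Agree (x :: p.writtenVars) p.writtenArrs s σ →
      P i σ → P (i + 1) ((p.run σ).setVar x (i + 1))) :
    P (b.val s) ((count x b p).run s) := by
  have : ∀ i ≤ b.val s, P i (rounds p.run x s i) := by
    intro i
    induction i with
    | zero => exact fun _ => zero
    | succ i ih =>
      intro hi
      refine succ i _ (by omega) ?_ (agree_rounds (agree_run p) x s i) (ih (by omega))
      cases i <;> exact State.setVar_var_self _ _ _
  exact this _ le_rfl

end Cmd

end RAM

namespace RAM

open ArcSystem

namespace Cmd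

theorem Agree.eval_eq {vs as : List ℕ} {s σ : State} {x j : ℕ} {e : Expr}
    (h : Agree (x :: vs) as s σ) (hx : σ.var x = j) (hv : ∀ y ∈ e.readVars, y ≠ x → y ∉ vs)
    (ha : ∀ a ∈ e.readArrs, a ∉ as) : e.eval σ = e.eval (s.setVar x j) := by
  refine Expr.eval_congr (fun y hy => ?_) fun a h' => h.2 a (ha a h')
  by_cases hyx : y = x
  · subst hyx; rw [hx, State.setVar_var_self]
  · rw [h.1 y (by simp [hyx, hv y hy hyx]), State.setVar_var_ne _ _ hyx]

/-- Set the entries of the array `a` to the values of `e`. -/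
def fill (x : ℕ) (b : Bound) (a : ℕ) (e : Expr) : Cmd := count x b (store a (.var x) e)

/-- Whenever `c` holds, set the entry `i` of the array `a` to `e`. -/
def scatter (x : ℕ) (b : Bound) (c : Expr) (a : ℕ) (i e : Expr) : Cmd :=
  count x b (cond c (store a i e) skip)

/-- If `c` holds at some time, set the variable `f` to `v`. -/
def flag (x : ℕ) (b : Bound) (c : Expr) (f v : ℕ) : Cmd :=
  count x b (cond c (assign f (.lit v)) skip)

variable {x : ℕ} {b : Bound} {a f v : ℕ} {c i e : Expr}

theorem run_fill (ha : a ∉ e.readArrs) (s : State) (y : ℕ) :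
    ((fill x b a e).run s).arr a y = if y < b.val s then e.eval (s.setVar x y) else s.arr a y := by
  refine count_induction
    (fun k σ => ∀ y, σ.arr a y = if y < k then e.eval (s.setVar x y) else s.arr a y)
    (fun y => by simp) (fun k σ _ hσ hag ih y => ?_) y
  have he : e.eval σ = e.eval (s.setVar x k) :=
    hag.eval_eq hσ (by simp [writtenVars])
      (by intro d hd; simp only [writtenArrs, List.mem_singleton]; rintro rfl; exact ha hd)
  simp only [run, Expr.eval, State.setVar_arr, State.setArr_arr_self, hσ, he]
  by_cases hy : y = k
  · subst hy; simp
  · rw [Function.update_of_ne hy, ih]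
    congr 1
    exact propext (by omega)

theorem run_scatter_aux (hc : a ∉ c.readArrs) (hi : a ∉ i.readArrs) (he : a ∉ e.readArrs)
    (s : State) :
    (∀ y, (∀ j < b.val s, c.Holds (s.setVar x j) → i.eval (s.setVar x j) ≠ y) →
      ((scatter x b c a i e).run s).arr a y = s.arr a y) ∧
    ∀ y, ∀ j < b.val s, c.Holds (s.setVar x j) → i.eval (s.setVar x j) = y →
      ∃ j' < b.val s, c.Holds (s.setVar x j') ∧ i.eval (s.setVar x j') = y ∧
        ((scatter x b c a i e).run s).arr a y = e.eval (s.setVar x j') := by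
  refine count_induction
    (fun k σ => (∀ y, (∀ j < k, c.Holds (s.setVar x j) → i.eval (s.setVar x j) ≠ y) →
      σ.arr a y = s.arr a y) ∧
      ∀ y, ∀ j < k, c.Holds (s.setVar x j) → i.eval (s.setVar x j) = y →
      ∃ j' < k, c.Holds (s.setVar x j') ∧ i.eval (s.setVar x j') = y ∧
        σ.arr a y = e.eval (s.setVar x j')) ⟨fun y _ => rfl, fun y j hj => by omega⟩ ?_
  intro k σ _ hσ hag ⟨ih1, ih2⟩
  have hev : ∀ g : Expr, a ∉ g.readArrs → g.eval σ = g.eval (s.setVar x k) := fun g hg =>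
    hag.eval_eq hσ (by simp [writtenVars])
      (by intro d hd; simp only [writtenArrs, List.append_nil, List.mem_singleton]
          rintro rfl; exact hg hd)
  by_cases hh : c.Holds (s.setVar x k)
  · have hh' : c.Holds σ := by rw [Expr.Holds, hev c hc]; exact hh
    simp only [run, if_pos hh', State.setVar_arr, State.setArr_arr_self, hev i hi, hev e he]
    refine ⟨fun y hy => ?_, fun y j hj h1 h2 => ?_⟩
    · rw [Function.update_of_ne (fun h => hy k (by omega) hh h.symm)]
      exact ih1 y fun j hj => hy j (by omega)
    · by_cases hy : i.eval (s.setVar x k) = y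
      · exact ⟨k, by omega, hh, hy, by simp [hy]⟩
      · have hjk : j ≠ k := by rintro rfl; exact hy h2
        obtain ⟨j', h3, h4, h5, h6⟩ := ih2 y j (by omega) h1 h2
        exact ⟨j', by omega, h4, h5, by rw [Function.update_of_ne (Ne.symm hy), h6]⟩
  · have hh' : ¬ c.Holds σ := by rw [Expr.Holds, hev c hc]; exact hh
    simp only [run, if_neg hh', State.setVar_arr]
    refine ⟨fun y hy => ih1 y fun j hj => hy j (by omega), fun y j hj h1 h2 => ?_⟩
    have hjk : j ≠ k := by rintro rfl; exact hh h1
    obtain ⟨j', h3, h4⟩ := ih2 y j (by omega) h1 h2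
    exact ⟨j', by omega, h4⟩

theorem run_scatter_of_forall (hc : a ∉ c.readArrs) (hi : a ∉ i.readArrs) (he : a ∉ e.readArrs)
    {s : State} {y : ℕ}
    (h : ∀ j < b.val s, c.Holds (s.setVar x j) → i.eval (s.setVar x j) ≠ y) :
    ((scatter x b c a i e).run s).arr a y = s.arr a y := (run_scatter_aux hc hi he s).1 y h

theorem run_scatter_of_exists (hc : a ∉ c.readArrs) (hi : a ∉ i.readArrs) (he : a ∉ e.readArrs)
    {s : State} {j : ℕ} (hj : j < b.val s) (hh : c.Holds (s.setVar x j))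
    (hv : ∀ j' < b.val s, c.Holds (s.setVar x j') →
      i.eval (s.setVar x j') = i.eval (s.setVar x j) → e.eval (s.setVar x j') = v) :
    ((scatter x b c a i e).run s).arr a (i.eval (s.setVar x j)) = v := by
  obtain ⟨j', h1, h2, h3, h4⟩ := (run_scatter_aux hc hi he s).2 _ j hj hh rfl
  rw [h4, hv j' h1 h2 h3]

theorem run_scatter_lit (hc : a ∉ c.readArrs) (hi : a ∉ i.readArrs) (s : State) (y : ℕ)
    [Decidable (∃ j < b.val s, c.Holds (s.setVar x j) ∧ i.eval (s.setVar x j) = y)] :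
    ((scatter x b c a i (.lit v)).run s).arr a y =
      if ∃ j < b.val s, c.Holds (s.setVar x j) ∧ i.eval (s.setVar x j) = y then v
      else s.arr a y := by
  have he : a ∉ (Expr.lit v).readArrs := by simp [Expr.readArrs]
  split_ifs with h
  · obtain ⟨j, hj, hh, rfl⟩ := h
    exact run_scatter_of_exists hc hi he hj hh fun _ _ _ _ => rfl
  · exact run_scatter_of_forall hc hi he fun j hj hh hy => h ⟨j, hj, hh, hy⟩

theorem run_flag (hf : f ∉ c.readVars) (hx : f ≠ x) (s : State)
    [Decidable (∃ j < b.val s, c.Holds (s.setVar x j))] :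
    ((flag x b c f v).run s).var f =
      if ∃ j < b.val s, c.Holds (s.setVar x j) then v else s.var f := by
  classical
  refine (count_induction
    (fun k σ => σ.var f = if ∃ j < k, c.Holds (s.setVar x j) then v else s.var f)
    (by simp [State.setVar_var_ne _ _ hx]) (fun k σ _ hσ hag ih => ?_)).trans (by congr)
  have hev : c.eval σ = c.eval (s.setVar x k) := hag.eval_eq hσ
    (by intro y hy _; simp only [writtenVars, List.append_nil, List.mem_singleton]
        rintro rfl; exact hf hy) (by simp [writtenArrs])
  rw [State.setVar_var_ne _ _ hx]
  by_cases hh : c.Holds (s.setVar x k)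
  · have hh' : c.Holds σ := by rw [Expr.Holds, hev]; exact hh
    rw [if_pos ⟨k, by omega, hh⟩]
    simp [run, hh', Expr.eval]
  · have hh' : ¬ c.Holds σ := by rw [Expr.Holds, hev]; exact hh
    simp only [run, if_neg hh', ih]
    congr 1
    refine propext ⟨fun ⟨j, hj, h⟩ => ⟨j, by omega, h⟩, fun ⟨j, hj, h⟩ => ⟨j, ?_, h⟩⟩
    have : j ≠ k := by rintro rfl; exact hh h
    omega

end Cmd

/-- The set whose indicator function is given by the first `N` entries of an array. -/
def support (N : ℕ) (f : ℕ → ℕ) : Set ℕ := {x | x < N ∧ f x ≠ 0}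

namespace Cmd

/-- One round of a breadth-first search. -/
def relax (T H W D : ℕ) : Cmd :=
  count 21 .arcs (cond
    (.conj (.arr W (.var 21)) (.conj (.le (.arr D (.arr T (.var 21))) (.var 20))
      (.lt (.add (.var 20) (.lit 1)) (.arr D (.arr H (.var 21))))))
    (store D (.arr H (.var 21)) (.add (.var 20) (.lit 1))) skip)

/-- Breadth-first search along the arcs `W` with tails `T` and heads `H` from the set `S`; the
distances are stored in `D`. -/
def bfs (T H W S D : ℕ) : Cmd :=
  seq (fill 20 .verts D (.add (.add (.var 0) (.var 0)) (.lit 1)))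
    (seq (scatter 20 .verts (.arr S (.var 20)) D (.var 20) (.lit 0))
      (count 20 .rounds (relax T H W D)))

variable {T H W S D : ℕ}

@[simp] theorem writtenVars_relax : (relax T H W D).writtenVars = [21] := rfl

@[simp] theorem writtenArrs_relax : (relax T H W D).writtenArrs = [D] := rfl

@[simp] theorem writtenVars_bfs : (bfs T H W S D).writtenVars = [20, 20, 20, 21] := rfl

@[simp] theorem writtenArrs_bfs : (bfs T H W S D).writtenArrs = [D, D, D] := rfl

open Classical in
theorem run_relax (hT : T ≠ D) (hH : H ≠ D) (hW : W ≠ D) (s : State) (x : ℕ) :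
    ((relax T H W D).run s).arr D x =
      if (∃ j < 2 * s.var 1, s.arr W j ≠ 0 ∧ s.arr D (s.arr T j) ≤ s.var 20 ∧ s.arr H j = x) ∧
        s.var 20 + 1 < s.arr D x then s.var 20 + 1 else s.arr D x := by
  refine count_induction (fun k σ => ∀ x, σ.arr D x =
      if (∃ j < k, s.arr W j ≠ 0 ∧ s.arr D (s.arr T j) ≤ s.var 20 ∧ s.arr H j = x) ∧
        s.var 20 + 1 < s.arr D x then s.var 20 + 1 else s.arr D x)
    (fun x => by simp) (fun k σ _ hσ hag ih x => ?_) x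
  have h1 : σ.arr W = s.arr W := hag.2 W (by simp [writtenArrs, hW])
  have h2 : σ.arr T = s.arr T := hag.2 T (by simp [writtenArrs, hT])
  have h3 : σ.arr H = s.arr H := hag.2 H (by simp [writtenArrs, hH])
  have h4 : σ.var 20 = s.var 20 := hag.1 20 (by simp [writtenVars])
  have hle : σ.arr D (s.arr T k) ≤ s.var 20 ↔ s.arr D (s.arr T k) ≤ s.var 20 := by
    rw [ih]; split_ifs with h <;> omega
  simp only [run, Expr.holds_conj, Expr.holds_le, Expr.holds_lt, Expr.holds_arr, Expr.eval,
    h1, h2, h3, h4, hσ, hle]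
  split_ifs with hc h5 h5
  · by_cases hx : x = s.arr H k
    · subst hx; simp [State.setArr_arr_self]
    · rw [State.setVar_arr, State.setArr_arr_self, Function.update_of_ne hx, ih, if_pos]
      obtain ⟨⟨j, hj, hj'⟩, h6⟩ := h5
      refine ⟨⟨j, ?_, hj'⟩, h6⟩
      have : j ≠ k := by rintro rfl; exact hx hj'.2.2.symm
      omega
  · have hx : x ≠ s.arr H k := by
      rintro rfl
      refine h5 ⟨⟨k, by omega, hc.1, hc.2.1, rfl⟩, ?_⟩
      have := hc.2.2
      rw [ih] at this
      split_ifs at this <;> omega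
    rw [State.setVar_arr, State.setArr_arr_self, Function.update_of_ne hx, ih, if_neg]
    rintro ⟨⟨j, hj, hj'⟩, h6⟩
    exact h5 ⟨⟨j, by omega, hj'⟩, h6⟩
  · rw [State.setVar_arr]
    obtain ⟨⟨j, hj, hj'⟩, h6⟩ := h5
    by_cases hjk : j = k
    · subst hjk
      have h7 := fun h => hc ⟨hj'.1, hj'.2.1, h⟩
      rw [hj'.2.2] at h7
      rw [ih] at h7 ⊢
      split_ifs with h8
      · rfl
      · rw [if_neg h8] at h7; exact absurd h6 h7
    · rw [ih, if_pos ⟨⟨j, by omega, hj'⟩, h6⟩]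
  · rw [State.setVar_arr, ih, if_neg]
    rintro ⟨⟨j, hj, hj'⟩, h6⟩
    exact h5 ⟨⟨j, by omega, hj'⟩, h6⟩

theorem run_bfs (hT : T ≠ D) (hH : H ≠ D) (hW : W ≠ D) (hS : S ≠ D) (s : State)
    (hTn : ∀ j < 2 * s.var 1, s.arr T j < s.var 0) {x : ℕ}
    (hx : x < s.var 0) {i : ℕ} (hi : i ≤ 2 * s.var 0) :
    ((bfs T H W S D).run s).arr D x ≤ i ↔
      x ∈ reach (s.arr T) (s.arr H) (support (2 * s.var 1) (s.arr W))
        (support (s.var 0) (s.arr S)) i := by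
  classical
  rw [bfs, run, run]
  set s1 := (fill 20 .verts D (.add (.add (.var 0) (.var 0)) (.lit 1))).run s with hs1
  set s2 := (scatter 20 .verts (.arr S (.var 20)) D (.var 20) (.lit 0)).run s1 with hs2
  have ag1 : Agree [20] [D] s s1 :=
    agree_run (fill 20 .verts D (.add (.add (.var 0) (.var 0)) (.lit 1))) s
  have ag2 : Agree [20] [D] s1 s2 := (agree_run _ s1).mono (by simp [scatter, writtenVars])
    (by simp [scatter, writtenArrs])
  have ag : Agree [20] [D] s s2 := (ag1.trans ag2).mono (by simp) (by simp)
  have hv0 : s2.var 0 = s.var 0 := ag.1 0 (by simp)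
  have hv1 : s2.var 1 = s.var 1 := ag.1 1 (by simp)
  set R := reach (s.arr T) (s.arr H) (support (2 * s.var 1) (s.arr W))
        (support (s.var 0) (s.arr S)) with hR
  have hinit : ∀ x < s.var 0, s2.arr D x = if s.arr S x ≠ 0 then 0 else 2 * s.var 0 + 1 := by
    intro x hx
    rw [hs2, run_scatter_lit (by simpa [Expr.readArrs] using Ne.symm hS) (by simp [Expr.readArrs])]
    simp only [Bound.val, Expr.holds_arr, Expr.eval, State.setVar_var_self, State.setVar_arr]
    rw [ag1.1 0 (by simp), ag1.2 S (by simpa using hS)]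
    by_cases h : s.arr S x ≠ 0
    · rw [if_pos h, if_pos ⟨x, hx, h, rfl⟩]
    · rw [if_neg h, if_neg (by rintro ⟨j, -, h1, rfl⟩; exact h h1), hs1,
        run_fill (by simp [Expr.readArrs]), Bound.val, if_pos hx]
      simp only [Expr.eval]
      rw [State.setVar_var_ne _ _ (by omega)]
      omega
  have key := count_induction (x := 20) (b := .rounds) (p := relax T H W D) (s := s2)
    (fun k σ => k ≤ 2 * s.var 0 → ∀ x < s.var 0, (∀ i ≤ k, σ.arr D x ≤ i ↔ x ∈ R i) ∧
      (σ.arr D x ≤ k ∨ σ.arr D x = 2 * s.var 0 + 1)) ?_ ?_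
  · rw [Bound.val, hv0] at key
    obtain ⟨h1, h2⟩ := key le_rfl x hx
    exact h1 i hi
  · intro _ x hx
    rw [State.setVar_arr, hinit x hx]
    refine ⟨fun i hi => ?_, by split_ifs <;> simp⟩
    obtain rfl : i = 0 := by omega
    simp only [hR, reach_zero, support, Set.mem_ofPred_eq, hx, true_and]
    split_ifs with h <;> simp [h]
  · intro k σ hk hσ hag ih hk' x hx
    rw [Bound.val, hv0] at hk
    have h1 : σ.arr W = s.arr W := by
      rw [hag.2 W (by simp [hW]), ag.2 W (by simp [hW])]
    have h2 : σ.arr T = s.arr T := by rw [hag.2 T (by simp [hT]), ag.2 T (by simp [hT])]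
    have h3 : σ.arr H = s.arr H := by rw [hag.2 H (by simp [hH]), ag.2 H (by simp [hH])]
    have h4 : σ.var 1 = s.var 1 := by rw [hag.1 1 (by simp), hv1]
    rw [State.setVar_arr, run_relax hT hH hW, h1, h2, h3, h4, hσ]
    replace ih := ih (by omega)
    have hiff : (∃ j < 2 * s.var 1, s.arr W j ≠ 0 ∧ σ.arr D (s.arr T j) ≤ k ∧ s.arr H j = x) ↔
        ∃ a ∈ support (2 * s.var 1) (s.arr W), s.arr T a ∈ R k ∧ s.arr H a = x := by
      constructor
      · rintro ⟨j, hj, hw, h5, h6⟩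
        exact ⟨j, ⟨hj, hw⟩, ((ih _ (hTn j hj)).1 k le_rfl).1 h5, h6⟩
      · rintro ⟨j, ⟨hj, hw⟩, h5, h6⟩
        exact ⟨j, hj, hw, ((ih _ (hTn j hj)).1 k le_rfl).2 h5, h6⟩
    obtain ⟨ih1, ih2⟩ := ih x hx
    have hk1 : x ∈ R (k + 1) ↔ x ∈ R k ∨
      (∃ j < 2 * s.var 1, s.arr W j ≠ 0 ∧ σ.arr D (s.arr T j) ≤ k ∧ s.arr H j = x) := by
      rw [hiff]; exact mem_reach_succ
    have hk2 := ih1 k le_rfl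
    refine ⟨fun i hi => ?_, ?_⟩
    · rcases Nat.lt_or_ge k i with h5 | h5
      · obtain rfl : i = k + 1 := by omega
        rw [hk1, ← hk2]
        split_ifs with h6
        · simp [h6.1]
        · rcases ih2 with h7 | h7
          · simp [h7]; omega
          · have : ¬ ∃ j < 2 * s.var 1, s.arr W j ≠ 0 ∧ σ.arr D (s.arr T j) ≤ k ∧ s.arr H j = x :=
              fun h => h6 ⟨h, by omega⟩
            simp only [this, or_false]; omega
      · rw [← ih1 i h5]
        split_ifs with h6
        · omega
        · rfl
    · split_ifs with h6 <;> omega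

end Cmd

end RAM

namespace RAM

open ArcSystem

/-- The data of one round: the numbers of vertices and edges, the current radius, the tails, heads
and reverses of the arcs, and the indicators of the arcs present and of the vertices absorbed. -/
structure Inst where
  n : ℕ
  m : ℕ
  r : ℕ
  t : ℕ → ℕ
  h : ℕ → ℕ
  rev : ℕ → ℕ
  g : ℕ → ℕ
  a : ℕ → ℕ

namespace Inst

variable (I : Inst)

def S : Set ℕ := {x | x < I.n}

def E : Set ℕ := {j | j < 2 * I.m}

def G : Set ℕ := support (2 * I.m) I.g

def A : Set ℕ := support I.n I.a

def undir : Set ℕ := undirOut I.t I.h I.G I.rev I.A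

def back : Set ℕ := returning I.t I.h I.G I.rev I.A (2 * I.r)

def split (O : Set ℕ) : Set ℕ := cut I.t I.h I.G I.rev I.A O

def Good (O : Set ℕ) : Prop := Reentrant I.t I.h I.G I.rev I.A (2 * I.r) O

structure Valid : Prop where
  bridgefree : Bridgefree I.t I.h I.rev I.E I.G I.S
  subset : I.A ⊆ I.S
  out : I.S ⊆ reach I.t I.h I.G I.A I.r
  into : I.S ⊆ reach I.h I.t I.G I.A I.r
  pos : 1 ≤ I.r
  le : I.r ≤ I.n

variable {I}

theorem Valid.t_lt (hI : I.Valid) {j : ℕ} (hj : j < 2 * I.m) : I.t j < I.n :=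
  hI.bridgefree.tail_mem j hj

theorem Valid.h_lt (hI : I.Valid) {j : ℕ} (hj : j < 2 * I.m) : I.h j < I.n :=
  hI.bridgefree.head_mem (E := I.E) hj

theorem Valid.rev_lt (hI : I.Valid) {j : ℕ} (hj : j < 2 * I.m) : I.rev j < 2 * I.m :=
  hI.bridgefree.rev_mem j hj

theorem mem_A {x : ℕ} (hx : x < I.n) : x ∈ I.A ↔ I.a x ≠ 0 := by
  simp [A, support, hx]

theorem mem_G {j : ℕ} (hj : j < 2 * I.m) : j ∈ I.G ↔ I.g j ≠ 0 := by
  simp [G, support, hj]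

theorem Valid.mem_undir (hI : I.Valid) {j : ℕ} (hj : j < 2 * I.m) :
    j ∈ I.undir ↔ I.g j ≠ 0 ∧ I.g (I.rev j) ≠ 0 ∧ I.a (I.t j) ≠ 0 ∧ ¬ I.a (I.h j) ≠ 0 := by
  rw [← mem_G hj, ← mem_G (hI.rev_lt hj), ← mem_A (hI.t_lt hj), ← mem_A (hI.h_lt hj)]
  rfl

end Inst

/-- The state `s` holds the data `I`, the tails and heads being stored in the arrays `T` and `H`. -/
structure Loaded (T H : ℕ) (I : Inst) (s : State) : Prop where
  var_n : s.var 0 = I.n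
  var_m : s.var 1 = I.m
  var_r : s.var 5 = I.r
  arr_t : s.arr T = I.t
  arr_h : s.arr H = I.h
  arr_g : s.arr 6 = I.g
  arr_rev : s.arr 7 = I.rev
  arr_a : s.arr 10 = I.a
  four_le_T : 4 ≤ T
  T_le_five : T ≤ 5
  four_le_H : 4 ≤ H
  H_le_five : H ≤ 5

variable {T H : ℕ} {I : Inst} {s σ : State}

theorem Loaded.agree {vs as : List ℕ} (hs : Loaded T H I s) (hag : Cmd.Agree vs as s σ)
    (hv : ∀ y ∈ vs, 5 < y) (ha : ∀ b ∈ as, b = 3 ∨ 10 < b) : Loaded T H I σ := by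
  have h1 : ∀ y ≤ 5, σ.var y = s.var y := fun y hy => hag.1 y fun h => by have := hv y h; omega
  have h2 : ∀ b, 4 ≤ b → b ≤ 10 → σ.arr b = s.arr b := fun b hb hb' => hag.2 b fun h => by
    have := ha b h; omega
  have := hs.four_le_T; have := hs.T_le_five; have := hs.four_le_H; have := hs.H_le_five
  exact ⟨(h1 _ (by omega)).trans hs.var_n, (h1 _ (by omega)).trans hs.var_m,
    (h1 _ (by omega)).trans hs.var_r, (h2 _ (by omega) (by omega)).trans hs.arr_t,
    (h2 _ (by omega) (by omega)).trans hs.arr_h, (h2 _ (by omega) (by omega)).trans hs.arr_g,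
    (h2 _ (by omega) (by omega)).trans hs.arr_rev, (h2 _ (by omega) (by omega)).trans hs.arr_a,
    by omega, by omega, by omega, by omega⟩

theorem Loaded.swap (hs : Loaded T H I s) :
    Loaded H T ⟨I.n, I.m, I.r, I.h, I.t, I.rev, I.g, I.a⟩ s :=
  ⟨hs.1, hs.2, hs.3, hs.5, hs.4, hs.6, hs.7, hs.8, hs.11, hs.12, hs.9, hs.10⟩

theorem Loaded.run (hs : Loaded T H I s) {c : Cmd} (hv : ∀ y ∈ c.writtenVars, 5 < y)
    (ha : ∀ b ∈ c.writtenArrs, b = 3 ∨ 10 < b) : Loaded T H I (c.run s) :=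
  hs.agree (c.agree_run s) hv ha

theorem Loaded.setVar (hs : Loaded T H I s) {x v : ℕ} (hx : 5 < x) : Loaded T H I (s.setVar x v) :=
  hs.agree (vs := [x]) (as := []) ⟨fun y hy => State.setVar_var_ne _ _ (by simpa using hy),
    fun _ _ => rfl⟩ (by simpa using hx) (by simp)

theorem Loaded.setArr (hs : Loaded T H I s) {b i v : ℕ} (hb : b = 3 ∨ 10 < b) :
    Loaded T H I (s.setArr b i v) :=
  hs.agree (vs := []) (as := [b]) ⟨fun _ _ => rfl,
    fun a ha => State.setArr_arr_ne _ _ _ (by simpa using ha)⟩ (by simp) (by simpa using hb)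

namespace Cmd

/-- The arc in variable `x` leads out of the absorbed set along an undirected edge. -/
def undirTest (T H x : ℕ) : Expr :=
  .conj (.arr 6 (.var x)) (.conj (.arr 6 (.arr 7 (.var x)))
    (.conj (.arr 10 (.arr T (.var x))) (.neg (.arr 10 (.arr H (.var x))))))

theorem holds_undirTest (hs : Loaded T H I s) (hI : I.Valid) {x : ℕ} (hx : s.var x < 2 * I.m) :
    (undirTest T H x).Holds s ↔ s.var x ∈ I.undir := by
  rw [hI.mem_undir hx]
  simp only [undirTest, Expr.holds_conj, Expr.holds_neg, Expr.holds_arr, Expr.eval, hs.arr_g,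
    hs.arr_rev, hs.arr_t, hs.arr_h, hs.arr_a]

def dropEdge : Cmd :=
  fill 22 .arcs 12 (.conj (.arr 6 (.var 22)) (.conj (.ne (.var 22) (.var 23))
    (.ne (.var 22) (.arr 7 (.var 23)))))

theorem support_dropEdge (hs : Loaded T H I s) :
    support (2 * I.m) ((dropEdge.run s).arr 12) = I.G \ {s.var 23, I.rev (s.var 23)} := by
  ext y
  simp only [support, Set.mem_ofPred_eq, Inst.G, Set.mem_sdiff, Set.mem_insert_iff,
    Set.mem_singleton_iff, not_or]
  rw [dropEdge, run_fill (by simp [Expr.conj, Expr.ne, Expr.neg, Expr.readArrs]), Bound.val, hs.var_m]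
  by_cases hy : y < 2 * I.m
  · rw [if_pos hy]
    change _ ∧ Expr.Holds _ _ ↔ _
    have hs' := hs.setVar (x := 22) (v := y) (by omega)
    simp only [Expr.holds_conj, Expr.holds_ne, Expr.holds_arr, Expr.eval, hs'.arr_g, hs'.arr_rev,
      State.setVar_var_self]
    rw [State.setVar_var_ne _ _ (by omega : (23 : ℕ) ≠ 22)]
    tauto
  · simp [hy]

/-- Find the undirected edges that may be oriented out of the absorbed set. -/
def findReturning (T H : ℕ) : Cmd :=
  count 23 .arcs (cond (undirTest T H 23)
    (seq dropEdge (seq (bfs H T 12 10 13)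
      (store 11 (.var 23) (.le (.arr 13 (.arr H (.var 23))) (.add (.var 5) (.var 5))))))
    (store 11 (.var 23) (.lit 0)))

theorem Loaded.bfs_iff (hs : Loaded T H I s) (hI : I.Valid) {W D : ℕ} (hD : 10 < D) (hW : W ≠ D)
    {x : ℕ} (hx : x < I.n) {i : ℕ} (hi : i ≤ 2 * I.n) :
    ((bfs T H W 10 D).run s).arr D x ≤ i ↔
      x ∈ reach I.t I.h (support (2 * I.m) (s.arr W)) I.A i := by
  have := hs.T_le_five; have := hs.H_le_five
  rw [run_bfs (by omega) (by omega) hW (by omega) s (by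
      rw [hs.var_m, hs.var_n, hs.arr_t]; exact fun j hj => hI.t_lt hj) (by rwa [hs.var_n])
      (by rwa [hs.var_n]), hs.arr_t, hs.arr_h, hs.var_m, hs.var_n, hs.arr_a]
  rfl

end Cmd

theorem Inst.Valid.swap (hI : I.Valid) :
    (⟨I.n, I.m, I.r, I.h, I.t, I.rev, I.g, I.a⟩ : Inst).Valid :=
  ⟨hI.bridgefree.symm, hI.subset, hI.into, hI.out, hI.pos, hI.le⟩

namespace Cmd

theorem run_findReturning (hs : Loaded T H I s) (hI : I.Valid) :
    ∀ j < 2 * I.m, ((findReturning T H).run s).arr 11 j ≠ 0 ↔ j ∈ I.back := by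
  have hr := hI.le
  have key := count_induction (x := 23) (b := .arcs) (s := s)
    (p := cond (undirTest T H 23) (seq dropEdge (seq (bfs H T 12 10 13)
      (store 11 (.var 23) (.le (.arr 13 (.arr H (.var 23))) (.add (.var 5) (.var 5))))))
    (store 11 (.var 23) (.lit 0)))
    (fun k σ => Loaded T H I σ ∧ ∀ j < k, σ.arr 11 j ≠ 0 ↔ j ∈ I.back)
    ⟨hs.setVar (by omega), fun j hj => by omega⟩ ?_
  · rw [Bound.val, hs.var_m] at key
    exact key.2
  intro k σ hk hσ _ ⟨hl, ih⟩
  rw [Bound.val, hs.var_m] at hk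
  have hund := holds_undirTest hl hI (x := 23) (by omega)
  rw [hσ] at hund
  rw [run]
  split_ifs with h
  · set σ1 := dropEdge.run σ with hσ1
    have hl1 : Loaded T H I σ1 := hl.run (by simp [dropEdge, fill, writtenVars])
      (by simp [dropEdge, fill, writtenArrs])
    have hsup := support_dropEdge hl
    rw [← hσ1, hσ] at hsup
    have hb := fun {x : ℕ} (hx : x < I.n) {i : ℕ} (hi : i ≤ 2 * I.n) =>
      Loaded.bfs_iff hl1.swap hI.swap (W := 12) (D := 13) (by omega)
      (by omega) (x := x) hx (i := i) hi
    have hl2 : Loaded T H I ((bfs H T 12 10 13).run σ1) := hl1.run (by simp) (by simp)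
    have h11 : ((bfs H T 12 10 13).run σ1).arr 11 = σ.arr 11 := by
      rw [run_arr (by simp), hσ1, run_arr (by simp [dropEdge, fill, writtenArrs])]
    have h23 : ((bfs H T 12 10 13).run σ1).var 23 = k := by
      rw [run_var (by simp), hσ1, run_var (by simp [dropEdge, fill, writtenVars]), hσ]
    set σ2 := (bfs H T 12 10 13).run σ1 with hσ2
    change Loaded T H I (((store 11 _ _).run σ2).setVar 23 (k + 1)) ∧ ∀ j < k + 1,
      (((store 11 _ _).run σ2).setVar 23 (k + 1)).arr 11 j ≠ 0 ↔ _
    refine ⟨(hl2.setArr (by omega)).setVar (by omega), fun j hj => ?_⟩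
    rw [State.setVar_arr, run, State.setArr_arr_self, Expr.eval, h23, h11]
    by_cases hjk : j = k
    · subst hjk
      rw [Function.update_self]
      change Expr.Holds _ _ ↔ _
      rw [Expr.holds_le]
      simp only [Expr.eval, hl2.arr_h, hl2.var_r, h23]
      rw [← two_mul, hb (hI.h_lt hk) (by omega), hsup]
      exact ⟨fun h1 => ⟨hund.1 h, h1⟩, fun h1 => h1.2⟩
    · rw [Function.update_of_ne hjk]
      exact ih j (by omega)
  · refine ⟨(hl.setArr (by omega)).setVar (by omega), fun j hj => ?_⟩
    have he : (Expr.var 23).eval σ = k := hσ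
    rw [State.setVar_arr, run, State.setArr_arr_self, he]
    by_cases hjk : j = k
    · subst hjk
      simp only [Function.update_self, Expr.eval, ne_eq, not_true_eq_false, false_iff]
      exact fun h1 => h (hund.2 h1.1)
    · rw [Function.update_of_ne hjk]
      exact ih j (by omega)

/-- Orient the undirected edges that leave the absorbed set. -/
def splitArcs (T H : ℕ) : Cmd :=
  fill 22 .arcs 14 (.conj (.arr 6 (.var 22)) (.conj (.neg (.arr 11 (.arr 7 (.var 22))))
    (.neg (.conj (undirTest T H 22) (.neg (.arr 11 (.var 22)))))))

theorem readArrs_splitArcs (hT : T ≤ 5) (hH : H ≤ 5) (b : ℕ) (hb : 12 ≤ b) :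
    b ∉ (Expr.conj (.arr 6 (.var 22)) (.conj (.neg (.arr 11 (.arr 7 (.var 22))))
    (.neg (.conj (undirTest T H 22) (.neg (.arr 11 (.var 22))))))).readArrs := by
  simp [undirTest, Expr.conj, Expr.neg, Expr.readArrs]
  omega

theorem support_splitArcs (hs : Loaded T H I s) (hI : I.Valid) :
    support (2 * I.m) (((splitArcs T H).run s).arr 14) =
      I.split (support (2 * I.m) (s.arr 11)) := by
  ext y
  rw [splitArcs, support, Set.mem_ofPred_eq,
    run_fill (readArrs_splitArcs hs.T_le_five hs.H_le_five _ (by omega)), Bound.val, hs.var_m]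
  by_cases hy : y < 2 * I.m
  · rw [if_pos hy]
    change _ ∧ Expr.Holds _ _ ↔ _
    have hs' := hs.setVar (x := 22) (v := y) (by omega)
    have h1 := holds_undirTest hs' hI (x := 22) (by simpa)
    simp only [Expr.holds_conj, Expr.holds_neg, Expr.holds_arr, Expr.eval, hs'.arr_g, hs'.arr_rev,
      State.setVar_var_self, State.setVar_arr, h1]
    simp only [Inst.split, cut, Set.mem_ofPred_eq, Inst.mem_G hy, support, hy, hI.rev_lt hy, true_and,
      Inst.undir]
    tauto
  · simp only [hy, false_and, false_iff]
    exact fun h => hy h.1.1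

/-- Test whether the edges into the absorbed set close short cycles; the distances from the absorbed
set are stored in array `15`. -/
def test (T H : ℕ) : Cmd :=
  seq (splitArcs T H) (seq (bfs T H 14 10 15) (seq (assign 24 (.lit 1))
    (flag 22 .arcs (.conj (.arr 14 (.var 22)) (.conj (.neg (.arr 10 (.arr T (.var 22))))
      (.conj (.arr 10 (.arr H (.var 22)))
        (.lt (.add (.var 5) (.var 5)) (.arr 15 (.arr T (.var 22))))))) 24 0)))

theorem writtenVars_test : (test T H).writtenVars = [22, 20, 20, 20, 21, 24, 22, 24] := rfl

theorem writtenArrs_test : (test T H).writtenArrs = [14, 15, 15, 15] := rfl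

theorem run_test (hs : Loaded T H I s) (hI : I.Valid) :
    support (2 * I.m) (((test T H).run s).arr 14) = I.split (support (2 * I.m) (s.arr 11)) ∧
    (∀ x < I.n, ∀ i ≤ 2 * I.n, ((test T H).run s).arr 15 x ≤ i ↔
      x ∈ reach I.t I.h (I.split (support (2 * I.m) (s.arr 11))) I.A i) ∧
    (((test T H).run s).var 24 ≠ 0 ↔ I.Good (support (2 * I.m) (s.arr 11))) := by
  classical
  have hr := hI.le
  set s1 := (splitArcs T H).run s with hs1
  have hl1 : Loaded T H I s1 := hs.run (by simp [splitArcs, fill, writtenVars])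
      (by simp [splitArcs, fill, writtenArrs])
  have hsup := support_splitArcs hs hI
  rw [← hs1] at hsup
  set s2 := (bfs T H 14 10 15).run s1 with hs2
  have hl2 : Loaded T H I s2 := hl1.run (by simp) (by simp)
  have h14 : s2.arr 14 = s1.arr 14 := by rw [hs2, run_arr (by simp)]
  have hd : ∀ x < I.n, ∀ i ≤ 2 * I.n, s2.arr 15 x ≤ i ↔
      x ∈ reach I.t I.h (I.split (support (2 * I.m) (s.arr 11))) I.A i := by
    intro x hx i hi
    rw [hs2, Loaded.bfs_iff hl1 hI (by omega) (by omega) hx hi, hsup]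
  have e14 : ((test T H).run s).arr 14 = s2.arr 14 := by
    simp only [test, run]
    rw [run_arr (by simp [flag, writtenArrs])]; rfl
  have e15 : ((test T H).run s).arr 15 = s2.arr 15 := by
    simp only [test, run]
    rw [run_arr (by simp [flag, writtenArrs])]; rfl
  refine ⟨by rw [e14, h14, hsup], fun x hx i hi => by rw [e15]; exact hd x hx i hi, ?_⟩
  set s3 := (assign 24 (.lit 1)).run s2 with hs3
  have hl3 : Loaded T H I s3 := hl2.setVar (by omega)
  change ((flag 22 .arcs _ 24 0).run s3).var 24 ≠ 0 ↔ _
  rw [run_flag (by simp [Expr.conj, Expr.neg, Expr.lt, Expr.readVars]) (by omega)]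
  have e3 : s3.arr = s2.arr := funext fun b => run_arr (by simp [writtenArrs]) _
  have h24 : s3.var 24 = 1 := by simp [hs3, run, Expr.eval]
  rw [h24]
  simp only [ne_eq, ite_eq_left_iff, not_exists, not_and, one_ne_zero, imp_false, not_forall,
    not_not, Bound.val, hl3.var_m]
  have hiff : ∀ j < 2 * I.m, Expr.Holds (s3.setVar 22 j)
      (.conj (.arr 14 (.var 22)) (.conj (.neg (.arr 10 (.arr T (.var 22))))
        (.conj (.arr 10 (.arr H (.var 22)))
        (.lt (.add (.var 5) (.var 5)) (.arr 15 (.arr T (.var 22))))))) ↔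
      j ∈ I.split (support (2 * I.m) (s.arr 11)) ∧ I.t j ∉ I.A ∧ I.h j ∈ I.A ∧
        I.t j ∉ reach I.t I.h (I.split (support (2 * I.m) (s.arr 11))) I.A (2 * I.r) := by
    intro j hj
    have hl' := hl3.setVar (x := 22) (v := j) (by omega)
    rw [← hd _ (hI.t_lt hj) _ (by omega), Inst.mem_A (hI.t_lt hj), Inst.mem_A (hI.h_lt hj), ← hsup]
    simp only [Expr.holds_conj, Expr.holds_neg, Expr.holds_lt, Expr.holds_arr, Expr.eval,
      hl'.arr_a, hl'.arr_t, hl'.arr_h, hl'.var_r, State.setVar_var_self, State.setVar_arr]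
    rw [e3, h14, support, Set.mem_ofPred_eq, not_le, two_mul I.r]
    exact ⟨fun h => ⟨⟨hj, h.1⟩, h.2⟩, fun h => ⟨h.1.2, h.2⟩⟩
  constructor
  · rintro h x ⟨j, hj, h1, h2, rfl⟩
    by_contra h3
    have hjE : j < 2 * I.m := hj.1.1
    exact h j hjE ((hiff j hjE).2 ⟨hj, h1, h2, h3⟩)
  · intro h j hj hh
    obtain ⟨h1, h2, h3, h4⟩ := (hiff j hj).1 hh
    exact h4 (h ⟨j, h1, h2, h3, rfl⟩)

/-- Find a minimal set of edges to orient out of the absorbed set. -/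
def shrink (T H : ℕ) : Cmd :=
  count 23 .arcs (cond (.arr 11 (.var 23))
    (seq (store 11 (.var 23) (.lit 0)) (seq (test T H)
      (cond (.var 24) skip (store 11 (.var 23) (.lit 1))))) skip)

theorem run_shrink (hs : Loaded T H I s) (hI : I.Valid)
    (h0 : support (2 * I.m) (s.arr 11) = I.back) :
    support (2 * I.m) (((shrink T H).run s).arr 11) ⊆ I.back ∧
    I.Good (support (2 * I.m) (((shrink T H).run s).arr 11)) ∧
    ∀ a ∈ support (2 * I.m) (((shrink T H).run s).arr 11),
      ¬ I.Good (support (2 * I.m) (((shrink T H).run s).arr 11) \ {a}) := by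
  have key := count_induction (x := 23) (b := .arcs) (s := s)
    (p := cond (.arr 11 (.var 23))
    (seq (store 11 (.var 23) (.lit 0)) (seq (test T H)
      (cond (.var 24) skip (store 11 (.var 23) (.lit 1))))) skip)
    (fun k σ => Loaded T H I σ ∧ support (2 * I.m) (σ.arr 11) ⊆ I.back ∧
      I.Good (support (2 * I.m) (σ.arr 11)) ∧ ∀ a < k, a ∈ support (2 * I.m) (σ.arr 11) →
      ¬ I.Good (support (2 * I.m) (σ.arr 11) \ {a}))
    ⟨hs.setVar (by omega), h0.le, ?_, fun j hj => by omega⟩ ?_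
  · rw [Bound.val, hs.var_m] at key
    exact ⟨key.2.1, key.2.2.1, fun a ha => key.2.2.2 a ha.1 ha⟩
  · rw [State.setVar_arr, h0]
    exact reentrant_returning hI.bridgefree hI.out hI.into hI.pos
  intro k σ hk hσ _ ⟨hl, ih1, ih2, ih3⟩
  rw [Bound.val, hs.var_m] at hk
  have hsub : ∀ {O O' : Set ℕ}, O ⊆ I.back → O' ⊆ O → ∀ a, ¬ I.Good (O \ {a}) →
      ¬ I.Good (O' \ {a}) := fun h1 h2 a h3 h4 =>
    h3 (Reentrant.mono hI.bridgefree ((Set.sdiff_subset.trans h1).trans returning_subset)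
      (Set.sdiff_subset_sdiff_left h2) h4)
  by_cases hk0 : σ.arr 11 k ≠ 0
  · have hc : (Expr.arr 11 (.var 23)).Holds σ := by rw [Expr.holds_arr, Expr.eval, hσ]; exact hk0
    set σ1 := σ.setArr 11 k 0 with hσ1
    set σ2 := (test T H).run σ1 with hσ2
    have hl1 : Loaded T H I σ1 := hl.setArr (by omega)
    have hl2 : Loaded T H I σ2 := hl1.run (by simp [writtenVars_test]) (by simp [writtenArrs_test])
    have hO1 : support (2 * I.m) (σ1.arr 11) = support (2 * I.m) (σ.arr 11) \ {k} := by
      ext y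
      by_cases hy : y = k <;> simp [support, hσ1, State.setArr_arr_self, Function.update, hy]
    have h11 : σ2.arr 11 = σ1.arr 11 := run_arr (by simp [writtenArrs_test]) _
    have h23 : σ2.var 23 = k := by
      rw [hσ2, run_var (by simp [writtenVars_test])]; exact hσ
    have htest := (run_test hl1 hI).2.2
    rw [← hσ2, hO1] at htest
    have hrun : (cond (.arr 11 (.var 23)) (seq (store 11 (.var 23) (.lit 0)) (seq (test T H)
        (cond (.var 24) skip (store 11 (.var 23) (.lit 1))))) skip).run σ =
        (cond (.var 24) skip (store 11 (.var 23) (.lit 1))).run σ2 := by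
      have he : (Expr.var 23).eval σ = k := hσ
      rw [run, if_pos hc, run, run, run, he, hσ2, hσ1]; rfl
    rw [hrun, run]
    by_cases hgood : I.Good (support (2 * I.m) (σ.arr 11) \ {k})
    · rw [if_pos (show (Expr.var 24).Holds σ2 from htest.2 hgood), run, State.setVar_arr, h11, hO1]
      refine ⟨hl2.setVar (by omega), Set.sdiff_subset.trans ih1, hgood, fun a ha haO => ?_⟩
      have hak : a ≠ k := haO.2
      exact hsub ih1 Set.sdiff_subset a (ih3 a (by omega) haO.1)
    · have hO2 : Function.update (σ2.arr 11) k 1 = Function.update (σ.arr 11) k 1 := by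
        rw [h11, hσ1, State.setArr_arr_self, Function.update_idem]
      have hO3 : support (2 * I.m) (Function.update (σ.arr 11) k 1) =
          support (2 * I.m) (σ.arr 11) := by
        ext y
        by_cases hy : y = k <;> simp [support, Function.update, hy, hk0]
      rw [if_neg (show ¬ (Expr.var 24).Holds σ2 from fun h => hgood (htest.1 h)), run,
        State.setVar_arr, State.setArr_arr_self, Expr.eval, Expr.eval, h23, hO2, hO3]
      refine ⟨(hl2.setArr (by omega)).setVar (by omega), ih1, ih2, fun a ha haO => ?_⟩
      by_cases hak : a = k
      · rwa [hak]
      · exact ih3 a (by omega) haO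
  · have hc : ¬ (Expr.arr 11 (.var 23)).Holds σ := by
      rw [Expr.holds_arr, Expr.eval, hσ]; exact hk0
    rw [run, if_neg hc, run, State.setVar_arr]
    refine ⟨hl.setVar (by omega), ih1, ih2, fun a ha haO => ih3 a ?_ haO⟩
    have : a ≠ k := by rintro rfl; exact hk0 haO.2
    omega

end Cmd

end RAM

namespace RAM

open ArcSystem

variable {T H : ℕ} {I : Inst} {s σ : State}

namespace Cmd

/-- Compute the vertices on shortest paths from `B` to `Z` and the arcs on shortest paths. -/
def spanCmd (T H W B Z D P Q K : ℕ) : Cmd :=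
  seq (bfs T H W B D) (seq
    (fill 22 .arcs P (.conj (.arr W (.var 22))
      (.conj (.le (.arr D (.arr T (.var 22))) (.add (.var 0) (.var 0)))
        (.lt (.arr D (.arr T (.var 22))) (.arr D (.arr H (.var 22)))))))
    (seq (bfs H T P Z Q)
      (fill 22 .verts K (.disj (.arr B (.var 22)) (.le (.arr Q (.var 22)) (.add (.var 0) (.var 0)))))))

theorem writtenVars_spanCmd {T H W B Z D P Q K : ℕ} : (spanCmd T H W B Z D P Q K).writtenVars =
    [20, 20, 20, 21, 22, 20, 20, 20, 21, 22] := rfl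

theorem writtenArrs_spanCmd {T H W B Z D P Q K : ℕ} : (spanCmd T H W B Z D P Q K).writtenArrs =
    [D, D, D, P, Q, Q, Q, K] := rfl

theorem run_spanCmd (hs : Loaded T H I s) (hI : I.Valid) {W B Z D P Q K : ℕ}
    (hne : ∀ a ∈ [W, B, Z], a ∉ [D, P, Q, K]) (hnd : [D, P, Q, K].Nodup)
    (hD : ∀ a ∈ [D, P, Q, K], 10 < a) :
    support I.n (((spanCmd T H W B Z D P Q K).run s).arr K) = span I.t I.h (2 * I.n)
      (support (2 * I.m) (s.arr W)) (support I.n (s.arr B)) (support I.n (s.arr Z)) ∧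
    support (2 * I.m) (((spanCmd T H W B Z D P Q K).run s).arr P) =
      ascending I.t I.h (2 * I.n) (support (2 * I.m) (s.arr W)) (support I.n (s.arr B)) := by
  have hTH : ∀ a ∈ [D, P, Q, K], T ≠ a ∧ H ≠ a := fun a ha => by
    have := hs.T_le_five; have := hs.H_le_five; have := hD a ha; omega
  simp only [List.mem_cons, List.not_mem_nil, or_false, forall_eq_or_imp, forall_eq, not_or,
    List.nodup_cons, not_false_eq_true, List.nodup_nil, and_true] at hne hnd hD hTH
  obtain ⟨⟨hWD, hWP, hWQ, hWK⟩, ⟨hBD, hBP, hBQ, hBK⟩, hZD, hZP, hZQ, hZK⟩ := hne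
  obtain ⟨⟨hDP, hDQ, hDK⟩, ⟨hPQ, hPK⟩, hQK⟩ := hnd
  obtain ⟨⟨hTD, hHD⟩, ⟨hTP, hHP⟩, ⟨hTQ, hHQ⟩, hTK, hHK⟩ := hTH
  set W' := support (2 * I.m) (s.arr W) with hW'
  set B' := support I.n (s.arr B) with hB'
  obtain ⟨s1, hs1⟩ : ∃ σ, (bfs T H W B D).run s = σ := ⟨_, rfl⟩
  have hl1 : Loaded T H I s1 := hs1 ▸ hs.run (by simp) (by simp [hD])
  have hd : ∀ x < I.n, ∀ i ≤ 2 * I.n, s1.arr D x ≤ i ↔ x ∈ reach I.t I.h W' B' i := by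
    intro x hx i hi
    rw [← hs1, run_bfs hTD hHD hWD hBD s (by
      rw [hs.var_m, hs.var_n, hs.arr_t]; exact fun j hj => hI.t_lt hj) (by rwa [hs.var_n])
      (by rwa [hs.var_n]), hs.arr_t, hs.arr_h, hs.var_m, hs.var_n]
  obtain ⟨s2, hs2⟩ : ∃ σ, (fill 22 .arcs P (.conj (.arr W (.var 22))
      (.conj (.le (.arr D (.arr T (.var 22))) (.add (.var 0) (.var 0)))
        (.lt (.arr D (.arr T (.var 22))) (.arr D (.arr H (.var 22))))))).run s1 = σ := ⟨_, rfl⟩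
  have hl2 : Loaded T H I s2 := hs2 ▸ hl1.run (by simp [fill, writtenVars])
    (by simp [fill, writtenArrs, hD])
  have hP : support (2 * I.m) (s2.arr P) = ascending I.t I.h (2 * I.n) W' B' := by
    ext y
    rw [support, Set.mem_ofPred_eq, ← hs2, run_fill (by
      simp [Expr.conj, Expr.neg, Expr.le, Expr.lt, Expr.readArrs, Ne.symm hWP, Ne.symm hDP, hTP.symm,
        hHP.symm]), Bound.val, hl1.var_m]
    by_cases hy : y < 2 * I.m
    · rw [if_pos hy]
      change _ ∧ Expr.Holds _ _ ↔ _
      have hl' := hl1.setVar (x := 22) (v := y) (by omega)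
      have hWs : s1.arr W = s.arr W := by rw [← hs1, run_arr (by simp [hWD])]
      simp only [Expr.holds_conj, Expr.holds_le, Expr.holds_lt, Expr.holds_arr, Expr.eval,
        hl'.arr_t, hl'.arr_h, hl'.var_n, State.setVar_var_self, State.setVar_arr, hWs, hy, true_and]
      have hyW : y ∈ W' ↔ s.arr W y ≠ 0 := by simp [hW', support, hy]
      rw [ascending, Set.mem_ofPred_eq, hyW, ← two_mul]
      refine and_congr_right fun _ => ⟨fun ⟨h1, h2⟩ => ⟨s1.arr D (I.t y), h1, ?_, ?_⟩, ?_⟩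
      · exact (hd _ (hI.t_lt hy) _ h1).1 le_rfl
      · exact fun h => absurd ((hd _ (hI.h_lt hy) _ h1).2 h) (by omega)
      · rintro ⟨k, hk, h1, h2⟩
        rw [← hd _ (hI.t_lt hy) _ hk] at h1
        rw [← hd _ (hI.h_lt hy) _ hk] at h2
        omega
    · simp only [hy, false_and, false_iff]
      exact fun h => hy h.1.1
  obtain ⟨s3, hs3⟩ : ∃ σ, (bfs H T P Z Q).run s2 = σ := ⟨_, rfl⟩
  have hl3 : Loaded T H I s3 := hs3 ▸ hl2.run (by simp) (by simp [hD])
  have hZs : s2.arr Z = s.arr Z := by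
    rw [← hs2, run_arr (by simp [fill, writtenArrs, hZP]), ← hs1, run_arr (by simp [hZD])]
  have hBs : s3.arr B = s.arr B := by
    rw [← hs3, run_arr (by simp [hBQ]), ← hs2, run_arr (by simp [fill, writtenArrs, hBP]), ← hs1,
      run_arr (by simp [hBD])]
  have hq : ∀ x < I.n, s3.arr Q x ≤ 2 * I.n ↔
      x ∈ reach I.h I.t (ascending I.t I.h (2 * I.n) W' B') (support I.n (s.arr Z)) (2 * I.n) := by
    intro x hx
    rw [← hs3, run_bfs hHQ hTQ hPQ hZQ s2 (by
      rw [hl2.var_m, hl2.var_n, hl2.arr_h]; exact fun j hj => hI.h_lt hj) (by rwa [hl2.var_n])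
      (by rw [hl2.var_n]), hl2.arr_t, hl2.arr_h, hl2.var_m, hl2.var_n, hP, hZs]
  have hrun : (spanCmd T H W B Z D P Q K).run s = (fill 22 .verts K
    (.disj (.arr B (.var 22)) (.le (.arr Q (.var 22)) (.add (.var 0) (.var 0))))).run s3 := by
    rw [← hs3, ← hs2, ← hs1]; rfl
  rw [hrun]
  constructor
  · ext y
    rw [support, Set.mem_ofPred_eq, run_fill (by
      simp [Expr.disj, Expr.neg, Expr.le, Expr.readArrs, Ne.symm hBK, Ne.symm hQK]), Bound.val, hl3.var_n]
    by_cases hy : y < I.n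
    · rw [if_pos hy]
      change _ ∧ Expr.Holds _ _ ↔ _
      have hl' := hl3.setVar (x := 22) (v := y) (by omega)
      simp only [Expr.holds_disj, Expr.holds_le, Expr.holds_arr, Expr.eval,
        hl'.var_n, State.setVar_var_self, State.setVar_arr, hBs, hy, true_and]
      rw [← two_mul, hq y hy, span, Set.mem_union, hB', support, Set.mem_ofPred_eq]
      simp only [hy, true_and]
    · simp only [hy, false_and, false_iff]
      rintro (h1 | h1)
      · exact hy h1.1
      · exact hy (reach_subset (S := {x | x < I.n}) (fun x hx => hx.1)
          (fun a ha _ => hI.t_lt ha.1.1) h1)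
  · rw [run_arr (by simp [fill, writtenArrs, hPK]), ← hs3, run_arr (by simp [hPQ]), hP]

/-- Mark the vertices with arcs into the absorbed set in array `16`, and those with arcs from it in
array `26`. -/
def marks (T H : ℕ) : Cmd :=
  seq (fill 22 .verts 16 (.lit 0)) (seq
    (scatter 22 .arcs (.conj (.arr 14 (.var 22)) (.conj (.neg (.arr 10 (.arr T (.var 22))))
      (.arr 10 (.arr H (.var 22))))) 16 (.arr T (.var 22)) (.lit 1)) (seq
    (fill 22 .verts 26 (.lit 0))
    (scatter 22 .arcs (.conj (.arr 14 (.var 22)) (.conj (.arr 10 (.arr T (.var 22)))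
      (.neg (.arr 10 (.arr H (.var 22)))))) 26 (.arr H (.var 22)) (.lit 1))))

theorem writtenVars_marks : (marks T H).writtenVars = [22, 22, 22, 22] := rfl

theorem writtenArrs_marks : (marks T H).writtenArrs = [16, 16, 26, 26] := rfl

theorem run_marks (hs : Loaded T H I s) (hI : I.Valid) :
    support I.n (((marks T H).run s).arr 16) =
      entering I.t I.h I.A (support (2 * I.m) (s.arr 14)) ∧
    support I.n (((marks T H).run s).arr 26) =
      leaving I.t I.h I.A (support (2 * I.m) (s.arr 14)) := by
  classical
  have := hs.T_le_five; have := hs.H_le_five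
  set s1 := (fill 22 .verts 16 (.lit 0)).run s with hs1
  have hl1 : Loaded T H I s1 := hs.run (by simp [fill, writtenVars]) (by simp [fill, writtenArrs])
  set c1 := Expr.conj (.arr 14 (.var 22)) (.conj (.neg (.arr 10 (.arr T (.var 22))))
      (.arr 10 (.arr H (.var 22)))) with hc1
  set s2 := (scatter 22 .arcs c1 16 (.arr T (.var 22)) (.lit 1)).run s1 with hs2
  have hl2 : Loaded T H I s2 := hl1.run (by simp [scatter, writtenVars])
    (by simp [scatter, writtenArrs])
  set s3 := (fill 22 .verts 26 (.lit 0)).run s2 with hs3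
  have hl3 : Loaded T H I s3 := hl2.run (by simp [fill, writtenVars]) (by simp [fill, writtenArrs])
  set c2 := Expr.conj (.arr 14 (.var 22)) (.conj (.arr 10 (.arr T (.var 22)))
      (.neg (.arr 10 (.arr H (.var 22))))) with hc2
  have h14 : s1.arr 14 = s.arr 14 := run_arr (by simp [fill, writtenArrs]) _
  have h14' : s3.arr 14 = s.arr 14 := by
    rw [hs3, run_arr (by simp [fill, writtenArrs]), hs2, run_arr (by simp [scatter, writtenArrs]), h14]
  have hrun : (marks T H).run s = (scatter 22 .arcs c2 26 (.arr H (.var 22)) (.lit 1)).run s3 := rfl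
  have hz1 : ∀ y < I.n, s1.arr 16 y = 0 := fun y hy => by
    rw [hs1, run_fill (by simp [Expr.readArrs]), Bound.val, hs.var_n, if_pos hy]; rfl
  have hz2 : ∀ y < I.n, s3.arr 26 y = 0 := fun y hy => by
    rw [hs3, run_fill (by simp [Expr.readArrs]), Bound.val, hl2.var_n, if_pos hy]; rfl
  rw [hrun]
  constructor
  · rw [run_arr (by simp [scatter, writtenArrs]), hs3, run_arr (by simp [fill, writtenArrs])]
    ext y
    rw [support, Set.mem_ofPred_eq, hs2, run_scatter_lit (by
      simp [hc1, Expr.conj, Expr.neg, Expr.readArrs]; omega) (by simp [Expr.readArrs]; omega),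
      Bound.val, hl1.var_m]
    simp only [hc1, Expr.holds_conj, Expr.holds_neg, Expr.holds_arr, Expr.eval,
      State.setVar_var_self, State.setVar_arr, hl1.arr_t, hl1.arr_h, hl1.arr_a, h14]
    constructor
    · rintro ⟨hy, h⟩
      split_ifs at h with h1
      · obtain ⟨j, hj, ⟨h1, h2, h3⟩, rfl⟩ := h1
        exact ⟨j, ⟨hj, h1⟩, (Inst.mem_A (hI.t_lt hj)).not.2 h2, (Inst.mem_A (hI.h_lt hj)).2 h3, rfl⟩
      · exact absurd (hz1 y hy) h
    · rintro ⟨j, ⟨hj, h1⟩, h2, h3, rfl⟩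
      refine ⟨hI.t_lt hj, ?_⟩
      rw [if_pos ⟨j, hj, ⟨h1, (Inst.mem_A (hI.t_lt hj)).not.1 h2, (Inst.mem_A (hI.h_lt hj)).1 h3⟩, rfl⟩]
      exact one_ne_zero
  · ext y
    rw [support, Set.mem_ofPred_eq, run_scatter_lit (by
      simp [hc2, Expr.conj, Expr.neg, Expr.readArrs]; omega) (by simp [Expr.readArrs]; omega),
      Bound.val, hl3.var_m]
    simp only [hc2, Expr.holds_conj, Expr.holds_neg, Expr.holds_arr, Expr.eval,
      State.setVar_var_self, State.setVar_arr, hl3.arr_t, hl3.arr_h, hl3.arr_a, h14']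
    constructor
    · rintro ⟨hy, h⟩
      split_ifs at h with h1
      · obtain ⟨j, hj, ⟨h1, h2, h3⟩, rfl⟩ := h1
        exact ⟨j, ⟨hj, h1⟩, (Inst.mem_A (hI.t_lt hj)).2 h2, (Inst.mem_A (hI.h_lt hj)).not.2 h3, rfl⟩
      · exact absurd (hz2 y hy) h
    · rintro ⟨j, ⟨hj, h1⟩, h2, h3, rfl⟩
      refine ⟨hI.h_lt hj, ?_⟩
      rw [if_pos ⟨j, hj, ⟨h1, (Inst.mem_A (hI.t_lt hj)).1 h2, (Inst.mem_A (hI.h_lt hj)).not.1 h3⟩, rfl⟩]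
      exact one_ne_zero

/-- The arc in variable `22` is to be committed. -/
def commitTest (T H : ℕ) : Expr :=
  .disj (.conj (.arr 14 (.var 22)) (.disj
      (.conj (.arr 10 (.arr T (.var 22))) (.neg (.arr 10 (.arr H (.var 22)))))
      (.conj (.neg (.arr 10 (.arr T (.var 22)))) (.arr 10 (.arr H (.var 22))))))
    (.disj (.conj (.arr 17 (.var 22)) (.arr 19 (.arr H (.var 22))))
      (.conj (.arr 27 (.var 22)) (.arr 29 (.arr T (.var 22)))))

theorem not_mem_readArrs_commitTest (hT : 3 ≠ T) (hH : 3 ≠ H) :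
    3 ∉ (commitTest T H).readArrs := by
  simp [commitTest, Expr.conj, Expr.disj, Expr.neg, Expr.readArrs, hT, hH]

def commit (T H : ℕ) : Cmd :=
  scatter 22 .arcs (commitTest T H) 3 (.arr 8 (.var 22)) (.arr 9 (.var 22))

/-- One round of the construction. -/
def level (T H : ℕ) : Cmd :=
  seq (findReturning T H) (seq (shrink T H) (seq (test T H) (seq (marks T H)
    (seq (spanCmd T H 14 10 16 15 17 18 19) (seq (spanCmd H T 14 19 26 25 27 28 29)
      (seq (commit T H) (fill 22 .verts 10 (.arr 29 (.var 22)))))))))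

theorem mem_writtenVars_level {y : ℕ} (hy : y ∈ (level T H).writtenVars) : 20 ≤ y ∧ y ≤ 24 := by
  have : ∀ y ∈ (level T H).writtenVars, 20 ≤ y ∧ y ≤ 24 := by
    simp [level, findReturning, shrink, test, marks, spanCmd, commit, scatter, fill, flag, bfs,
      relax, dropEdge, splitArcs, writtenVars]
  exact this y hy

theorem mem_writtenArrs_level {y : ℕ} (hy : y ∈ (level T H).writtenArrs) : y = 3 ∨ 10 ≤ y := by
  have : ∀ y ∈ (level T H).writtenArrs, y = 3 ∨ 10 ≤ y := by
    simp [level, findReturning, shrink, test, marks, spanCmd, commit, scatter, fill, flag, bfs,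
      relax, dropEdge, splitArcs, writtenArrs]
  exact this y hy

theorem wellFormed_level : (level T H).WellFormed := by
  simp [level, findReturning, shrink, test, marks, spanCmd, commit, scatter, fill, flag, bfs,
      relax, dropEdge, splitArcs, WellFormed, writtenVars]

theorem run_level (hs : Loaded T H I s) (hI : I.Valid) :
    ∃ C : Set ℕ, Round I.t I.h I.rev I.G I.S I.A (support I.n (((level T H).run s).arr 10)) C I.r ∧
      (∀ e, (∀ c ∈ C, s.arr 8 c ≠ e) → ((level T H).run s).arr 3 e = s.arr 3 e) ∧
      ∀ c ∈ C, (∀ c' ∈ C, s.arr 8 c' = s.arr 8 c → s.arr 9 c' = s.arr 9 c) →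
        ((level T H).run s).arr 3 (s.arr 8 c) = s.arr 9 c := by
  have hr := hI.le
  obtain ⟨s1, hs1⟩ : ∃ σ, (findReturning T H).run s = σ := ⟨_, rfl⟩
  have hl1 : Loaded T H I s1 := hs1 ▸ hs.run
    (by simp [findReturning, dropEdge, fill, writtenVars])
    (by simp [findReturning, dropEdge, fill, writtenArrs])
  have hback : support (2 * I.m) (s1.arr 11) = I.back := by
    ext y
    by_cases hy : y < 2 * I.m
    · rw [support, Set.mem_ofPred_eq, ← hs1, run_findReturning hs hI y hy]; simp [hy]
    · simp only [support, Set.mem_ofPred_eq, hy, false_and, false_iff]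
      exact fun h => hy h.1.1.1
  obtain ⟨s2, hs2⟩ : ∃ σ, (shrink T H).run s1 = σ := ⟨_, rfl⟩
  have hl2 : Loaded T H I s2 := hs2 ▸ hl1.run
    (by simp [shrink, writtenVars, writtenVars_test])
    (by simp [shrink, writtenArrs, writtenArrs_test])
  obtain ⟨ho1, ho2, ho3⟩ := run_shrink hl1 hI hback
  rw [hs2] at ho1 ho2 ho3
  set O := support (2 * I.m) (s2.arr 11) with hO
  obtain ⟨s3, hs3⟩ : ∃ σ, (test T H).run s2 = σ := ⟨_, rfl⟩
  have hl3 : Loaded T H I s3 := hs3 ▸ hl2.run (by simp [writtenVars_test]) (by simp [writtenArrs_test])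
  have h14 : support (2 * I.m) (s3.arr 14) = I.split O := hs3 ▸ (run_test hl2 hI).1
  obtain ⟨s4, hs4⟩ : ∃ σ, (marks T H).run s3 = σ := ⟨_, rfl⟩
  have hl4 : Loaded T H I s4 := hs4 ▸ hl3.run (by simp [writtenVars_marks]) (by simp [writtenArrs_marks])
  obtain ⟨h16, h26⟩ := run_marks hl3 hI
  have e14 : s4.arr 14 = s3.arr 14 := hs4 ▸ run_arr (by simp [writtenArrs_marks]) _
  rw [hs4, h14] at h16 h26
  obtain ⟨s5, hs5⟩ : ∃ σ, (spanCmd T H 14 10 16 15 17 18 19).run s4 = σ := ⟨_, rfl⟩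
  have hl5 : Loaded T H I s5 := hs5 ▸ hl4.run (by simp [writtenVars_spanCmd])
    (by simp [writtenArrs_spanCmd])
  obtain ⟨h19, h17⟩ := run_spanCmd (W := 14) (B := 10) (Z := 16) (D := 15) (P := 17) (Q := 18)
    (K := 19) hl4 hI (by simp) (by simp) (by simp)
  rw [hs5, e14, h14, h16, hl4.arr_a] at h19
  rw [hs5, e14, h14, hl4.arr_a] at h17
  obtain ⟨s6, hs6⟩ : ∃ σ, (spanCmd H T 14 19 26 25 27 28 29).run s5 = σ := ⟨_, rfl⟩
  have hl6 : Loaded T H I s6 := hs6 ▸ hl5.run (by simp [writtenVars_spanCmd])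
    (by simp [writtenArrs_spanCmd])
  obtain ⟨h29, h27⟩ := run_spanCmd (W := 14) (B := 19) (Z := 26) (D := 25) (P := 27) (Q := 28)
    (K := 29) hl5.swap hI.swap (by simp) (by simp) (by simp)
  have f14 : s5.arr 14 = s4.arr 14 := hs5 ▸ run_arr (by simp [writtenArrs_spanCmd]) _
  have f26 : s5.arr 26 = s4.arr 26 := hs5 ▸ run_arr (by simp [writtenArrs_spanCmd]) _
  dsimp only at h29 h27
  rw [hs6, f14, f26, e14, h14, h26, h19] at h29
  rw [hs6, f14, e14, h14, h19] at h27
  have g14 : s6.arr 14 = s3.arr 14 := by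
    rw [← hs6, run_arr (by simp [writtenArrs_spanCmd]), f14, e14]
  have g17 : s6.arr 17 = s5.arr 17 := hs6 ▸ run_arr (by simp [writtenArrs_spanCmd]) _
  have g19 : s6.arr 19 = s5.arr 19 := hs6 ▸ run_arr (by simp [writtenArrs_spanCmd]) _
  have hkeep : ∀ b ∈ [3, 8, 9], s6.arr b = s.arr b := by
    intro b hb
    have hb' : b < 10 := by simp at hb; omega
    rw [← hs6, run_arr (by simp [writtenArrs_spanCmd]; omega),
      ← hs5, run_arr (by simp [writtenArrs_spanCmd]; omega),
      ← hs4, run_arr (by simp [writtenArrs_marks]; omega),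
      ← hs3, run_arr (by simp [writtenArrs_test]; omega),
      ← hs2, run_arr (by simp [shrink, writtenArrs, writtenArrs_test]; omega),
      ← hs1, run_arr (by simp [findReturning, dropEdge, fill, writtenArrs]; omega)]
  obtain ⟨s7, hs7⟩ : ∃ σ, (commit T H).run s6 = σ := ⟨_, rfl⟩
  have hl7 : Loaded T H I s7 := hs7 ▸ hl6.run (by simp [commit, scatter, writtenVars])
    (by simp [commit, scatter, writtenArrs])
  obtain ⟨s8, hs8⟩ : ∃ σ, (fill 22 .verts 10 (.arr 29 (.var 22))).run s7 = σ := ⟨_, rfl⟩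
  have hrun : (level T H).run s = s8 := by
    simp only [level, run] at *
    rw [hs1, hs2, hs3, hs4, hs5, hs6, hs7, hs8]
  have h10 : support I.n (s8.arr 10) = absorb I.t I.h (2 * I.n) I.A (I.split O) := by
    change _ = span I.h I.t (2 * I.n) (I.split O) _ _
    refine Eq.trans ?_ h29
    ext y
    rw [support, Set.mem_ofPred_eq, ← hs8, run_fill (by simp [Expr.readArrs]), Bound.val, hl7.var_n]
    simp only [Expr.eval, State.setVar_arr, State.setVar_var_self]
    rw [← hs7, run_arr (by simp [commit, scatter, writtenArrs]), support, Set.mem_ofPred_eq]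
    exact and_congr_right fun hy => by rw [if_pos hy]
  have hmem : ∀ j < 2 * I.m, (commitTest T H).Holds (s6.setVar 22 j) ↔
      j ∈ committed I.t I.h (2 * I.n) I.A (I.split O) := by
    intro j hj
    have ht := hI.t_lt hj
    have hh := hI.h_lt hj
    have hl' := hl6.setVar (x := 22) (v := j) (by omega)
    simp only [commitTest, Expr.holds_conj, Expr.holds_disj, Expr.holds_neg, Expr.holds_arr,
      Expr.eval, hl'.arr_t, hl'.arr_h, hl'.arr_a, State.setVar_var_self]
    simp only [State.setVar_arr, g14, g17, g19]
    have m14 : s3.arr 14 j ≠ 0 ↔ j ∈ I.split O := by rw [← h14]; simp [support, hj]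
    have m17 : s5.arr 17 j ≠ 0 ↔
        j ∈ ascending I.t I.h (2 * I.n) (I.split O) (support I.n I.a) := by
      rw [← h17]; simp [support, hj]
    have m19 : s5.arr 19 (I.h j) ≠ 0 ↔ I.h j ∈ span I.t I.h (2 * I.n) (I.split O)
        (support I.n I.a) (entering I.t I.h I.A (I.split O)) := by
      rw [← h19]; simp [support, hh]
    have m27 := Set.ext_iff.1 h27 j
    have m29 := Set.ext_iff.1 h29 (I.t j)
    rw [support, Set.mem_ofPred_eq] at m27 m29
    simp only [hj, ht, true_and] at m27 m29
    rw [m14, m17, m19, m27, m29, ← Inst.mem_A ht, ← Inst.mem_A hh]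
    rfl
  refine ⟨committed I.t I.h (2 * I.n) I.A (I.split O), ?_, ?_, ?_⟩
  · rw [hrun, h10]
    exact round_of_minimal hI.bridgefree hI.subset hI.out hI.into hI.pos (by omega) ho1 ho2 ho3
  · intro e he
    have : s7.arr 3 e = s6.arr 3 e := by
      rw [← hs7]
      refine run_scatter_of_forall (not_mem_readArrs_commitTest (by have := hs.four_le_T; omega)
        (by have := hs.four_le_H; omega))
        (by simp [Expr.readArrs]) (by simp [Expr.readArrs]) ?_
      intro j hj hc
      rw [Bound.val, hl6.var_m] at hj
      simp only [Expr.eval, State.setVar_arr, State.setVar_var_self]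
      rw [hkeep 8 (by simp)]
      exact he j ((hmem j hj).1 hc)
    rw [hrun, ← hs8, run_arr (by simp [fill, writtenArrs]), this, hkeep 3 (by simp)]
  · intro c hc hc'
    have hcE : c < 2 * I.m := by
      rcases hc with hc | hc | hc
      exacts [hc.1.1.1, hc.1.1.1.1, hc.1.1.1.1]
    have h8 : ∀ j, (Expr.arr 8 (.var 22)).eval (s6.setVar 22 j) = s.arr 8 j := fun j => by
      simp only [Expr.eval, State.setVar_arr, State.setVar_var_self]; rw [hkeep 8 (by simp)]
    have h9 : ∀ j, (Expr.arr 9 (.var 22)).eval (s6.setVar 22 j) = s.arr 9 j := fun j => by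
      simp only [Expr.eval, State.setVar_arr, State.setVar_var_self]; rw [hkeep 9 (by simp)]
    rw [hrun, ← hs8, run_arr (by simp [fill, writtenArrs]), ← h8 c, ← hs7]
    refine run_scatter_of_exists (not_mem_readArrs_commitTest (by have := hs.four_le_T; omega)
        (by have := hs.four_le_H; omega))
      (by simp [Expr.readArrs]) (by simp [Expr.readArrs]) (by rwa [Bound.val, hl6.var_m])
      ((hmem c hcE).2 hc) ?_
    intro j hj hjc hje
    rw [Bound.val, hl6.var_m] at hj
    rw [h8, h8] at hje
    rw [h9]
    exact hc' j ((hmem j hj).1 hjc) hje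

end Cmd

end RAM

namespace ArcSystem

variable {V α : Type*} {t h : α → V} {rev : α → α} {E G W C : Set α} {S A A' : Set V}

/-- The arcs of `G` that agree with the orientation `σ` of the edges, where `d j` is the direction in
which the arc `j` traverses the edge `ed j`. -/
def orientedArcs (G : Set α) (ed d : α → ℕ) (σ : ℕ → ℕ) : Set α :=
  {j | j ∈ G ∧ (σ (ed j) ≠ 0 ↔ d j ≠ 0)}

/-- The edges inside `A` are oriented by `σ` in such a way that all vertices of `A` are reached from
`c` within `a` steps and reach `c` within `b` steps; all vertices are within distance `r` of `A`. -/
structure Progress (t h : α → V) (G : Set α) (S : Set V) (ed d : α → ℕ) (c : V) (σ : ℕ → ℕ)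
    (A : Set V) (a b r : ℕ) : Prop where
  subset : A ⊆ S
  near : S ⊆ reach t h G A r
  near' : S ⊆ reach h t G A r
  out : A ⊆ reach t h {j | j ∈ orientedArcs G ed d σ ∧ t j ∈ A ∧ h j ∈ A} {c} a
  into : A ⊆ reach h t {j | j ∈ orientedArcs G ed d σ ∧ t j ∈ A ∧ h j ∈ A} {c} b

variable {ed d : α → ℕ} {c : V} {σ σ' : ℕ → ℕ} {a b r : ℕ}

theorem Progress.symm (hp : Progress t h G S ed d c σ A a b r) :
    Progress h t G S ed d c σ A b a r :=
  ⟨hp.subset, hp.near', hp.near, by simpa only [and_comm] using hp.into,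
    by simpa only [and_comm] using hp.out⟩

theorem Progress.step (hG : Bridgefree t h rev E G S)
    (hp : Progress t h G S ed d c σ A a b r) (hr : Round t h rev G S A A' C r)
    (hed : ∀ i ∈ E, ∀ j ∈ E, ed i = ed j → i = j ∨ i = rev j)
    (hkeep : ∀ e, (∀ c ∈ C, ed c ≠ e) → σ' e = σ e)
    (hset : ∀ c ∈ C, (∀ c' ∈ C, ed c' = ed c → d c' = d c) → σ' (ed c) = d c) :
    Progress t h G S ed d c σ' A' (a + 2 * r) (b + (4 * r - 1)) (r - 1) := by
  have hC : {j | j ∈ C ∧ t j ∈ A' ∧ h j ∈ A'} ⊆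
      {j | j ∈ orientedArcs G ed d σ' ∧ t j ∈ A' ∧ h j ∈ A'} := by
    rintro j ⟨hj, hA⟩
    refine ⟨⟨hr.arcs hj, ?_⟩, hA⟩
    rw [hset j hj fun i hi hij => ?_]
    rcases hed i (hG.subset (hr.arcs hi)) j (hG.subset (hr.arcs hj)) hij with rfl | rfl
    · rfl
    · exact absurd hi (hr.not_rev j hj)
  have hold : {j | j ∈ orientedArcs G ed d σ ∧ t j ∈ A ∧ h j ∈ A} ⊆
      {j | j ∈ orientedArcs G ed d σ' ∧ t j ∈ A' ∧ h j ∈ A'} := by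
    rintro j ⟨⟨hjG, hj⟩, hA1, hA2⟩
    refine ⟨⟨hjG, ?_⟩, hr.subset hA1, hr.subset hA2⟩
    rw [hkeep, hj]
    intro i hi hij
    have hjE := hG.subset hjG
    rcases hed i (hG.subset (hr.arcs hi)) j hjE hij with rfl | rfl
    · exact hr.fresh i hi ⟨hA1, hA2⟩
    · exact hr.fresh _ hi ⟨by rwa [hG.tail_rev j hjE], by rwa [hG.head_rev hjE]⟩
  refine ⟨hr.subset_vertices, hr.near, hr.near', fun x hx => ?_, fun x hx => ?_⟩
  · exact reach_le_of_subset (hp.out.trans (reach_mono hold subset_rfl))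
      (reach_mono hC subset_rfl (hr.out x hx))
  · exact reach_le_of_subset (hp.into.trans (reach_mono hold subset_rfl))
      (reach_mono hC subset_rfl (hr.into x hx))

theorem reach_eq_of_eq_succ {k : ℕ} (hk : reach t h W A k = reach t h W A (k + 1)) (l : ℕ) :
    reach t h W A (k + l) = reach t h W A k := by
  induction l with
  | zero => rfl
  | succ l ih =>
    ext x
    rw [← add_assoc, mem_reach_succ, ih, ← mem_reach_succ, ← hk]

/-- Among `n` vertices, all vertices that can be reached can be reached within `n` steps. -/
theorem reach_subset_reach_card {t h : α → ℕ} {A : Set ℕ} {n : ℕ} (hA : A ⊆ {x | x < n})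
    (hne : A.Nonempty) (hW : ∀ a ∈ W, h a < n) (k : ℕ) :
    reach t h W A k ⊆ reach t h W A n := by
  have hfin : ∀ k, reach t h W A k ⊆ Set.Iio n := fun k =>
    reach_subset (S := Set.Iio n) hA fun a ha _ => hW a ha
  have key : ∀ k, k < (reach t h W A k).ncard ∨
      ∃ j < k, reach t h W A j = reach t h W A (j + 1) := by
    intro k
    induction k with
    | zero =>
      left
      exact (Set.ncard_pos ((Set.finite_Iio n).subset (hfin 0))).2 hne
    | succ k ih =>
      rcases ih with ih | ⟨j, hj, h1⟩
      · by_cases hk : reach t h W A k = reach t h W A (k + 1)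
        · exact Or.inr ⟨k, by omega, hk⟩
        · left
          have hss : reach t h W A k ⊂ reach t h W A (k + 1) :=
            (reach_mono_right (Nat.le_succ k)).ssubset_of_ne hk
          have := Set.ncard_lt_ncard hss ((Set.finite_Iio n).subset (hfin (k + 1)))
          omega
      · exact Or.inr ⟨j, by omega, h1⟩
  rcases key n with h1 | ⟨j, hj, h1⟩
  · have := Set.ncard_le_ncard (hfin n) (Set.finite_Iio n)
    rw [Set.ncard_Iio_nat] at this
    omega
  · rcases le_total k n with hk | hk
    · exact reach_mono_right hk
    · have h2 := reach_eq_of_eq_succ h1 (k - j)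
      rw [Nat.add_sub_cancel' (by omega)] at h2
      rw [h2]
      exact reach_mono_right hj.le

end ArcSystem

namespace RAM

open ArcSystem

namespace Cmd

variable {x : ℕ} {b : Bound} {a : ℕ} {c e f : Expr} {s σ : State}

/-- Set the entries of the array `a` to the values of `e` where `c` holds, and of `f` elsewhere. -/
def fillIf (x : ℕ) (b : Bound) (a : ℕ) (c e f : Expr) : Cmd :=
  count x b (cond c (store a (.var x) e) (store a (.var x) f))

open Classical in
theorem run_fillIf (hc : a ∉ c.readArrs) (he : a ∉ e.readArrs) (hf : a ∉ f.readArrs) (s : State)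
    (y : ℕ) : ((fillIf x b a c e f).run s).arr a y = if y < b.val s then
      if c.Holds (s.setVar x y) then e.eval (s.setVar x y) else f.eval (s.setVar x y)
      else s.arr a y := by
  refine count_induction (fun k σ => ∀ y, σ.arr a y = if y < k then
      if c.Holds (s.setVar x y) then e.eval (s.setVar x y) else f.eval (s.setVar x y)
      else s.arr a y) (fun y => by simp) (fun k σ _ hσ hag ih y => ?_) y
  have hev : ∀ g : Expr, a ∉ g.readArrs → g.eval σ = g.eval (s.setVar x k) := fun g hg =>
    hag.eval_eq hσ (by simp [writtenVars])
      (by intro d hd; simp only [writtenArrs, List.mem_append, List.mem_singleton, or_self]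
          rintro rfl; exact hg hd)
  have hh : c.Holds σ ↔ c.Holds (s.setVar x k) := by rw [Expr.Holds, hev c hc]; rfl
  have hx : (Expr.var x).eval σ = k := hσ
  rw [run, apply_ite (fun s : State => s.setVar x (k + 1)), apply_ite (fun s : State => s.arr a y)]
  simp only [run, State.setVar_arr, State.setArr_arr_self, hx, hev e he, hev f hf, hh]
  by_cases hy : y = k
  · subst hy; simp
  · simp only [Function.update_of_ne hy, ite_self, ih]
    congr 1
    exact propext (by omega)

end Cmd

end RAM

namespace RAM

open ArcSystem

variable {s σ : State}

namespace Cmd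

theorem agree_of_run {c : Cmd} (h : c.run s = σ) : Agree c.writtenVars c.writtenArrs s σ :=
  h ▸ agree_run c s

theorem run_seq (p q : Cmd) (s : State) : (seq p q).run s = q.run (p.run s) := rfl

/-- Compute the tails, heads, presence, reverses, edges and directions of the arcs. -/
def init : Cmd :=
  seq (fillIf 22 .arcs 4 (.lt (.var 22) (.var 1)) (.arr 0 (.var 22))
    (.arr 1 (.sub (.var 22) (.var 1))))
  (seq (fillIf 22 .arcs 5 (.lt (.var 22) (.var 1)) (.arr 1 (.var 22))
    (.arr 0 (.sub (.var 22) (.var 1))))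
  (seq (fillIf 22 .arcs 6 (.lt (.var 22) (.var 1)) (.lit 1)
    (.neg (.arr 2 (.sub (.var 22) (.var 1)))))
  (seq (fillIf 22 .arcs 7 (.lt (.var 22) (.var 1)) (.add (.var 22) (.var 1))
    (.sub (.var 22) (.var 1)))
  (seq (fillIf 22 .arcs 8 (.lt (.var 22) (.var 1)) (.var 22) (.sub (.var 22) (.var 1)))
  (fillIf 22 .arcs 9 (.lt (.var 22) (.var 1)) (.lit 0) (.lit 1))))))

theorem run_init_aux {a : ℕ} {e f : Expr} (he : a ∉ e.readArrs) (hf : a ∉ f.readArrs) (s : State)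
    {j : ℕ} (hj : j < 2 * s.var 1) :
    ((fillIf 22 .arcs a (.lt (.var 22) (.var 1)) e f).run s).arr a j =
      if j < s.var 1 then e.eval (s.setVar 22 j) else f.eval (s.setVar 22 j) := by
  classical
  rw [run_fillIf (by simp [Expr.lt, Expr.readArrs]) he hf, Bound.val, if_pos hj]
  simp only [Expr.holds_lt, Expr.eval, State.setVar_var_self]
  rw [State.setVar_var_ne _ _ (by omega)]

theorem run_init (s : State) {j : ℕ} (hj : j < 2 * s.var 1) :
    (init.run s).arr 4 j = (if j < s.var 1 then s.arr 0 j else s.arr 1 (j - s.var 1)) ∧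
    (init.run s).arr 5 j = (if j < s.var 1 then s.arr 1 j else s.arr 0 (j - s.var 1)) ∧
    (init.run s).arr 6 j = (if j < s.var 1 then 1 else 1 - s.arr 2 (j - s.var 1)) ∧
    (init.run s).arr 7 j = (if j < s.var 1 then j + s.var 1 else j - s.var 1) ∧
    (init.run s).arr 8 j = (if j < s.var 1 then j else j - s.var 1) ∧
    (init.run s).arr 9 j = (if j < s.var 1 then 0 else 1) := by
  rw [init]
  simp only [run_seq]
  obtain ⟨s1, hs1⟩ : ∃ σ, (fillIf 22 .arcs 4 (.lt (.var 22) (.var 1)) (.arr 0 (.var 22))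
    (.arr 1 (.sub (.var 22) (.var 1)))).run s = σ := ⟨_, rfl⟩
  rw [hs1]
  obtain ⟨s2, hs2⟩ : ∃ σ, (fillIf 22 .arcs 5 (.lt (.var 22) (.var 1)) (.arr 1 (.var 22))
    (.arr 0 (.sub (.var 22) (.var 1)))).run s1 = σ := ⟨_, rfl⟩
  rw [hs2]
  obtain ⟨s3, hs3⟩ : ∃ σ, (fillIf 22 .arcs 6 (.lt (.var 22) (.var 1)) (.lit 1)
    (.neg (.arr 2 (.sub (.var 22) (.var 1))))).run s2 = σ := ⟨_, rfl⟩
  rw [hs3]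
  obtain ⟨s4, hs4⟩ : ∃ σ, (fillIf 22 .arcs 7 (.lt (.var 22) (.var 1)) (.add (.var 22) (.var 1))
    (.sub (.var 22) (.var 1))).run s3 = σ := ⟨_, rfl⟩
  rw [hs4]
  obtain ⟨s5, hs5⟩ : ∃ σ, (fillIf 22 .arcs 8 (.lt (.var 22) (.var 1)) (.var 22)
    (.sub (.var 22) (.var 1))).run s4 = σ := ⟨_, rfl⟩
  rw [hs5]
  have a1 : Agree [22] [4, 4] s s1 := agree_of_run hs1
  have a2 : Agree [22] [5, 5] s1 s2 := agree_of_run hs2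
  have a3 : Agree [22] [6, 6] s2 s3 := agree_of_run hs3
  have a4 : Agree [22] [7, 7] s3 s4 := agree_of_run hs4
  have a5 : Agree [22] [8, 8] s4 s5 := agree_of_run hs5
  have v1 : s1.var 1 = s.var 1 := a1.1 1 (by simp)
  have v2 : s2.var 1 = s.var 1 := (a2.1 1 (by simp)).trans v1
  have v3 : s3.var 1 = s.var 1 := (a3.1 1 (by simp)).trans v2
  have v4 : s4.var 1 = s.var 1 := (a4.1 1 (by simp)).trans v3
  have v5 : s5.var 1 = s.var 1 := (a5.1 1 (by simp)).trans v4
  have l9 : ∀ b ≠ 9, ((fillIf 22 .arcs 9 (.lt (.var 22) (.var 1)) (.lit 0) (.lit 1)).run s5).arr b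
      = s5.arr b := fun b hb => run_arr (by simpa [fillIf, writtenArrs] using hb) _
  refine ⟨?_, ?_, ?_, ?_, ?_, ?_⟩
  · rw [l9 4 (by omega), a5.2 4 (by simp), a4.2 4 (by simp), a3.2 4 (by simp), a2.2 4 (by simp),
      ← hs1, run_init_aux (by simp [Expr.readArrs]) (by simp [Expr.readArrs]) s hj]
    simp [Expr.eval, State.setVar_var_ne]
  · rw [l9 5 (by omega), a5.2 5 (by simp), a4.2 5 (by simp), a3.2 5 (by simp),
      ← hs2, run_init_aux (by simp [Expr.readArrs]) (by simp [Expr.readArrs]) s1 (by rwa [v1])]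
    simp [Expr.eval, State.setVar_var_ne, v1, a1.2 0, a1.2 1]
  · rw [l9 6 (by omega), a5.2 6 (by simp), a4.2 6 (by simp),
      ← hs3, run_init_aux (by simp [Expr.readArrs]) (by simp [Expr.readArrs, Expr.neg]) s2
        (by rwa [v2])]
    simp [Expr.eval, Expr.neg, State.setVar_var_ne, v2, a1.2 2, a2.2 2]
  · rw [l9 7 (by omega), a5.2 7 (by simp),
      ← hs4, run_init_aux (by simp [Expr.readArrs]) (by simp [Expr.readArrs]) s3 (by rwa [v3])]
    simp [Expr.eval, State.setVar_var_ne, v3]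
  · rw [l9 8 (by omega),
      ← hs5, run_init_aux (by simp [Expr.readArrs]) (by simp [Expr.readArrs]) s4 (by rwa [v4])]
    simp [Expr.eval, State.setVar_var_ne, v4]
  · rw [run_init_aux (by simp [Expr.readArrs]) (by simp [Expr.readArrs]) s5 (by rwa [v5])]
    simp [Expr.eval, v5]

theorem writtenVars_init : init.writtenVars = [22, 22, 22, 22, 22, 22] := rfl

/-- Record the vertex in variable `27` and the radius in variable `26` if all vertices are within
that distance. -/
def tryCenter : Cmd :=
  seq (fill 22 .verts 30 (.neg (.ne (.var 22) (.var 27)))) (seq (bfs 4 5 6 30 31)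
    (seq (bfs 5 4 6 30 32) (seq (assign 24 (.lit 1))
      (seq (flag 22 .verts (.disj (.lt (.var 26) (.arr 31 (.var 22)))
        (.lt (.var 26) (.arr 32 (.var 22)))) 24 0)
        (cond (.var 24) (seq (assign 5 (.var 26)) (assign 28 (.var 27))) skip)))))

theorem writtenVars_tryCenter : tryCenter.writtenVars =
    [22, 20, 20, 20, 21, 20, 20, 20, 21, 24, 22, 24, 5, 28] := rfl

theorem writtenArrs_tryCenter : tryCenter.writtenArrs = [30, 31, 31, 31, 32, 32, 32] := rfl

/-- All vertices are within distance `k` of `u` in both directions. -/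
def Central (s : State) (u k : ℕ) : Prop :=
  ∀ x < s.var 0, x ∈ reach (s.arr 4) (s.arr 5) (support (2 * s.var 1) (s.arr 6)) {u} k ∧
    x ∈ reach (s.arr 5) (s.arr 4) (support (2 * s.var 1) (s.arr 6)) {u} k

theorem run_tryCenter (h4 : ∀ j < 2 * s.var 1, s.arr 4 j < s.var 0)
    (h5 : ∀ j < 2 * s.var 1, s.arr 5 j < s.var 0) (h27 : s.var 27 < s.var 0)
    (h26 : s.var 26 ≤ 2 * s.var 0) :
    (Central s (s.var 27) (s.var 26) ∧ (tryCenter.run s).var 5 = s.var 26 ∧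
      (tryCenter.run s).var 28 = s.var 27) ∨
    (¬ Central s (s.var 27) (s.var 26) ∧ (tryCenter.run s).var 5 = s.var 5 ∧
      (tryCenter.run s).var 28 = s.var 28) := by
  classical
  rw [tryCenter]
  simp only [run_seq]
  obtain ⟨s1, hs1⟩ : ∃ σ, (fill 22 .verts 30 (.neg (.ne (.var 22) (.var 27)))).run s = σ :=
    ⟨_, rfl⟩
  rw [hs1]
  obtain ⟨s2, hs2⟩ : ∃ σ, (bfs 4 5 6 30 31).run s1 = σ := ⟨_, rfl⟩
  rw [hs2]
  obtain ⟨s3, hs3⟩ : ∃ σ, (bfs 5 4 6 30 32).run s2 = σ := ⟨_, rfl⟩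
  rw [hs3]
  have a1 : Agree [22] [30] s s1 := agree_of_run hs1
  have a2 : Agree [20, 20, 20, 21] [31, 31, 31] s1 s2 := agree_of_run hs2
  have a3 : Agree [20, 20, 20, 21] [32, 32, 32] s2 s3 := agree_of_run hs3
  have a12 := a1.trans a2
  have a13 := a12.trans a3
  have hS : support (s.var 0) (s1.arr 30) = {s.var 27} := by
    ext y
    rw [support, Set.mem_ofPred_eq, ← hs1, run_fill (by simp [Expr.neg, Expr.ne, Expr.readArrs]),
      Bound.val]
    by_cases hy : y < s.var 0
    · rw [if_pos hy]
      change _ ∧ Expr.Holds _ _ ↔ _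
      simp only [Expr.holds_neg, Expr.holds_ne, Expr.eval, State.setVar_var_self, hy, true_and,
        not_not, Set.mem_singleton_iff]
      rw [State.setVar_var_ne _ _ (by omega)]
    · simp only [hy, false_and, Set.mem_singleton_iff, false_iff]
      rintro rfl; exact hy h27
  have hd1 : ∀ x < s.var 0, s3.arr 31 x ≤ s.var 26 ↔
      x ∈ reach (s.arr 4) (s.arr 5) (support (2 * s.var 1) (s.arr 6)) {s.var 27} (s.var 26) := by
    intro x hx
    rw [a3.2 31 (by simp), ← hs2, run_bfs (by omega) (by omega) (by omega) (by omega) s1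
      (by rw [a1.1 1 (by simp), a1.1 0 (by simp), a1.2 4 (by simp)]; exact h4)
      (by rwa [a1.1 0 (by simp)]) (by rwa [a1.1 0 (by simp)]), a1.1 1 (by simp), a1.1 0 (by simp),
      a1.2 4 (by simp), a1.2 5 (by simp), a1.2 6 (by simp), hS]
  have hd2 : ∀ x < s.var 0, s3.arr 32 x ≤ s.var 26 ↔
      x ∈ reach (s.arr 5) (s.arr 4) (support (2 * s.var 1) (s.arr 6)) {s.var 27} (s.var 26) := by
    intro x hx
    rw [← hs3, run_bfs (by omega) (by omega) (by omega) (by omega) s2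
      (by rw [a12.1 1 (by simp), a12.1 0 (by simp), a12.2 5 (by simp)]; exact h5)
      (by rwa [a12.1 0 (by simp)]) (by rwa [a12.1 0 (by simp)]), a12.1 1 (by simp),
      a12.1 0 (by simp), a12.2 4 (by simp), a12.2 5 (by simp), a12.2 6 (by simp),
      a2.2 30 (by simp), hS]
  obtain ⟨s4, hs4⟩ : ∃ σ, (assign 24 (.lit 1)).run s3 = σ := ⟨_, rfl⟩
  rw [hs4]
  have a4 : Agree [24] [] s3 s4 := agree_of_run hs4
  have a14 := a13.trans a4
  have h24 : s4.var 24 = 1 := by rw [← hs4, run, State.setVar_var_self]; rfl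
  obtain ⟨s5, hs5⟩ : ∃ σ, (flag 22 .verts (.disj (.lt (.var 26) (.arr 31 (.var 22)))
        (.lt (.var 26) (.arr 32 (.var 22)))) 24 0).run s4 = σ := ⟨_, rfl⟩
  rw [hs5]
  have a5 : Agree [22, 24] [] s4 s5 := agree_of_run hs5
  have a15 := a14.trans a5
  have hflag : (Expr.var 24).Holds s5 ↔ Central s (s.var 27) (s.var 26) := by
    change s5.var 24 ≠ 0 ↔ _
    rw [← hs5, run_flag (by simp [Expr.disj, Expr.lt, Expr.readVars]) (by omega), h24, Bound.val,
      a14.1 0 (by simp)]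
    simp only [ne_eq, ite_eq_left_iff, not_exists, not_and, one_ne_zero, imp_false, not_forall,
      not_not, Central]
    refine forall₂_congr fun x hx => ?_
    simp only [Expr.holds_disj, Expr.holds_lt, Expr.eval, State.setVar_arr, State.setVar_var_self]
    rw [State.setVar_var_ne _ _ (by omega), a14.1 26 (by simp), a4.2 31 (by simp),
      a4.2 32 (by simp), not_or, not_lt, not_lt, hd1 x hx, hd2 x hx]
  by_cases hc : Central s (s.var 27) (s.var 26)
  · refine Or.inl ⟨hc, ?_⟩
    rw [run, if_pos (hflag.2 hc)]
    simp only [run]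
    constructor
    · rw [State.setVar_var_ne _ _ (by omega), State.setVar_var_self]
      exact a15.1 26 (by simp)
    · rw [State.setVar_var_self]
      exact (State.setVar_var_ne _ _ (by omega)).trans (a15.1 27 (by simp))
  · refine Or.inr ⟨hc, ?_⟩
    rw [run, if_neg fun h => hc (hflag.1 h), run]
    exact ⟨a15.1 5 (by simp), a15.1 28 (by simp)⟩

/-- Find a central vertex and the radius. -/
def findCenter : Cmd :=
  count 25 .rounds (seq
    (assign 26 (.sub (.sub (.add (.var 0) (.var 0)) (.lit 1)) (.var 25)))
    (count 27 .verts tryCenter))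

theorem writtenVars_findCenter : findCenter.writtenVars =
    [25, 26, 27, 22, 20, 20, 20, 21, 20, 20, 20, 21, 24, 22, 24, 5, 28] := rfl

theorem writtenArrs_findCenter : findCenter.writtenArrs = [30, 31, 31, 31, 32, 32, 32] := rfl

theorem run_findCenter (h4 : ∀ j < 2 * s.var 1, s.arr 4 j < s.var 0)
    (h5 : ∀ j < 2 * s.var 1, s.arr 5 j < s.var 0) {u k : ℕ} (hu : u < s.var 0)
    (hk : k < 2 * s.var 0) (huk : Central s u k) :
    (findCenter.run s).var 28 < s.var 0 ∧ (findCenter.run s).var 5 ≤ k ∧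
      Central s ((findCenter.run s).var 28) ((findCenter.run s).var 5) := by
  have key := count_induction (x := 25) (b := .rounds) (s := s) (p := seq
    (assign 26 (.sub (.sub (.add (.var 0) (.var 0)) (.lit 1)) (.var 25)))
    (count 27 .verts tryCenter))
    (fun i σ => ∀ u < s.var 0, ∀ k < 2 * s.var 0, 2 * s.var 0 ≤ k + i → Central s u k →
      σ.var 28 < s.var 0 ∧ σ.var 5 ≤ k ∧ Central s (σ.var 28) (σ.var 5))
    (fun u _ k hk hk' => by omega) ?_
  · exact key u hu k hk (by rw [Bound.val]; omega) huk
  intro i σ hi hσ hag ih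
  rw [Bound.val] at hi
  have hv : ∀ y, y < 2 → σ.var y = s.var y := fun y hy => hag.1 y (by
    simp [writtenVars, writtenVars_tryCenter]; omega)
  have ha : ∀ y, y < 30 → σ.arr y = s.arr y := fun y hy => hag.2 y (by
    simp [writtenArrs, writtenArrs_tryCenter]; omega)
  rw [run]
  obtain ⟨τ, hτ⟩ : ∃ τ, (assign 26 (.sub (.sub (.add (.var 0) (.var 0)) (.lit 1))
    (.var 25))).run σ = τ := ⟨_, rfl⟩
  rw [hτ]
  have at1 : Agree [26] [] σ τ := agree_of_run hτ
  have h26 : τ.var 26 = 2 * s.var 0 - 1 - i := by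
    rw [← hτ, run, State.setVar_var_self]
    simp only [Expr.eval, hσ, hv 0 (by omega)]
    omega
  have hτv : ∀ y, y < 2 → τ.var y = s.var y := fun y hy => by
    rw [at1.1 y (by simp; omega), hv y hy]
  have key2 := count_induction (x := 27) (b := .verts) (s := τ) (p := tryCenter)
    (fun v ρ => (∀ u < v, Central s u (2 * s.var 0 - 1 - i) → ρ.var 28 < s.var 0 ∧
        ρ.var 5 ≤ 2 * s.var 0 - 1 - i ∧ Central s (ρ.var 28) (ρ.var 5)) ∧
      ∀ u < s.var 0, ∀ k < 2 * s.var 0, 2 * s.var 0 ≤ k + i → Central s u k →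
        ρ.var 28 < s.var 0 ∧ ρ.var 5 ≤ k ∧ Central s (ρ.var 28) (ρ.var 5)) ?_ ?_
  · rw [Bound.val, hτv 0 (by omega)] at key2
    intro u hu k hk hki huk
    rw [State.setVar_var_ne _ _ (by omega), State.setVar_var_ne _ _ (by omega)]
    by_cases hki' : 2 * s.var 0 ≤ k + i
    · exact key2.2 u hu k hk hki' huk
    · obtain rfl : k = 2 * s.var 0 - 1 - i := by omega
      exact key2.1 u hu huk
  · refine ⟨fun u hu => by omega, fun u hu k hk hki huk => ?_⟩
    rw [State.setVar_var_ne _ _ (by omega), State.setVar_var_ne _ _ (by omega),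
      at1.1 28 (by simp), at1.1 5 (by simp)]
    exact ih u hu k hk hki huk
  · intro v ρ hv' hρ hag' ⟨ih1, ih2⟩
    rw [Bound.val, hτv 0 (by omega)] at hv'
    have hρv : ∀ y, y < 2 → ρ.var y = s.var y := fun y hy => by
      rw [hag'.1 y (by simp [writtenVars_tryCenter]; omega), hτv y hy]
    have hρa : ∀ y, y < 30 → ρ.arr y = s.arr y := fun y hy => by
      rw [hag'.2 y (by simp [writtenArrs_tryCenter]; omega), at1.2 y (by simp), ha y hy]
    have hρ26 : ρ.var 26 = 2 * s.var 0 - 1 - i := by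
      rw [hag'.1 26 (by simp [writtenVars_tryCenter]), h26]
    have hcen : ∀ u k, Central ρ u k ↔ Central s u k := fun u k => by
      rw [Central, Central, hρv 0 (by omega), hρv 1 (by omega), hρa 4 (by omega), hρa 5 (by omega),
        hρa 6 (by omega)]
    have htry := run_tryCenter (s := ρ)
      (by rw [hρv 0 (by omega), hρv 1 (by omega), hρa 4 (by omega)]; exact h4)
      (by rw [hρv 0 (by omega), hρv 1 (by omega), hρa 5 (by omega)]; exact h5)
      (by rw [hρ, hρv 0 (by omega)]; exact hv') (by rw [hρ26, hρv 0 (by omega)]; omega)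
    rw [hcen, hρ, hρ26] at htry
    rw [State.setVar_var_ne _ _ (by omega), State.setVar_var_ne _ _ (by omega)]
    rcases htry with ⟨h1, h2, h3⟩ | ⟨h1, h2, h3⟩
    · rw [h2, h3]
      exact ⟨fun _ _ _ => ⟨hv', le_rfl, h1⟩, fun u hu k hk hki huk => ⟨hv', by omega, h1⟩⟩
    · rw [h2, h3]
      refine ⟨fun u hu huk => ?_, ih2⟩
      have : u ≠ v := by rintro rfl; exact h1 huk
      exact ih1 u (by omega) huk

end Cmd

end RAM

namespace RAM

open ArcSystem

variable {s σ : State} {n m ρ R c : ℕ} {t h rev g ed d : ℕ → ℕ}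

/-- The invariant of the main loop: all vertices are within distance `ρ` of the absorbed set, and
the bounds on the distances from and to the center are balanced. -/
structure Running (n m : ℕ) (t h rev g ed d : ℕ → ℕ) (c R ρ : ℕ) (s : State) : Prop where
  loaded : Loaded 4 5 ⟨n, m, ρ, t, h, rev, g, s.arr 10⟩ s
  arr_ed : s.arr 8 = ed
  arr_d : s.arr 9 = d
  progress : Progress t h (support (2 * m) g) {x | x < n} ed d c (s.arr 3) (support n (s.arr 10))
    (s.var 40) (s.var 41) ρ
  total : s.var 40 + s.var 41 + 3 * ρ ^ 2 + 2 * ρ = 3 * R ^ 2 + 2 * R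
  balance : s.var 40 ≤ s.var 41 + max 2 (2 * ρ + 1)
  balance' : s.var 41 ≤ s.var 40 + max 2 (2 * ρ + 1)

theorem Running.setVar (hs : Running n m t h rev g ed d c R ρ s) {x v : ℕ} (hx : 5 < x)
    (hx' : x < 40) : Running n m t h rev g ed d c R ρ (s.setVar x v) where
  loaded := hs.loaded.setVar hx
  arr_ed := hs.arr_ed
  arr_d := hs.arr_d
  progress := by
    rw [State.setVar_var_ne _ _ (by omega), State.setVar_var_ne _ _ (by omega)]
    exact hs.progress
  total := by
    rw [State.setVar_var_ne _ _ (by omega), State.setVar_var_ne _ _ (by omega)]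
    exact hs.total
  balance := by
    rw [State.setVar_var_ne _ _ (by omega), State.setVar_var_ne _ _ (by omega)]
    exact hs.balance
  balance' := by
    rw [State.setVar_var_ne _ _ (by omega), State.setVar_var_ne _ _ (by omega)]
    exact hs.balance'

namespace Cmd

theorem run_cond_of_holds {e : Expr} (h : e.Holds s) (p q : Cmd) :
    (cond e p q).run s = p.run s := if_pos h

theorem run_cond_of_not_holds {e : Expr} (h : ¬ e.Holds s) (p q : Cmd) :
    (cond e p q).run s = q.run s := if_neg h

theorem progress_level {T H : ℕ} {I : Inst} (hs : Loaded T H I s) (hI : I.Valid) {a b : ℕ}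
    (hed : ∀ i ∈ I.E, ∀ j ∈ I.E, s.arr 8 i = s.arr 8 j → i = j ∨ i = I.rev j)
    (hp : Progress I.t I.h I.G I.S (s.arr 8) (s.arr 9) c (s.arr 3) I.A a b I.r) :
    Progress I.t I.h I.G I.S (s.arr 8) (s.arr 9) c (((level T H).run s).arr 3)
      (support I.n (((level T H).run s).arr 10)) (a + 2 * I.r) (b + (4 * I.r - 1)) (I.r - 1) := by
  obtain ⟨C, h1, h2, h3⟩ := run_level hs hI
  exact Progress.step hI.bridgefree hp h1 hed h2 h3

/-- One round, in which the smaller of the two bounds grows more. -/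
def advance : Cmd :=
  seq (cond (.le (.var 40) (.var 41))
    (seq (level 5 4) (seq
      (assign 40 (.add (.var 40) (.sub (.add (.add (.var 5) (.var 5)) (.add (.var 5) (.var 5)))
        (.lit 1))))
      (assign 41 (.add (.var 41) (.add (.var 5) (.var 5))))))
    (seq (level 4 5) (seq
      (assign 40 (.add (.var 40) (.add (.var 5) (.var 5))))
      (assign 41 (.add (.var 41) (.sub (.add (.add (.var 5) (.var 5)) (.add (.var 5) (.var 5)))
        (.lit 1)))))))
    (assign 5 (.sub (.var 5) (.lit 1)))

theorem running_advance
    (hG : Bridgefree t h rev {j | j < 2 * m} (support (2 * m) g) {x | x < n})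
    (hed : ∀ i < 2 * m, ∀ j < 2 * m, ed i = ed j → i = j ∨ i = rev j) (hn : ρ + 1 ≤ n)
    (hs : Running n m t h rev g ed d c R (ρ + 1) s) :
    Running n m t h rev g ed d c R ρ (advance.run s) := by
  have hp := hs.progress
  have hI : (⟨n, m, ρ + 1, t, h, rev, g, s.arr 10⟩ : Inst).Valid :=
    ⟨hG, hp.subset, hp.near, hp.near', by simp, hn⟩
  have hI' : (⟨n, m, ρ + 1, h, t, rev, g, s.arr 10⟩ : Inst).Valid :=
    ⟨hG.symm, hp.subset, hp.near', hp.near, by simp, hn⟩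
  have key : ∀ (T H a b : ℕ) (f : State), f.arr = ((level T H).run s).arr →
      f.var 0 = n → f.var 1 = m → f.var 5 = ρ → f.var 40 = a → f.var 41 = b →
      Progress t h (support (2 * m) g) {x | x < n} ed d c (((level T H).run s).arr 3)
        (support n (((level T H).run s).arr 10)) a b ρ →
      (a = s.var 40 + (4 * ρ + 3) ∧ b = s.var 41 + 2 * (ρ + 1) ∧ s.var 40 ≤ s.var 41 ∨
        a = s.var 40 + 2 * (ρ + 1) ∧ b = s.var 41 + (4 * ρ + 3) ∧ s.var 41 < s.var 40) →
      Running n m t h rev g ed d c R ρ f := by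
    intro T H a b f hf h0 h1 h5 h40 h41 hpr hcase
    have harr : ∀ y, 4 ≤ y → y < 10 → f.arr y = s.arr y := fun y hy hy' => by
      rw [hf, run_arr fun h => by have := mem_writtenArrs_level h; omega]
    have ht := hs.total; have hb := hs.balance; have hb' := hs.balance'
    refine ⟨⟨h0, h1, h5, (harr 4 (by omega) (by omega)).trans hs.loaded.arr_t,
      (harr 5 (by omega) (by omega)).trans hs.loaded.arr_h,
      (harr 6 (by omega) (by omega)).trans hs.loaded.arr_g,
      (harr 7 (by omega) (by omega)).trans hs.loaded.arr_rev, rfl, by omega, by omega, by omega,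
      by omega⟩, (harr 8 (by omega) (by omega)).trans hs.arr_ed,
      (harr 9 (by omega) (by omega)).trans hs.arr_d, ?_, ?_, ?_, ?_⟩
    · rw [h40, h41, hf]; exact hpr
    · rcases hcase with ⟨h6, h7, -⟩ | ⟨h6, h7, -⟩ <;> rw [h40, h41, h6, h7] <;> linarith
    · rcases hcase with ⟨h6, h7, h8⟩ | ⟨h6, h7, h8⟩ <;> rw [h40, h41, h6, h7] <;> omega
    · rcases hcase with ⟨h6, h7, h8⟩ | ⟨h6, h7, h8⟩ <;> rw [h40, h41, h6, h7] <;> omega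
  have hvar : ∀ (T H y : ℕ), y < 20 ∨ 24 < y → ((level T H).run s).var y = s.var y :=
    fun T H y hy => run_var (fun h => by have := mem_writtenVars_level h; omega) s
  have h0 : s.var 0 = n := hs.loaded.var_n
  have h1 : s.var 1 = m := hs.loaded.var_m
  have h5 : s.var 5 = ρ + 1 := hs.loaded.var_r
  rw [advance, run_seq]
  by_cases hle : (Expr.le (.var 40) (.var 41)).Holds s
  · rw [run_cond_of_holds hle]
    rw [Expr.holds_le] at hle
    have hpr := (progress_level hs.loaded.swap hI' (by rw [hs.arr_ed]; exact hed)
      (by rw [hs.arr_ed, hs.arr_d]; exact hp.symm)).symm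
    rw [hs.arr_ed, hs.arr_d] at hpr
    refine key 5 4 _ _ _ (by simp only [run, State.setVar_arr]) ?_ ?_ ?_ ?_ ?_ hpr
      (Or.inl ⟨rfl, rfl, hle⟩)
    all_goals simp [run, State.setVar, Expr.eval, hvar, h0, h1, h5]
    all_goals omega
  · rw [run_cond_of_not_holds hle]
    rw [Expr.holds_le, not_le] at hle
    have hpr := progress_level hs.loaded hI (by rw [hs.arr_ed]; exact hed)
      (by rw [hs.arr_ed, hs.arr_d]; exact hp)
    rw [hs.arr_ed, hs.arr_d] at hpr
    refine key 4 5 _ _ _ (by simp only [run, State.setVar_arr]) ?_ ?_ ?_ ?_ ?_ hpr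
      (Or.inr ⟨rfl, rfl, hle⟩)
    all_goals simp [run, State.setVar, Expr.eval, hvar, h0, h1, h5]
    all_goals omega

def mainLoop : Cmd := count 29 .verts (cond (.var 5) advance skip)

theorem running_mainLoop
    (hG : Bridgefree t h rev {j | j < 2 * m} (support (2 * m) g) {x | x < n})
    (hed : ∀ i < 2 * m, ∀ j < 2 * m, ed i = ed j → i = j ∨ i = rev j) (hn : R ≤ n)
    (hs : Running n m t h rev g ed d c R R s) :
    Running n m t h rev g ed d c R 0 (mainLoop.run s) := by
  have key := count_induction (x := 29) (b := .verts) (s := s) (p := cond (.var 5) advance skip)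
    (fun k σ => Running n m t h rev g ed d c R (R - k) σ) (hs.setVar (by omega) (by omega)) ?_
  · rw [Bound.val, hs.loaded.var_n, Nat.sub_eq_zero_of_le hn] at key
    exact key
  intro k σ hk hσ _ ih
  refine Running.setVar ?_ (by omega) (by omega)
  have h5 : σ.var 5 = R - k := ih.loaded.var_r
  by_cases h : (Expr.var 5).Holds σ
  · rw [run_cond_of_holds h]
    change σ.var 5 ≠ 0 at h
    obtain ⟨ρ, hρ⟩ : ∃ ρ, R - k = ρ + 1 := ⟨R - k - 1, by omega⟩
    rw [hρ] at ih
    rw [show R - (k + 1) = ρ by omega]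
    exact running_advance hG hed (by omega) ih
  · rw [run_cond_of_not_holds h]
    have h' : σ.var 5 = 0 := not_not.1 h
    rw [show R - (k + 1) = R - k by omega]
    exact ih

/-- Absorb the center, and initialize the bounds on the distances. -/
def start : Cmd :=
  seq (fill 22 .verts 10 (.neg (.ne (.var 22) (.var 28)))) (seq (assign 40 (.lit 0))
    (assign 41 (.lit 0)))

def main : Cmd := seq init (seq findCenter (seq start mainLoop))

theorem wellFormed_main : main.WellFormed := by
  have h29 : ∀ T H, 29 ∉ (level T H).writtenVars := fun T H h => by
    have := mem_writtenVars_level h; omega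
  simp [main, init, findCenter, tryCenter, start, mainLoop, advance, fillIf, fill, flag, WellFormed,
    wellFormed_level, writtenVars, bfs, relax, scatter, h29]

theorem running_start (hs : Loaded 4 5 ⟨n, m, R, t, h, rev, g, s.arr 10⟩ s)
    (hed : s.arr 8 = ed) (hd : s.arr 9 = d) (hc : s.var 28 < n) (hcen : Central s (s.var 28) R) :
    Running n m t h rev g ed d (s.var 28) R R (start.run s) := by
  obtain ⟨f, hf⟩ : ∃ f, start.run s = f := ⟨_, rfl⟩
  have hag : Agree [22, 40, 41] [10] s f := agree_of_run hf
  have h40 : f.var 40 = 0 := by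
    rw [← hf, start, run_seq, run_seq]; simp [run, State.setVar, Expr.eval]
  have h41 : f.var 41 = 0 := by
    rw [← hf, start, run_seq, run_seq]; simp [run, State.setVar, Expr.eval]
  have hA : support n (f.arr 10) = {s.var 28} := by
    ext y
    rw [support, Set.mem_ofPred_eq, ← hf, start, run_seq, run_seq]
    simp only [run.eq_2, State.setVar_arr]
    rw [run_fill (by simp [Expr.neg, Expr.ne, Expr.readArrs]), Bound.val, hs.var_n]
    by_cases hy : y < n
    · rw [if_pos hy]
      change _ ∧ Expr.Holds _ _ ↔ _
      simp only [Expr.holds_neg, Expr.holds_ne, Expr.eval, State.setVar_var_self, hy, true_and,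
        not_not, Set.mem_singleton_iff]
      rw [State.setVar_var_ne _ _ (by omega)]
    · simp only [hy, false_and, Set.mem_singleton_iff, false_iff]
      rintro rfl; exact hy hc
  rw [Central, hs.var_n, hs.var_m, hs.arr_t, hs.arr_h, hs.arr_g] at hcen
  rw [hf]
  refine ⟨⟨(hag.1 0 (by simp)).trans hs.var_n, (hag.1 1 (by simp)).trans hs.var_m,
    (hag.1 5 (by simp)).trans hs.var_r, (hag.2 4 (by simp)).trans hs.arr_t,
    (hag.2 5 (by simp)).trans hs.arr_h, (hag.2 6 (by simp)).trans hs.arr_g,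
    (hag.2 7 (by simp)).trans hs.arr_rev, rfl, by omega, by omega, by omega, by omega⟩,
    (hag.2 8 (by simp)).trans hed, (hag.2 9 (by simp)).trans hd, ?_, ?_, ?_, ?_⟩
  · rw [hA]
    exact ⟨by simpa using hc, fun x hx => (hcen x hx).1, fun x hx => (hcen x hx).2,
      subset_reach, subset_reach⟩
  · rw [h40, h41]; ring
  · rw [h40, h41]; omega
  · rw [h40, h41]; omega

end Cmd

end RAM

namespace MixedMultigraph

variable {V E V' E' : Type*} {G : MixedMultigraph V E} {G' : MixedMultigraph V' E'} {u v w : V}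
  {k l r : ℕ}

theorem HasWalk.append (h : G.HasWalk k u v) (h' : G.HasWalk l v w) : G.HasWalk (k + l) u w := by
  induction h with
  | nil u => rwa [zero_add]
  | cons e he _ ih => rw [Nat.add_right_comm]; exact .cons e he (ih h')

theorem HasWalk.map {f : V → V'}
    (hf : ∀ e u v, G.Traverses e u v → ∃ e', G'.Traverses e' (f u) (f v)) (h : G.HasWalk k u v) :
    G'.HasWalk k (f u) (f v) := by
  induction h with
  | nil u => exact .nil _
  | cons e he _ ih => obtain ⟨e', he'⟩ := hf _ _ _ he; exact .cons e' he' ih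

theorem HasWalk.exists_crossing (h : G.HasWalk k u v) {B : Set V} (hu : u ∈ B) (hv : v ∉ B) :
    ∃ e x y, G.Traverses e x y ∧ x ∈ B ∧ y ∉ B := by
  induction h with
  | nil u => exact absurd hu hv
  | @cons k u w v e he _ ih =>
    by_cases hw : w ∈ B
    · exact ih hw hv
    · exact ⟨e, u, w, he, hu, hw⟩

theorem edist_le_iff : G.edist u v ≤ k ↔ ∃ i ≤ k, G.HasWalk i u v := by
  rw [← ENat.lt_natCast_add_one_iff, edist, iInf_lt_iff]
  simp only [iInf_lt_iff, ENat.lt_natCast_add_one_iff, Nat.cast_le, exists_prop]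
  exact exists_congr fun i => and_comm

/-- All vertices are within distance `k` from `u`, and `u` is within distance `k` from them. -/
def IsCenter (G : MixedMultigraph V E) (u : V) (k : ℕ) : Prop :=
  ∀ v, (∃ i ≤ k, G.HasWalk i u v) ∧ ∃ i ≤ k, G.HasWalk i v u

theorem radius_le_iff : G.radius ≤ k ↔ ∃ u, G.IsCenter u k := by
  rw [← ENat.lt_natCast_add_one_iff, radius, iInf_lt_iff]
  simp only [ENat.lt_natCast_add_one_iff, ecc, outEcc, inEcc, max_le_iff, iSup_le_iff, edist_le_iff,
    IsCenter, forall_and]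

theorem IsCenter.stronglyConnected (h : G.IsCenter u k) : G.StronglyConnected := fun x y => by
  obtain ⟨i, -, hi⟩ := (h x).2
  obtain ⟨j, -, hj⟩ := (h y).1
  exact ⟨_, hi.append hj⟩

theorem IsCenter.map (h : G.IsCenter u k) {f : V → V'} (hf : f.Surjective)
    (hG : ∀ e u v, G.Traverses e u v → ∃ e', G'.Traverses e' (f u) (f v)) :
    G'.IsCenter (f u) k := by
  intro v
  obtain ⟨v, rfl⟩ := hf v
  obtain ⟨⟨i, hi, h1⟩, j, hj, h2⟩ := h v
  exact ⟨⟨i, hi, h1.map hG⟩, j, hj, h2.map hG⟩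

/-- The graph `G` with other names for its vertices and edges. -/
def relabel (G : MixedMultigraph V E) (f : V ≃ V') (g : E ≃ E') : MixedMultigraph V' E' where
  fst e := f (G.fst (g.symm e))
  snd e := f (G.snd (g.symm e))
  directed e := G.directed (g.symm e)

theorem Traverses.relabel {e : E} (h : G.Traverses e u v) (f : V ≃ V') (g : E ≃ E') :
    (G.relabel f g).Traverses (g e) (f u) (f v) := by
  simpa [Traverses, MixedMultigraph.relabel] using h

theorem Bridgeless.relabel (h : G.Bridgeless) (f : V ≃ V') (g : E ≃ E') :
    (G.relabel f g).Bridgeless := by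
  rintro e ⟨he, hconn⟩
  refine h (g.symm e) ⟨he, fun hc => hconn fun x y => ?_⟩
  obtain ⟨k, hk⟩ := hc (f.symm x) (f.symm y)
  refine ⟨k, ?_⟩
  have := hk.map (G' := ((G.relabel f g).deleteEdge e).underlying) (f := f) ?_
  · simpa using this
  · rintro ⟨e', he'⟩ u v ht
    refine ⟨⟨g e', fun h => he' (by rw [← h, g.symm_apply_apply])⟩, ?_⟩
    simpa [Traverses, underlying, deleteEdge, MixedMultigraph.relabel] using ht

theorem Traverses.of_orient_relabel {f : V ≃ V'} {g : E ≃ E'} {σ : E' → Bool} {e : E'} {u v : V'}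
    (h : ((G.relabel f g).orient σ).Traverses e u v) :
    (G.orient (σ ∘ g)).Traverses (g.symm e) (f.symm u) (f.symm v) := by
  obtain ⟨rfl, rfl⟩ | ⟨h, -⟩ := h
  · refine Or.inl ?_
    cases hd : G.directed (g.symm e) <;> cases hσ : σ e <;>
      simp [orient, MixedMultigraph.relabel, hd, hσ]
  · exact absurd h Bool.true_eq_false_eq_False

end MixedMultigraph

namespace RAM

open ArcSystem MixedMultigraph

variable {n m : ℕ} {G : MixedMultigraph (Fin n) (Fin m)} {t h rev g ed d : ℕ → ℕ}

/-- The arcs encode the graph: edge `e` yields the arcs `e` from its first to its second endpoint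
and `e + m` in the other direction, the latter being absent if the edge is directed. -/
structure Encodes (G : MixedMultigraph (Fin n) (Fin m)) (t h rev g ed d : ℕ → ℕ) : Prop where
  t_fwd (e : Fin m) : t e = G.fst e
  t_bwd (e : Fin m) : t (e + m) = G.snd e
  h_fwd (e : Fin m) : h e = G.snd e
  h_bwd (e : Fin m) : h (e + m) = G.fst e
  g_fwd (e : Fin m) : g e ≠ 0
  g_bwd (e : Fin m) : g (e + m) ≠ 0 ↔ G.directed e = false
  rev_fwd (e : Fin m) : rev e = e + m
  rev_bwd (e : Fin m) : rev (e + m) = e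
  ed_fwd (e : Fin m) : ed e = e
  ed_bwd (e : Fin m) : ed (e + m) = e
  d_fwd (e : Fin m) : d e = 0
  d_bwd (e : Fin m) : d (e + m) ≠ 0

theorem exists_edge {j : ℕ} (hj : j < 2 * m) : ∃ e : Fin m, j = e ∨ j = e + m := by
  by_cases h : j < m
  · exact ⟨⟨j, h⟩, Or.inl rfl⟩
  · exact ⟨⟨j - m, by omega⟩, Or.inr (by simp only; omega)⟩

namespace Encodes

variable (hG : Encodes G t h rev g ed d)
include hG

theorem fwd_mem (e : Fin m) : (e : ℕ) ∈ support (2 * m) g := ⟨by omega, hG.g_fwd e⟩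

theorem bwd_mem {e : Fin m} (he : G.directed e = false) : (e + m : ℕ) ∈ support (2 * m) g :=
  ⟨by omega, (hG.g_bwd e).2 he⟩

theorem eq_or_eq_rev {i j : ℕ} (hi : i < 2 * m) (hj : j < 2 * m) (hij : ed i = ed j) :
    i = j ∨ i = rev j := by
  obtain ⟨e, rfl | rfl⟩ := exists_edge hi <;> obtain ⟨e', rfl | rfl⟩ := exists_edge hj <;>
    simp only [hG.ed_fwd, hG.ed_bwd, hG.rev_fwd, hG.rev_bwd] at hij ⊢ <;> omega

theorem bridgefree (hB : G.Bridgeless) :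
    Bridgefree t h rev {j | j < 2 * m} (support (2 * m) g) {x | x < n} where
  subset := fun j hj => hj.1
  tail_mem := fun j hj => by
    obtain ⟨e, rfl | rfl⟩ := exists_edge hj
    · rw [hG.t_fwd]; exact (G.fst e).2
    · rw [hG.t_bwd]; exact (G.snd e).2
  rev_mem := fun j hj => by
    rw [Set.mem_ofPred_eq]
    obtain ⟨e, rfl | rfl⟩ := exists_edge hj
    · rw [hG.rev_fwd]; omega
    · rw [hG.rev_bwd]; omega
  rev_rev := fun j hj => by
    obtain ⟨e, rfl | rfl⟩ := exists_edge hj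
    · rw [hG.rev_fwd, hG.rev_bwd]
    · rw [hG.rev_bwd, hG.rev_fwd]
  tail_rev := fun j hj => by
    obtain ⟨e, rfl | rfl⟩ := exists_edge hj
    · rw [hG.rev_fwd, hG.t_bwd, hG.h_fwd]
    · rw [hG.rev_bwd, hG.t_fwd, hG.h_bwd]
  crossing := by
    intro a ha hra B h1 h2
    have key : ∀ (e : Fin m) (x y : Fin n), G.directed e = false → (x : ℕ) ∈ B → (y : ℕ) ∉ B →
        ∃ b ∈ support (2 * m) g, b ≠ e ∧ b ≠ e + m ∧
          ((t b ∈ B ∧ h b ∉ B) ∨ (t b ∉ B ∧ h b ∈ B)) := by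
      intro e x y he hx hy
      have hconn : (G.deleteEdge e).underlying.StronglyConnected :=
        not_not.1 fun hc => hB e ⟨he, hc⟩
      obtain ⟨k, hk⟩ := hconn x y
      obtain ⟨⟨e', he'⟩, x', y', htr, hx', hy'⟩ :=
        hk.exists_crossing (B := {z : Fin n | (z : ℕ) ∈ B}) hx hy
      rw [Set.mem_ofPred_eq] at hx' hy'
      refine ⟨e', hG.fwd_mem e', fun h => he' (Fin.ext h), by omega, ?_⟩
      rw [hG.t_fwd, hG.h_fwd]
      rcases htr with ⟨rfl, rfl⟩ | ⟨-, rfl, rfl⟩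
      · exact Or.inl ⟨hx', hy'⟩
      · exact Or.inr ⟨hy', hx'⟩
    obtain ⟨e, rfl | rfl⟩ := exists_edge ha.1
    · rw [hG.t_fwd] at h1
      rw [hG.h_fwd] at h2
      rw [hG.rev_fwd] at hra ⊢
      exact key e _ _ ((hG.g_bwd e).1 hra.2) h1 h2
    · rw [hG.t_bwd] at h1
      rw [hG.h_bwd] at h2
      rw [hG.rev_bwd]
      obtain ⟨b, hb, h3, h4, h5⟩ := key e _ _ ((hG.g_bwd e).1 ha.2) h1 h2
      exact ⟨b, hb, h4, h3, h5⟩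

theorem mem_reach_of_hasWalk {k : ℕ} {u v : Fin n} (hw : G.HasWalk k u v) :
    (v : ℕ) ∈ reach t h (support (2 * m) g) {(u : ℕ)} k := by
  induction hw with
  | nil u => exact Set.mem_singleton _
  | @cons k u v w e he _ ih =>
    rw [add_comm]
    refine reach_trans ?_ ih
    rcases he with ⟨rfl, rfl⟩ | ⟨hd, rfl, rfl⟩
    · rw [← hG.h_fwd, ← hG.t_fwd]
      exact reach_step (hG.fwd_mem e) (Set.mem_singleton _)
    · rw [← hG.h_bwd, ← hG.t_bwd]
      exact reach_step (hG.bwd_mem hd) (Set.mem_singleton _)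

theorem hasWalk_of_mem_reach {σ : ℕ → ℕ} {W : Set ℕ}
    (hW : W ⊆ orientedArcs (support (2 * m) g) ed d σ) {k : ℕ} {u : Fin n} {y : ℕ}
    (hy : y ∈ reach t h W {(u : ℕ)} k) :
    ∃ v : Fin n, y = v ∧ ∃ i ≤ k, (G.orient fun e => decide (σ e ≠ 0)).HasWalk i u v := by
  induction k generalizing y with
  | zero => exact ⟨u, hy, 0, le_rfl, .nil u⟩
  | succ k ih =>
    rcases hy with hy | ⟨j, hj, hty, rfl⟩
    · obtain ⟨v, hv, i, hi, hw⟩ := ih hy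
      exact ⟨v, hv, i, by omega, hw⟩
    · obtain ⟨v, hv, i, hi, hw⟩ := ih hty
      obtain ⟨hjG, hjσ⟩ := hW hj
      obtain ⟨e, rfl | rfl⟩ := exists_edge hjG.1
      · rw [hG.ed_fwd, hG.d_fwd] at hjσ
        rw [hG.t_fwd] at hv
        refine ⟨G.snd e, hG.h_fwd e, i + 1, by omega, hw.append (.cons e (Or.inl ?_) (.nil _))⟩
        have : σ e = 0 := by simpa using hjσ
        simpa [orient, this] using Fin.ext hv
      · have hd := (hG.g_bwd e).1 hjG.2
        have hσ : σ e ≠ 0 := by rw [hG.ed_bwd] at hjσ; exact hjσ.2 (hG.d_bwd e)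
        rw [hG.t_bwd] at hv
        refine ⟨G.fst e, hG.h_bwd e, i + 1, by omega, hw.append (.cons e (Or.inl ?_) (.nil _))⟩
        simpa [orient, hd, hσ] using Fin.ext hv

end Encodes

namespace Cmd

theorem encodes_init (G : MixedMultigraph (Fin n) (Fin m)) {s : State}
    (hs : init.run (input G) = s) :
    Encodes G (s.arr 4) (s.arr 5) (s.arr 7) (s.arr 6) (s.arr 8) (s.arr 9) := by
  have h1 : (input G).var 1 = m := rfl
  have h2 : ∀ e : Fin m, (input G).arr 0 e = G.fst e := fun e => by simp [input]
  have h3 : ∀ e : Fin m, (input G).arr 1 e = G.snd e := fun e => by simp [input]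
  have h4 : ∀ e : Fin m, (input G).arr 2 e = (G.directed e).toNat := fun e => by simp [input]
  have hf := fun e : Fin m => run_init (input G) (j := e) (by omega)
  have hb := fun e : Fin m => run_init (input G) (j := e + m) (by omega)
  simp only [hs, h1, Fin.is_lt, if_true, h2, h3, h4, Nat.add_sub_cancel,
    Nat.not_lt.2 (Nat.le_add_left m _), if_false] at hf hb
  exact ⟨fun e => (hf e).1, fun e => (hb e).1, fun e => (hf e).2.1, fun e => (hb e).2.1,
    fun e => by rw [(hf e).2.2.1]; omega,
    fun e => by rw [(hb e).2.2.1]; cases G.directed e <;> simp,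
    fun e => (hf e).2.2.2.1, fun e => (hb e).2.2.2.1, fun e => (hf e).2.2.2.2.1,
    fun e => (hb e).2.2.2.2.1, fun e => (hf e).2.2.2.2.2,
    fun e => by rw [(hb e).2.2.2.2.2]; omega⟩

theorem isCenter_main (hB : G.Bridgeless) {u : Fin n} {r : ℕ} (hu : G.IsCenter u r) :
    ∃ c k, (G.orient (output m (main.run (input G)))).IsCenter c k ∧
      2 * k ≤ 3 * r ^ 2 + 2 * r + 2 := by
  rw [main, run_seq, run_seq, run_seq]
  obtain ⟨s, hs⟩ : ∃ s, init.run (input G) = s := ⟨_, rfl⟩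
  obtain ⟨s', hs'⟩ : ∃ s', findCenter.run s = s' := ⟨_, rfl⟩
  rw [hs, hs']
  have hE := encodes_init G hs
  have hbf := hE.bridgefree hB
  have hv : ∀ y < 2, s.var y = (input G).var y := fun y hy => by
    rw [← hs, run_var (by rw [writtenVars_init]; simp; omega)]
  have h0 : s.var 0 = n := hv 0 (by omega)
  have h1 : s.var 1 = m := hv 1 (by omega)
  have hv' : ∀ y < 2, s'.var y = s.var y := fun y hy => by
    rw [← hs', run_var (by rw [writtenVars_findCenter]; simp; omega)]
  have ha' : ∀ y < 30, s'.arr y = s.arr y := fun y hy => by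
    rw [← hs', run_arr (by rw [writtenArrs_findCenter]; simp; omega)]
  have hcen : Central s u (min r n) := by
    have hne := Set.singleton_nonempty (u : ℕ)
    have hsub : ({(u : ℕ)} : Set ℕ) ⊆ {x | x < n} := Set.singleton_subset_iff.2 u.2
    intro x hx
    rw [h0] at hx
    rw [h1]
    obtain ⟨⟨i, hi, hwi⟩, j, hj, hwj⟩ := hu ⟨x, hx⟩
    have hri := reach_mono_right hi (hE.mem_reach_of_hasWalk hwi)
    have hrj := reach_mono_right hj (reach_symm.1 (hE.mem_reach_of_hasWalk hwj))
    rcases le_total r n with hrn | hrn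
    · rw [min_eq_left hrn]; exact ⟨hri, hrj⟩
    · rw [min_eq_right hrn]
      exact ⟨reach_subset_reach_card hsub hne (fun a ha => hbf.head_mem (hbf.subset ha)) r hri,
        reach_subset_reach_card hsub hne (fun a ha => hbf.tail_mem a (hbf.subset ha)) r hrj⟩
  have hn := u.2
  obtain ⟨hc1, hc2, hc3⟩ := run_findCenter (s := s)
    (fun j hj => by rw [h0]; rw [h1] at hj; exact hbf.tail_mem j hj)
    (fun j hj => by rw [h0]; rw [h1] at hj; exact hbf.head_mem (E := {j | j < 2 * m}) hj)
    (by rw [h0]; exact hn) (by rw [h0]; omega) hcen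
  rw [hs'] at hc1 hc2 hc3
  rw [h0] at hc1
  have hcen' : Central s' (s'.var 28) (s'.var 5) := by
    rw [Central, hv' 0 (by omega), hv' 1 (by omega), ha' 4 (by omega), ha' 5 (by omega),
      ha' 6 (by omega)]
    exact hc3
  have hrun := running_mainLoop hbf
    (fun i hi j hj hij => hE.eq_or_eq_rev hi hj hij) (by omega)
    (running_start (s := s') (n := n) (m := m) (R := s'.var 5) ⟨(hv' 0 (by omega)).trans h0,
      (hv' 1 (by omega)).trans h1,
      rfl, ha' 4 (by omega), ha' 5 (by omega), ha' 6 (by omega), ha' 7 (by omega), rfl,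
      by omega, by omega, by omega, by omega⟩ (ha' 8 (by omega)) (ha' 9 (by omega)) hc1 hcen')
  obtain ⟨f, hf⟩ : ∃ f, mainLoop.run (start.run s') = f := ⟨_, rfl⟩
  rw [hf] at hrun ⊢
  obtain ⟨R, hR⟩ : ∃ R, s'.var 5 = R := ⟨_, rfl⟩
  rw [hR] at hrun hc2
  have hall : ∀ v : Fin n, (v : ℕ) ∈ support n (f.arr 10) := fun v => hrun.progress.near v.2
  have hsub : {j | j ∈ orientedArcs (support (2 * m) (s.arr 6)) (s.arr 8) (s.arr 9) (f.arr 3) ∧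
      s.arr 4 j ∈ support n (f.arr 10) ∧ s.arr 5 j ∈ support n (f.arr 10)} ⊆
      orientedArcs (support (2 * m) (s.arr 6)) (s.arr 8) (s.arr 9) (f.arr 3) := fun j hj => hj.1
  refine ⟨⟨s'.var 28, hc1⟩, max (f.var 40) (f.var 41), fun v => ⟨?_, ?_⟩, ?_⟩
  · obtain ⟨v', hv', i, hi, hw⟩ := hE.hasWalk_of_mem_reach (u := ⟨s'.var 28, hc1⟩) hsub
      (hrun.progress.out (hall v))
    obtain rfl := Fin.ext hv'
    exact ⟨i, hi.trans (le_max_left _ _), hw⟩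
  · obtain ⟨v', hv', i, hi, hw⟩ := hE.hasWalk_of_mem_reach (u := v) hsub
      (reach_symm.2 (hrun.progress.into (hall v)))
    obtain rfl : (⟨s'.var 28, hc1⟩ : Fin n) = v' := Fin.ext hv'
    exact ⟨i, hi.trans (le_max_right _ _), hw⟩
  · have h3 := hrun.total
    have h4 := hrun.balance
    have h5 := hrun.balance'
    have hRr : R ≤ r := by omega
    have h6 : R ^ 2 ≤ r ^ 2 := Nat.pow_le_pow_left hRr 2
    omega

end Cmd

end RAM

namespace MixedMultigraph

theorem exists_orient_isCenter {V E : Type*} [Finite V] [Finite E] {G : MixedMultigraph V E}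
    (hB : G.Bridgeless) {r : ℕ} (hr : G.radius ≤ r) :
    ∃ σ c k, (G.orient σ).IsCenter c k ∧ 2 * k ≤ 3 * r ^ 2 + 2 * r + 2 := by
  obtain ⟨u, hu⟩ := radius_le_iff.1 hr
  let f := Finite.equivFin V
  let g := Finite.equivFin E
  obtain ⟨c, k, hc, hk⟩ := RAM.Cmd.isCenter_main (hB.relabel f g)
    (hu.map f.surjective fun e _ _ he => ⟨g e, he.relabel f g⟩)
  exact ⟨_, _, k, hc.map f.symm.surjective fun e _ _ he => ⟨_, he.of_orient_relabel⟩, hk⟩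

theorem toENNReal_le_of_le {x : ℕ∞} {k r : ℕ} (hx : x ≤ k) (hk : 2 * k ≤ 3 * r ^ 2 + 2 * r + 2) :
    (x : ℝ≥0∞) ≤ 3 / 2 * (r : ℝ≥0∞) ^ 2 + r + 1 := by
  have h1 : (x : ℝ≥0∞) ≤ k := by simpa using ENat.toENNReal_le.2 hx
  refine h1.trans ?_
  rw [← ENNReal.mul_le_mul_iff_right (a := 2) (by simp) (by simp)]
  have h2 : (2 : ℝ≥0∞) * (3 / 2) = 3 := ENNReal.mul_div_cancel (by simp) (by simp)
  rw [mul_add, mul_add, ← mul_assoc, h2, mul_one]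
  exact_mod_cast hk

end MixedMultigraph

/-- The bound on the smallest admissible oriented radius, its meaning for each single graph, and a
polynomial-time algorithm that finds such an orientation. -/
theorem theorem1 :
    (∀ r : ℕ, (MixedMultigraph.worstOrientedRadius r : ℝ≥0∞) ≤ 3 / 2 * (r : ℝ≥0∞) ^ 2 + r + 1) ∧
    (∀ (V : Type*) (E : Type*) [Finite V] [Finite E] (G : MixedMultigraph V E) (r : ℕ),
      G.StronglyConnected → G.Bridgeless → G.radius = r →
        ∃ σ : E → Bool, (G.orient σ).StronglyConnected ∧
          ((G.orient σ).radius : ℝ≥0∞) ≤ 3 / 2 * (r : ℝ≥0∞) ^ 2 + r + 1) ∧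
    (∃ (p : RAM.Program) (T : Polynomial ℕ),
      ∀ (n m : ℕ) (G : MixedMultigraph (Fin n) (Fin m)) (r : ℕ),
        G.StronglyConnected → G.Bridgeless → G.radius = r →
          ∃ (s : RAM.State) (t : ℕ), RAM.Exec p (RAM.input G) s t ∧ t ≤ T.eval (n + m) ∧
            (G.orient (RAM.output m s)).StronglyConnected ∧
            ((G.orient (RAM.output m s)).radius : ℝ≥0∞) ≤ 3 / 2 * (r : ℝ≥0∞) ^ 2 + r + 1) := by
  refine ⟨fun r => ?_, fun V E _ _ G r _ hB hr => ?_, RAM.Cmd.main.compile,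
    RAM.Cmd.main.timeBound, fun n m G r _ hB hr => ?_⟩
  · refine MixedMultigraph.toENNReal_le_of_le (k := (3 * r ^ 2 + 2 * r + 2) / 2)
      (sInf_le fun V E _ _ G _ hB hr => ?_) (by omega)
    obtain ⟨σ, c, k, hc, hk⟩ := MixedMultigraph.exists_orient_isCenter hB hr.le
    exact ⟨σ, hc.stronglyConnected,
      (MixedMultigraph.radius_le_iff.2 ⟨c, hc⟩).trans (Nat.cast_le.2 (by omega))⟩
  · obtain ⟨σ, c, k, hc, hk⟩ := MixedMultigraph.exists_orient_isCenter hB hr.le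
    exact ⟨σ, hc.stronglyConnected,
      MixedMultigraph.toENNReal_le_of_le (MixedMultigraph.radius_le_iff.2 ⟨c, hc⟩) hk⟩
  · obtain ⟨u, hu⟩ := MixedMultigraph.radius_le_iff.1 hr.le
    obtain ⟨c, k, hc, hk⟩ := RAM.Cmd.isCenter_main hB hu
    obtain ⟨t, ht, hexec⟩ := RAM.Cmd.main.exec_compile RAM.Cmd.wellFormed_main (RAM.input G)
    exact ⟨_, t, hexec, ht, hc.stronglyConnected,
      MixedMultigraph.toENNReal_le_of_le (MixedMultigraph.radius_le_iff.2 ⟨c, hc⟩) hk⟩
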